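/- Let $n\ge 0$ and let $f=e^{\psi}$ be a smooth ($C^\infty$) density on $\mathbb{R}^{n+1}$ that is radial, i.e. $\psi(x)=\delta(|x|)$ for all $x$. The weighted volume of a set $\Omega\subset\mathbb{R}^{n+1}$ is $\mathrm{vol}(\Omega)=\int_\Omega f\,dv$ (Lebesgue measure) and its weighted perimeter is $P(\Omega)=\int_{\partial\Omega} f\,da$ ($n$-dimensional Hausdorff measure). A variation is a family $\{\varphi_t\}_{|t|<\varepsilon}$, $\varepsilon>0$, of diffeomorphisms of $\mathbb{R}^{n+1}$, smooth in $(t,x)$ jointly, with $\varphi_0=\mathrm{id}$; it preserves the volume of $\Omega$ if $V(t)=\mathrm{vol}(\varphi_t(\Omega))$ is constant for small $t$. Put $P(t)=P(\varphi_t(\Omega))$. The set $\Omega$ is called stationary if, for every variation that preserves its volume, $P(t)$ is finite for small $t$, is differentiable at $0$, and satisfies $P'(0)=0$. It is called stable if it is stationary and, for every such variation, $P$ is $C^2$ near $0$ and $P''(0)\ge 0$. Then, for every $r>0$, the open ball of radius $r$ centered at the origin is stable if and only if $\delta''(r)\ge 0$. In particular, if $f$ is also log-convex (i.e. $\psi$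 is convex on $\mathbb{R}^{n+1}$), then all open balls centered at the origin are stable. -/

import Mathlib

open Set Filter Topology MeasureTheory
open scoped ENNReal ContDiff

/-- The weighted volume of `Ω ⊆ ℝⁿ⁺¹` for the density `e^ψ`, with respect to Lebesgue measure. -/
noncomputable def weightedVolume {n : ℕ} (ψ : EuclideanSpace ℝ (Fin (n + 1)) → ℝ)
    (Ω : Set (EuclideanSpace ℝ (Fin (n + 1)))) : ℝ≥0∞ :=
  ∫⁻ x in Ω, ENNReal.ofReal (Real.exp (ψ x))

/-- The weighted perimeter of `Ω ⊆ ℝⁿ⁺¹` for the density `e^ψ`: the integral of `e^ψ` over the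
topological boundary of `Ω`, with respect to the `n`-dimensional Hausdorff measure, normalized so
that it is the usual `n`-dimensional area. -/
noncomputable def weightedPerimeter {n : ℕ} (ψ : EuclideanSpace ℝ (Fin (n + 1)) → ℝ)
    (Ω : Set (EuclideanSpace ℝ (Fin (n + 1)))) : ℝ≥0∞ :=
  ∫⁻ x in frontier Ω, ENNReal.ofReal (Real.exp (ψ x)) ∂(μHE[n])

/-- A one-parameter variation `{φ_t}`, `|t| < ε`, of `ℝⁿ⁺¹`: a family of diffeomorphisms of
`ℝⁿ⁺¹`, jointly smooth in `(t, x)`, that starts at the identity. Values `φ t` with `|t| ≥ ε`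
are irrelevant. -/
structure IsVariation {n : ℕ} (ε : ℝ)
    (φ : ℝ → EuclideanSpace ℝ (Fin (n + 1)) → EuclideanSpace ℝ (Fin (n + 1))) : Prop where
  pos : 0 < ε
  smooth : ContDiffOn ℝ ∞
    (fun p : ℝ × EuclideanSpace ℝ (Fin (n + 1)) => φ p.1 p.2) (Ioo (-ε) ε ×ˢ univ)
  zero : ∀ x, φ 0 x = x
  diffeo : ∀ t ∈ Ioo (-ε) ε,
    ∃ χ : EuclideanSpace ℝ (Fin (n + 1)) → EuclideanSpace ℝ (Fin (n + 1)),
      ContDiff ℝ ∞ χ ∧ Function.LeftInverse χ (φ t) ∧ Function.RightInverse χ (φ t)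

/-- The variation `φ` preserves the weighted volume of `Ω`: `V(t) = vol (φ_t(Ω))` is constant for
small `t`. -/
def PreservesVolume {n : ℕ} (ψ : EuclideanSpace ℝ (Fin (n + 1)) → ℝ)
    (Ω : Set (EuclideanSpace ℝ (Fin (n + 1))))
    (φ : ℝ → EuclideanSpace ℝ (Fin (n + 1)) → EuclideanSpace ℝ (Fin (n + 1))) : Prop :=
  ∀ᶠ t in 𝓝 (0 : ℝ), weightedVolume ψ (φ t '' Ω) = weightedVolume ψ Ω

/-- The perimeter function `P(t) = P(φ_t(Ω))` of a variation, as a real-valued function. -/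
noncomputable def perimeterFunction {n : ℕ} (ψ : EuclideanSpace ℝ (Fin (n + 1)) → ℝ)
    (Ω : Set (EuclideanSpace ℝ (Fin (n + 1))))
    (φ : ℝ → EuclideanSpace ℝ (Fin (n + 1)) → EuclideanSpace ℝ (Fin (n + 1))) (t : ℝ) : ℝ :=
  (weightedPerimeter ψ (φ t '' Ω)).toReal

/-- `Ω` is stationary: for each volume-preserving variation, `P(t)` is finite for small `t`,
differentiable at `0`, and `P'(0) = 0`. -/
def IsStationaryRegion {n : ℕ} (ψ : EuclideanSpace ℝ (Fin (n + 1)) → ℝ)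
    (Ω : Set (EuclideanSpace ℝ (Fin (n + 1)))) : Prop :=
  ∀ (ε : ℝ) (φ : ℝ → EuclideanSpace ℝ (Fin (n + 1)) → EuclideanSpace ℝ (Fin (n + 1))),
    IsVariation ε φ → PreservesVolume ψ Ω φ →
      (∀ᶠ t in 𝓝 (0 : ℝ), weightedPerimeter ψ (φ t '' Ω) ≠ ⊤) ∧
        HasDerivAt (perimeterFunction ψ Ω φ) 0 0

/-- `Ω` is stable: it is stationary and, for each volume-preserving variation, `P(t)` is `C²` near
`0` and `P''(0) ≥ 0`. -/
def IsStableRegion {n : ℕ} (ψ : EuclideanSpace ℝ (Fin (n + 1)) → ℝ)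
    (Ω : Set (EuclideanSpace ℝ (Fin (n + 1)))) : Prop :=
  IsStationaryRegion ψ Ω ∧
    ∀ (ε : ℝ) (φ : ℝ → EuclideanSpace ℝ (Fin (n + 1)) → EuclideanSpace ℝ (Fin (n + 1))),
      IsVariation ε φ → PreservesVolume ψ Ω φ →
        ContDiffAt ℝ 2 (perimeterFunction ψ Ω φ) 0 ∧
          0 ≤ iteratedDeriv 2 (perimeterFunction ψ Ω φ) 0

/-! For small `t` the image of the ball is star-shaped, `{|x| < R(t, x/|x|)}`, with `R` smooth and
`R(0, ·) = r`. Put `A(s) = e^{δ(s)} s^n` and let `σ` be the cone measure of the unit sphere. In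
polar coordinates the volume is `∫ F(R) dσ` with `F' = A`, and the area formula gives the perimeter
`c ∫ A(R) √(1 + |∇R|²/R²) dσ`, where `0 < c < ∞`.

Let `u` and `w` be the first and second `t`-derivatives of `R` at `0`, and `H = A'(r)/A(r) = δ'(r) +
n/r`. Constant volume forces `∫ u = 0` and `∫ w = -H ∫ u²`. Then `P'(0) = c A(r) H ∫ u = 0`, so the
ball is stationary, and the terms in `H²` cancel in `P''(0)`, leaving `P''(0) = c A(r) ((δ''(r) -
n/r²) ∫ u² + r⁻² ∫ |∇u|²)` (`IsRadialFunction.second_variation`).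

If `δ''(r) ≥ 0`, the sharp Poincaré inequality `n ∫ u² ≤ ∫ |∇u|²` for mean-zero `u`
(`sphere_poincare`) gives `P''(0) ≥ 0`. Conversely, translating the ball in direction `e`, with a
dilation that restores the volume, realises `u = ⟨θ, e⟩`. Summing the second variations over an
orthonormal basis leaves a positive multiple of `δ''(r)`. If `ψ` is convex, so is its restriction to
a line through the origin, whence `δ'' ≥ 0`.

Three analytic ingredients carry this. The Poincaré inequality is deduced from the Gaussian one,
applied to the extension `|x| u(x/|x|)`; the Gaussian one comes from the line by tensorisation
(`variance_prod_le`). The area formula `setLIntegral_image_sphere` is obtained by differentiating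
measures over small balls, and Hausdorff area is compared with `σ` through uniqueness of
rotation-invariant measures on the sphere. The radial function `R` comes from the inverse function
theorem (`exists_radial_function`). -/

/-! ### Smooth dependence of integrals on parameters. -/

section Parametric

variable {P X F : Type} [NormedAddCommGroup P] [NormedSpace ℝ P]
  [NormedAddCommGroup X] [NormedSpace ℝ X] [MeasurableSpace X] [BorelSpace X]
  [NormedAddCommGroup F] [NormedSpace ℝ F]

/-- The partial derivative is bounded by some `M` on the compact slice over `p`. By compactness of
`K` it stays below `M + 1` for all parameters near `p`, and this constant dominates. -/
theorem hasFDerivAt_setIntegral_of_contDiffOn [SecondCountableTopology X] [CompleteSpace F]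
    {μ : Measure X} [IsFiniteMeasureOnCompacts μ] {U : Set P} {W K : Set X} (hU : IsOpen U)
    (hW : IsOpen W) (hK : IsCompact K) (hKW : K ⊆ W) {G : P × X → F}
    (hG : ContDiffOn ℝ 1 G (U ×ˢ W)) {p : P} (hp : p ∈ U) :
    HasFDerivAt (fun q => ∫ x in K, G (q, x) ∂μ)
      (∫ x in K, (fderiv ℝ G (p, x)).comp (ContinuousLinearMap.inl ℝ P X) ∂μ) p := by
  have hO : IsOpen (U ×ˢ W) := hU.prod hW
  have hD : ContinuousOn (fun z => (fderiv ℝ G z).comp (ContinuousLinearMap.inl ℝ P X))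
      (U ×ˢ W) :=
    (hG.continuousOn_fderiv_of_isOpen hO le_rfl).clm_comp continuousOn_const
  have hslice : ∀ q ∈ U, ContinuousOn (fun x => G (q, x)) K := fun q hq =>
    hG.continuousOn.comp (by fun_prop) fun x hx => ⟨hq, hKW hx⟩
  have hsliceD : ContinuousOn (fun x => (fderiv ℝ G (p, x)).comp
      (ContinuousLinearMap.inl ℝ P X)) K :=
    hD.comp (f := fun x => (p, x)) (by fun_prop) fun x hx => ⟨hp, hKW hx⟩
  obtain ⟨M, hM⟩ := hK.exists_bound_of_continuousOn hsliceD
  have hloc : ∀ᶠ q in 𝓝 p, ∀ x ∈ K,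
      ‖(fderiv ℝ G (q, x)).comp (ContinuousLinearMap.inl ℝ P X)‖ < M + 1 := by
    apply hK.eventually_forall_of_forall_eventually
    intro x hx
    have hc : ContinuousAt (fun z => ‖(fderiv ℝ G z).comp (ContinuousLinearMap.inl ℝ P X)‖)
        (p, x) := (hD.continuousAt (hO.mem_nhds ⟨hp, hKW hx⟩)).norm
    exact hc.eventually_lt_const (lt_of_le_of_lt (hM x hx) (lt_add_one M))
  have hmem : {q | q ∈ U ∧ ∀ x ∈ K,
      ‖(fderiv ℝ G (q, x)).comp (ContinuousLinearMap.inl ℝ P X)‖ < M + 1} ∈ 𝓝 p :=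
    Filter.inter_mem (hU.mem_nhds hp) hloc
  obtain ⟨e, he, hball⟩ := Metric.mem_nhds_iff.1 hmem
  refine (hasFDerivAt_integral_of_dominated_of_fderiv_le (μ := μ.restrict K)
    (F' := fun q x => (fderiv ℝ G (q, x)).comp (ContinuousLinearMap.inl ℝ P X))
    (bound := fun _ => M + 1) (Metric.ball_mem_nhds p he) ?_ ?_ ?_ ?_ ?_ ?_)
  · filter_upwards [hU.mem_nhds hp] with q hq
    exact (hslice q hq).aestronglyMeasurable_of_isCompact hK hK.measurableSet
  · exact (hslice p hp).integrableOn_compact hK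
  · exact hsliceD.aestronglyMeasurable_of_isCompact hK hK.measurableSet
  · filter_upwards [ae_restrict_mem hK.measurableSet] with x hx q hq
    exact ((hball hq).2 x hx).le
  · have : IsFiniteMeasure (μ.restrict K) := ⟨by simpa using hK.measure_lt_top⟩
    exact integrable_const _
  · filter_upwards [ae_restrict_mem hK.measurableSet] with x hx q hq
    have h1 : HasFDerivAt G (fderiv ℝ G (q, x)) (q, x) :=
      ((hG.contDiffAt (hO.mem_nhds ⟨(hball hq).1, hKW hx⟩)).differentiableAt
        one_ne_zero).hasFDerivAt
    exact h1.comp q (hasFDerivAt_prodMk_left q x)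

/-- The derivative is again a parametric integral, but with values in `P →L[ℝ] F`; the target space
is therefore quantified inside the induction. -/
theorem contDiffOn_setIntegral_nat [SecondCountableTopology X]
    {μ : Measure X} [IsFiniteMeasureOnCompacts μ] {U : Set P} {W K : Set X} (hU : IsOpen U)
    (hW : IsOpen W) (hK : IsCompact K) (hKW : K ⊆ W) (k : ℕ) :
    ∀ {F : Type} [NormedAddCommGroup F] [NormedSpace ℝ F] [CompleteSpace F] {G : P × X → F},
    ContDiffOn ℝ ∞ G (U ×ˢ W) → ContDiffOn ℝ k (fun q => ∫ x in K, G (q, x) ∂μ) U := by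
  induction k with
  | zero =>
    intro F _ _ _ G hG
    exact contDiffOn_zero.2 fun p hp => (hasFDerivAt_setIntegral_of_contDiffOn (μ := μ) hU hW hK hKW
      (hG.of_le (by simp)) hp).continuousAt.continuousWithinAt
  | succ k ih =>
    intro F _ _ _ G hG
    have hder := fun p (hp : p ∈ U) => hasFDerivAt_setIntegral_of_contDiffOn (μ := μ) hU hW hK hKW
      (hG.of_le (by simp)) hp
    push_cast
    rw [contDiffOn_succ_iff_fderiv_of_isOpen hU]
    refine ⟨fun p hp => (hder p hp).differentiableAt.differentiableWithinAt, by simp, ?_⟩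
    refine (ih (G := fun z => (fderiv ℝ G z).comp (ContinuousLinearMap.inl ℝ P X))
      ?_).congr fun p hp => (hder p hp).fderiv
    exact (hG.fderiv_of_isOpen (hU.prod hW) (by simp)).clm_comp contDiffOn_const

theorem contDiffOn_setIntegral [SecondCountableTopology X] [CompleteSpace F]
    {μ : Measure X} [IsFiniteMeasureOnCompacts μ] {U : Set P} {W K : Set X} (hU : IsOpen U)
    (hW : IsOpen W) (hK : IsCompact K) (hKW : K ⊆ W) {G : P × X → F}
    (hG : ContDiffOn ℝ ∞ G (U ×ˢ W)) :
    ContDiffOn ℝ ∞ (fun q => ∫ x in K, G (q, x) ∂μ) U :=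
  contDiffOn_infty.2 fun k => contDiffOn_setIntegral_nat hU hW hK hKW k hG

theorem hasDerivAt_setIntegral_of_contDiffOn [SecondCountableTopology X] [CompleteSpace F]
    {μ : Measure X} [IsFiniteMeasureOnCompacts μ] {U : Set ℝ} {W K : Set X} (hU : IsOpen U)
    (hW : IsOpen W) (hK : IsCompact K) (hKW : K ⊆ W) {G : ℝ × X → F}
    (hG : ContDiffOn ℝ 1 G (U ×ˢ W)) {t : ℝ} (ht : t ∈ U) :
    HasDerivAt (fun q => ∫ x in K, G (q, x) ∂μ) (∫ x in K, fderiv ℝ G (t, x) (1, 0) ∂μ) t := by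
  have h := (hasFDerivAt_setIntegral_of_contDiffOn (μ := μ) hU hW hK hKW hG ht).hasDerivAt
  convert h using 1
  have hD : ContinuousOn (fun x => (fderiv ℝ G (t, x)).comp (ContinuousLinearMap.inl ℝ ℝ X)) K :=
    ((hG.continuousOn_fderiv_of_isOpen (hU.prod hW) le_rfl).clm_comp continuousOn_const).comp
      (f := fun x => (t, x)) (by fun_prop) fun x hx => ⟨ht, hKW hx⟩
  rw [ContinuousLinearMap.integral_apply (hD.integrableOn_compact hK)]
  simp

end Parametric

/-! ### Consequences of the inverse function theorem. -/

section Inverse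

variable {E : Type} [NormedAddCommGroup E] [NormedSpace ℝ E] [FiniteDimensional ℝ E]

theorem exists_equiv_of_injective (A : E →L[ℝ] E) (hA : Function.Injective A) :
    ∃ e : E ≃L[ℝ] E, (e : E →L[ℝ] E) = A :=
  ⟨(LinearEquiv.ofInjectiveEndo (A : E →ₗ[ℝ] E) hA).toContinuousLinearEquiv, by ext; rfl⟩

theorem isOpen_image_of_injective_fderiv {f : E → E} {U : Set E} (hU : IsOpen U)
    (hf : ContDiffOn ℝ ∞ f U) (hd : ∀ x ∈ U, Function.Injective (fderiv ℝ f x)) :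
    IsOpen (f '' U) := by
  rw [isOpen_iff_mem_nhds]
  rintro _ ⟨x, hx, rfl⟩
  have hfx := hf.contDiffAt (hU.mem_nhds hx)
  obtain ⟨e, he⟩ := exists_equiv_of_injective _ (hd x hx)
  have hs : HasStrictFDerivAt f (e : E →L[ℝ] E) x := by
    rw [he]; exact hfx.hasStrictFDerivAt (by simp)
  rw [← hs.map_nhds_eq_of_equiv]
  exact image_mem_map (hU.mem_nhds hx)

/-- No continuity of `g` is assumed. The local inverse takes values in `U` near `f x`, so the
left-inverse identity forces `g` to agree with it there. This makes pointwise choices such as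
`Function.invFunOn` smooth. -/
theorem contDiffOn_leftInverse {f g : E → E} {U : Set E} (hU : IsOpen U)
    (hf : ContDiffOn ℝ ∞ f U) (hd : ∀ x ∈ U, Function.Injective (fderiv ℝ f x))
    (hg : ∀ x ∈ U, g (f x) = x) : ContDiffOn ℝ ∞ g (f '' U) := by
  rintro _ ⟨x, hx, rfl⟩
  have hfx := hf.contDiffAt (hU.mem_nhds hx)
  obtain ⟨e, he⟩ := exists_equiv_of_injective _ (hd x hx)
  have hs : HasFDerivAt f (e : E →L[ℝ] E) x := by
    rw [he]; exact (hfx.differentiableAt (by simp)).hasFDerivAt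
  have hl := hfx.to_localInverse hs (by simp)
  have hss := hfx.hasStrictFDerivAt' hs (by simp)
  refine (hl.congr_of_eventuallyEq ?_).contDiffWithinAt
  have h1 : ∀ᶠ y in 𝓝 (f x), f (hss.localInverse f e x y) = y := hss.eventually_right_inverse
  have h2 : ∀ᶠ y in 𝓝 (f x), hss.localInverse f e x y ∈ U :=
    hss.localInverse_tendsto (hU.mem_nhds hx)
  filter_upwards [h1, h2] with y hy1 hy2
  have := hg _ hy2
  rw [hy1] at this
  exact this

end Inverse

/-! ### Rotation-invariant measures on the unit sphere and polar coordinates. -/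

section RotationInvariant

open scoped Pointwise

set_option linter.unusedSectionVars false

variable {E : Type} [NormedAddCommGroup E] [InnerProductSpace ℝ E] [FiniteDimensional ℝ E]
  [MeasurableSpace E] [BorelSpace E]

/-- A measure on `E` invariant under all linear isometries. -/
def IsRotationInvariant (μ : Measure E) : Prop :=
  ∀ e : E ≃ₗᵢ[ℝ] E, μ.map e = μ

theorem exists_isometry_apply_eq {x y : E} (h : ‖x‖ = ‖y‖) : ∃ e : E ≃ₗᵢ[ℝ] E, e x = y :=
  ⟨Submodule.reflection (Submodule.span ℝ {x - y})ᗮ, Submodule.reflection_sub h⟩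

theorem IsRotationInvariant.measure_closedBall_eq {μ : Measure E} (hμ : IsRotationInvariant μ)
    {x y : E} (h : ‖x‖ = ‖y‖) (r : ℝ) :
    μ (Metric.closedBall x r) = μ (Metric.closedBall y r) := by
  obtain ⟨e, rfl⟩ := exists_isometry_apply_eq h
  conv_rhs => rw [← hμ e]
  rw [Measure.map_apply e.continuous.measurable Metric.isClosed_closedBall.measurableSet]
  congr 1
  ext z
  simp

theorem IsRotationInvariant.add {μ ν : Measure E} (hμ : IsRotationInvariant μ)
    (hν : IsRotationInvariant ν) : IsRotationInvariant (μ + ν) := fun e => by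
  rw [Measure.map_add _ _ e.continuous.measurable, hμ e, hν e]

/-- By Besicovitch differentiation the density is a limit of ratios of measures of small balls.
Rotations act transitively on the sphere, so these ratios do not depend on the centre and the
density is constant almost everywhere. -/
theorem IsRotationInvariant.exists_eq_smul_of_absolutelyContinuous {ρ τ : Measure E}
    [IsFiniteMeasure ρ] [IsFiniteMeasure τ] (hρ : IsRotationInvariant ρ)
    (hτ : IsRotationInvariant τ) (hS : τ (Metric.sphere 0 1)ᶜ = 0) (hac : ρ ≪ τ) :
    ∃ c : ℝ≥0∞, ρ = c • τ := by
  rcases eq_or_ne τ 0 with h0 | h0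
  · refine ⟨0, ?_⟩
    rw [zero_smul]
    exact Measure.measure_univ_eq_zero.1 (hac (by simp [h0]))
  have hlim := Besicovitch.ae_tendsto_rnDeriv ρ τ
  have hmem : ∀ᵐ x ∂τ, x ∈ Metric.sphere (0 : E) 1 := hS
  have : NeBot (ae τ) := ae_neBot.2 h0
  obtain ⟨x₀, hx₀, hx₀S⟩ := (hlim.and hmem).exists
  refine ⟨ρ.rnDeriv τ x₀, ?_⟩
  conv_lhs => rw [← Measure.withDensity_rnDeriv_eq ρ τ hac]
  rw [← withDensity_const]
  apply withDensity_congr_ae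
  filter_upwards [hlim, hmem] with x hx hxS
  refine tendsto_nhds_unique hx (hx₀.congr fun r => ?_)
  have hn : ‖x₀‖ = ‖x‖ := by simp_all
  rw [hρ.measure_closedBall_eq hn, hτ.measure_closedBall_eq hn]

/-- Both measures are absolutely continuous with respect to their sum, which makes them multiples of
a common measure. The cross-multiplied form covers zero measures as well. -/
theorem IsRotationInvariant.smul_eq_smul {μ ν : Measure E}
    [IsFiniteMeasure μ] [IsFiniteMeasure ν] (hμ : IsRotationInvariant μ)
    (hν : IsRotationInvariant ν) (hμS : μ (Metric.sphere 0 1)ᶜ = 0)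
    (hνS : ν (Metric.sphere 0 1)ᶜ = 0) : ν univ • μ = μ univ • ν := by
  have hS : (μ + ν) (Metric.sphere 0 1)ᶜ = 0 := by simp [hμS, hνS]
  obtain ⟨a, ha⟩ := hμ.exists_eq_smul_of_absolutelyContinuous (hμ.add hν) hS
    (Measure.le_add_right le_rfl).absolutelyContinuous
  obtain ⟨b, hb⟩ := hν.exists_eq_smul_of_absolutelyContinuous (hμ.add hν) hS
    (Measure.le_add_left le_rfl).absolutelyContinuous
  generalize μ + ν = τ at *
  rw [ha, hb]
  simp only [Measure.smul_apply, smul_smul, smul_eq_mul]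
  congr 1
  ring

variable (E) in
/-- The cone measure of the unit sphere, as a measure on the ambient space. -/
noncomputable def sphereMeasure : Measure E :=
  (volume : Measure E).toSphere.map Subtype.val

instance : IsFiniteMeasure (sphereMeasure E) := by
  unfold sphereMeasure; infer_instance

theorem sphereMeasure_apply {A : Set E} (hA : MeasurableSet A) :
    sphereMeasure E A =
      Module.finrank ℝ E * volume (Ioo (0 : ℝ) 1 • (A ∩ Metric.sphere (0 : E) 1)) := by
  rw [sphereMeasure, Measure.map_apply measurable_subtype_coe hA,
    Measure.toSphere_apply' _ (measurable_subtype_coe hA), Subtype.image_preimage_coe, inter_comm]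

theorem sphereMeasure_compl : sphereMeasure E (Metric.sphere (0 : E) 1)ᶜ = 0 := by
  rw [sphereMeasure_apply Metric.isClosed_sphere.measurableSet.compl]
  simp

theorem sphereMeasure_restrict :
    (sphereMeasure E).restrict (Metric.sphere (0 : E) 1) = sphereMeasure E :=
  Measure.restrict_eq_self_of_ae_mem sphereMeasure_compl

theorem ae_sphereMeasure_norm_eq_one : ∀ᵐ x ∂(sphereMeasure E), ‖x‖ = 1 := by
  have h : ∀ᵐ x ∂(sphereMeasure E), x ∈ Metric.sphere (0 : E) 1 := sphereMeasure_compl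
  simpa using h

theorem sphereMeasure_ne_zero [Nontrivial E] : sphereMeasure E ≠ 0 := by
  rw [sphereMeasure, Ne, Measure.map_eq_zero_iff measurable_subtype_coe.aemeasurable]
  exact Measure.toSphere_ne_zero _

/-- The cone over a rotated set is the rotated cone, and Lebesgue measure is invariant under
isometries. -/
theorem isRotationInvariant_sphereMeasure : IsRotationInvariant (sphereMeasure E) := by
  intro e
  ext A hA
  have he : Measurable e := e.continuous.measurable
  rw [Measure.map_apply he hA, sphereMeasure_apply (he hA), sphereMeasure_apply hA]
  have h := (e.measurePreserving).measure_preimage_equiv (f := e.toHomeomorph.toMeasurableEquiv)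
    (Ioo (0 : ℝ) 1 • (A ∩ Metric.sphere (0 : E) 1))
  rw [← h]
  congr 2
  ext x
  simp only [Set.mem_smul, mem_inter_iff, mem_preimage, mem_sphere_iff_norm, sub_zero]
  constructor
  · rintro ⟨s, hs, y, ⟨hy, hy1⟩, rfl⟩
    exact ⟨s, hs, e y, ⟨hy, by simpa using hy1⟩, by simp⟩
  · rintro ⟨s, hs, y, ⟨hy, hy1⟩, h⟩
    refine ⟨s, hs, e.symm y, ⟨by simpa using hy, by simpa using hy1⟩, ?_⟩
    apply e.injective
    have h' : s • y = e x := h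
    simp [h']

theorem lintegral_eq_lintegral_sphereMeasure [Nontrivial E] {f : E → ℝ≥0∞} (hf : Measurable f) :
    ∫⁻ x, f x = ∫⁻ θ, (∫⁻ s in Ioi (0 : ℝ),
      ENNReal.ofReal (s ^ (Module.finrank ℝ E - 1)) * f (s • θ)) ∂(sphereMeasure E) := by
  have hmp := (volume : Measure E).measurePreserving_homeomorphUnitSphereProd
  have hms : Measurable fun p : Metric.sphere (0 : E) 1 × Ioi (0 : ℝ) => f (p.2.1 • p.1.1) := by
    fun_prop
  have hmeas : Measurable fun θ : E => ∫⁻ s in Ioi (0 : ℝ),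
      ENNReal.ofReal (s ^ (Module.finrank ℝ E - 1)) * f (s • θ) := by
    apply Measurable.lintegral_prod_right' (f := fun p : E × ℝ =>
      ENNReal.ofReal (p.2 ^ (Module.finrank ℝ E - 1)) * f (p.2 • p.1))
    fun_prop
  rw [sphereMeasure, lintegral_map hmeas measurable_subtype_coe]
  calc ∫⁻ x, f x = ∫⁻ x in ({0}ᶜ : Set E), f x := by
        rw [restrict_compl_singleton]
    _ = ∫⁻ x : ({0}ᶜ : Set E), f x ∂((volume : Measure E).comap Subtype.val) :=
        (lintegral_subtype_comap (measurableSet_singleton _).compl _).symm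
    _ = ∫⁻ p, f (p.2.1 • p.1.1) ∂((volume : Measure E).toSphere.prod
          (Measure.volumeIoiPow (Module.finrank ℝ E - 1))) := by
        rw [← hmp.lintegral_comp hms]
        refine lintegral_congr fun x => ?_
        have hx : ‖(x : E)‖ ≠ 0 := norm_ne_zero_iff.2 x.2
        congr 1
        have := congrArg Subtype.val ((homeomorphUnitSphereProd E).symm_apply_apply x)
        rw [homeomorphUnitSphereProd_symm_apply_coe] at this
        exact this.symm
    _ = _ := by
        rw [lintegral_prod _ hms.aemeasurable]
        refine lintegral_congr fun θ => ?_
        rw [Measure.volumeIoiPow, lintegral_withDensity_eq_lintegral_mul _ (by fun_prop)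
          (by fun_prop), ← lintegral_subtype_comap measurableSet_Ioi]
        rfl

end RotationInvariant

/-! ### Comparing Hausdorff measures of nearly isometric images. -/

section Comparison

/-- The inequality makes `g x ↦ f x` a well-defined `K`-Lipschitz map on `g '' A`, even if `g` is
not injective; the section `s` realises it. -/
theorem euclideanHausdorffMeasure_image_le_of_norm_le {X E F : Type} [NormedAddCommGroup E]
    [MeasurableSpace E] [BorelSpace E] [NormedAddCommGroup F] [MeasurableSpace F] [BorelSpace F]
    {f : X → E} {g : X → F} {A : Set X} {K : NNReal}
    (h : ∀ x ∈ A, ∀ y ∈ A, ‖f x - f y‖ ≤ K * ‖g x - g y‖) (d : ℕ) :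
    μHE[d] (f '' A) ≤ (K : ℝ≥0∞) ^ d * μHE[d] (g '' A) := by
  rcases A.eq_empty_or_nonempty with rfl | ⟨a, ha⟩
  · simp
  have : Nonempty X := ⟨a⟩
  set s := Function.invFunOn g A with hs
  have hsA : ∀ x ∈ A, s (g x) ∈ A ∧ g (s (g x)) = g x := fun x hx =>
    ⟨Function.invFunOn_mem ⟨x, hx, rfl⟩, Function.invFunOn_eq ⟨x, hx, rfl⟩⟩
  have hfs : ∀ x ∈ A, f (s (g x)) = f x := fun x hx => by
    have := h _ (hsA x hx).1 x hx
    rw [(hsA x hx).2, sub_self, norm_zero, mul_zero] at this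
    exact sub_eq_zero.1 (norm_le_zero_iff.1 this)
  have hl : LipschitzOnWith K (f ∘ s) (g '' A) := by
    rw [lipschitzOnWith_iff_norm_sub_le]
    rintro _ ⟨x, hx, rfl⟩ _ ⟨y, hy, rfl⟩
    simp only [Function.comp_apply, hfs x hx, hfs y hy]
    exact h x hx y hy
  have him : (f ∘ s) '' (g '' A) = f '' A := by
    rw [image_image]
    exact image_congr hfs
  have := hl.hausdorffMeasure_image_le (d := d) (by positivity)
  rw [him] at this
  simp only [Measure.euclideanHausdorffMeasure_def, Measure.smul_apply, ENNReal.smul_def,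
    smul_eq_mul]
  calc _ ≤ _ := mul_le_mul_right this _
    _ = _ := by rw [ENNReal.rpow_natCast]; ring

variable {E : Type} [NormedAddCommGroup E] [InnerProductSpace ℝ E] [FiniteDimensional ℝ E]

/-- On the unit sphere near `θ`, a map strictly differentiable at `θ` is close to the composition
of its derivative with the orthogonal projection to the tangent space. -/
theorem exists_nhds_norm_sub_le_tangent {Θ : E → E} {T : E →L[ℝ] E} {θ : E} (hθ : ‖θ‖ = 1)
    (hΘ : HasStrictFDerivAt Θ T θ)
    (hT : ∀ v ∈ (Submodule.span ℝ {θ})ᗮ, T v = 0 → v = 0) {K : ℝ} (hK : 1 < K) :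
    ∃ U : Set E, IsOpen U ∧ θ ∈ U ∧
      ∀ x ∈ U ∩ Metric.sphere 0 1, ∀ y ∈ U ∩ Metric.sphere 0 1,
      ‖Θ x - Θ y‖ ≤ K * ‖T ((Submodule.span ℝ {θ})ᗮ.orthogonalProjectionOnto x) -
          T ((Submodule.span ℝ {θ})ᗮ.orthogonalProjectionOnto y)‖ ∧
      ‖T ((Submodule.span ℝ {θ})ᗮ.orthogonalProjectionOnto x) -
          T ((Submodule.span ℝ {θ})ᗮ.orthogonalProjectionOnto y)‖ ≤ K * ‖Θ x - Θ y‖ := by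
  set W := (Submodule.span ℝ {θ})ᗮ with hW
  obtain ⟨m, hm, hmT⟩ : ∃ m > 0, ∀ v : W, m * ‖v‖ ≤ ‖T v‖ := by
    have hinj : Function.Injective (T.comp W.subtypeL) := by
      rw [injective_iff_map_eq_zero]
      intro v hv
      exact Subtype.ext (hT v v.2 hv)
    obtain ⟨k, hk, hka⟩ := (T.comp W.subtypeL).toLinearMap.exists_antilipschitzWith
      (LinearMap.ker_eq_bot.2 hinj)
    refine ⟨(k : ℝ)⁻¹, by positivity, fun v => ?_⟩
    have := hka.le_mul_dist v 0
    simp only [dist_zero_right, map_zero] at this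
    rw [inv_mul_le_iff₀ (by positivity)]
    exact this
  set M := ‖T‖
  have hM : 0 ≤ M := norm_nonneg _
  -- Chosen so that `1 + κ ≤ K` and `K * (1 - κ) = 1`: a relative error `κ` then gives both
  -- inequalities with the same `K`.
  set κ := (K - 1) / K with hκ
  have hκ0 : 0 < κ := div_pos (by linarith) (by linarith)
  -- The bound `1 / 2` ensures `‖z‖ ≤ 2 * ‖p‖`; the other one turns the total error `η * (1 + M) *
  -- ‖z‖` into at most `κ * ‖T p‖`.
  set η := min (1 / 2) (κ * m / (2 * (1 + M))) with hη
  have hη0 : 0 < η := by positivity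
  have h1 : ∀ᶠ p : E × E in 𝓝 (θ, θ), ‖Θ p.1 - Θ p.2 - T (p.1 - p.2)‖ ≤ η * ‖p.1 - p.2‖ :=
    hΘ.isLittleO.bound hη0
  have h2 : ∀ᶠ p : E × E in 𝓝 (θ, θ), ‖θ - (2 : ℝ)⁻¹ • (p.1 + p.2)‖ < η := by
    have hc : Continuous fun p : E × E => ‖θ - (2 : ℝ)⁻¹ • (p.1 + p.2)‖ := by fun_prop
    apply hc.continuousAt.eventually_lt_const
    simpa [← two_smul ℝ θ, smul_smul] using hη0
  obtain ⟨U, hU, hUo, hθU, hUsub⟩ : ∃ U : Set E, U ∈ 𝓝 θ ∧ IsOpen U ∧ θ ∈ U ∧ ∀ x ∈ U, ∀ y ∈ U,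
      ‖Θ x - Θ y - T (x - y)‖ ≤ η * ‖x - y‖ ∧ ‖θ - (2 : ℝ)⁻¹ • (x + y)‖ < η := by
    have h12 := h1.and h2
    rw [nhds_prod_eq] at h12
    obtain ⟨t, ht, h⟩ := Filter.mem_prod_same_iff.1 h12
    obtain ⟨U, hUt, hUo, hU⟩ := mem_nhds_iff.1 ht
    exact ⟨U, hUo.mem_nhds hU, hUo, hU, fun x hx y hy =>
      h (mk_mem_prod (hUt hx) (hUt hy))⟩
  refine ⟨U, hUo, hθU, ?_⟩
  rintro x ⟨hx, hxS⟩ y ⟨hy, hyS⟩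
  obtain ⟨ha, hb⟩ := hUsub x hx y hy
  rw [← map_sub, ← Submodule.coe_sub, ← map_sub]
  set z := x - y
  set p : W := W.orthogonalProjectionOnto z with hp
  have hz : z = inner ℝ θ z • θ + (p : E) := by
    have := Submodule.starProjection_add_starProjection_orthogonal (K := Submodule.span ℝ {θ}) z
    rw [Submodule.starProjection_unit_singleton ℝ hθ] at this
    exact this.symm
  -- A chord `x - y` of the sphere is orthogonal to `x + y`, so its component along `θ` only sees
  -- the distance from `θ` to the midpoint.
  have hin : |inner ℝ θ z| ≤ η * ‖z‖ := by
    have h0 : inner ℝ (x + y) z = 0 := by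
      have := real_inner_add_sub_eq_zero_iff x y
      rw [this, mem_sphere_zero_iff_norm.1 hxS, mem_sphere_zero_iff_norm.1 hyS]
    have : inner ℝ θ z = inner ℝ (θ - (2 : ℝ)⁻¹ • (x + y)) z := by
      rw [inner_sub_left, inner_smul_left, h0]; simp
    rw [this]
    exact (abs_real_inner_le_norm _ _).trans (by gcongr)
  have hzp : ‖z - p‖ ≤ η * ‖z‖ := by
    have : z - p = inner ℝ θ z • θ := by
      rw [sub_eq_iff_eq_add]; exact hz
    rw [this, norm_smul, hθ, mul_one]
    exact hin
  have hz2 : ‖z‖ ≤ 2 * ‖p‖ := by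
    have h3 : ‖z‖ ≤ ‖z - p‖ + ‖(p : E)‖ := by simpa using norm_add_le (z - p) (p : E)
    have h4 : η * ‖z‖ ≤ 1 / 2 * ‖z‖ := by gcongr; exact min_le_left _ _
    have h5 : ‖(p : E)‖ = ‖p‖ := rfl
    linarith
  have hz3 : ‖z‖ ≤ 2 / m * ‖T p‖ := by
    have := hmT p
    calc ‖z‖ ≤ 2 * ‖p‖ := hz2
      _ = 2 / m * (m * ‖p‖) := by field_simp
      _ ≤ _ := by gcongr
  have hmain : ‖(Θ x - Θ y) - T p‖ ≤ κ * ‖T p‖ := by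
    have : (Θ x - Θ y) - T p = (Θ x - Θ y - T z) + T (z - p) := by
      rw [map_sub T z p]; abel
    rw [this]
    calc _ ≤ η * ‖z‖ + M * (η * ‖z‖) := by
          refine (norm_add_le _ _).trans (add_le_add ha ((T.le_opNorm _).trans ?_))
          gcongr
      _ = η * (1 + M) * ‖z‖ := by ring
      _ ≤ (κ * m / (2 * (1 + M))) * (1 + M) * (2 / m * ‖T p‖) := by
          gcongr
          exact min_le_right _ _
      _ = κ * ‖T p‖ := by field_simp
  have hK0 : 0 < K := by linarith
  have hκ1 : 1 + κ ≤ K := by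
    rw [hκ]
    have : (K - 1) / K ≤ K - 1 := div_le_self (by linarith) hK.le
    linarith
  have hκ2 : K * (1 - κ) = 1 := by rw [hκ]; field_simp; ring
  constructor
  · calc ‖Θ x - Θ y‖ ≤ ‖(Θ x - Θ y) - T p‖ + ‖T p‖ := by
          simpa using norm_add_le ((Θ x - Θ y) - T p) (T p)
      _ ≤ (1 + κ) * ‖T p‖ := by linarith
      _ ≤ _ := by gcongr
  · have : ‖T p‖ ≤ ‖(Θ x - Θ y) - T p‖ + ‖Θ x - Θ y‖ := by
      have := norm_sub_le (Θ x - Θ y) ((Θ x - Θ y) - T p)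
      simp only [sub_sub_cancel] at this
      linarith
    calc ‖T p‖ = K * ((1 - κ) * ‖T p‖) := by rw [← mul_assoc, hκ2, one_mul]
      _ ≤ _ := by gcongr; linarith

end Comparison

/-! ### The Jacobian determinant of a radial graph. -/

section NormDet

variable {W E : Type} [NormedAddCommGroup E] [InnerProductSpace ℝ E]
   [NormedAddCommGroup W] [InnerProductSpace ℝ W] [FiniteDimensional ℝ W]

/-- In an orthonormal basis the Gram matrix is `ρ²` times a rank-one perturbation of the identity,
and the matrix determinant lemma applies. -/
theorem normDet_sq_of_inner_eq (f : W →ₗ[ℝ] E) (g : W) {ρ : ℝ} (hρ : 0 < ρ)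
    (hf : ∀ v w, inner ℝ (f v) (f w) = ρ ^ 2 * inner ℝ v w + inner ℝ g v * inner ℝ g w) :
    f.normDet ^ 2 = (ρ ^ 2) ^ Module.finrank ℝ W * (1 + ‖g‖ ^ 2 / ρ ^ 2) := by
  classical
  set b := stdOrthonormalBasis ℝ W
  have h := f.normDet_sq_eq_det_gram b
  have hm : Matrix.gram ℝ (fun i => f (b i)) = (ρ ^ 2) • ((1 : Matrix _ _ ℝ) +
      Matrix.replicateCol Unit (fun i => inner ℝ g (b i) / ρ) *
      Matrix.replicateRow Unit (fun i => inner ℝ g (b i) / ρ)) := by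
    ext i j
    simp only [Matrix.gram_apply, hf, Matrix.smul_apply, Matrix.add_apply, Matrix.one_apply,
      Matrix.mul_apply, Matrix.replicateCol_apply, Matrix.replicateRow_apply, Finset.univ_unique,
      Finset.sum_const, Finset.card_singleton, one_smul, smul_eq_mul,
      orthonormal_iff_ite.1 b.orthonormal]
    field_simp
  have h' : f.normDet ^ 2 = (Matrix.gram ℝ (fun i => f (b i))).det := by
    simpa [Function.comp_def] using h
  rw [h', hm, Matrix.det_smul, Matrix.det_one_add_replicateCol_mul_replicateRow, Fintype.card_fin,
    dotProduct]
  congr 2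
  rw [← b.sum_sq_norm_inner_left g, Finset.sum_div]
  refine Finset.sum_congr rfl fun i _ => ?_
  rw [Real.norm_eq_abs, sq_abs]
  field_simp

end NormDet

/-! ### Hausdorff measure on the sphere, locally and globally. -/

section SphereArea

set_option linter.unusedSectionVars false

variable {E : Type} [NormedAddCommGroup E] [InnerProductSpace ℝ E] [FiniteDimensional ℝ E]
  [MeasurableSpace E] [BorelSpace E]

/-- The Jacobian of a linear map on the hyperplane orthogonal to `θ`. -/
noncomputable def tangentJacobian (T : E →L[ℝ] E) (θ : E) : ℝ :=
  (T.toLinearMap ∘ₗ (Submodule.span ℝ {θ})ᗮ.subtype).normDet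

theorem tangentJacobian_id (θ : E) : tangentJacobian (ContinuousLinearMap.id ℝ E) θ = 1 := by
  have : (ContinuousLinearMap.id ℝ E).toLinearMap ∘ₗ (Submodule.span ℝ {θ})ᗮ.subtype =
      (Submodule.span ℝ {θ})ᗮ.subtype := rfl
  rw [tangentJacobian, this, LinearMap.normDet_subtype]

variable {n : ℕ} [Fact (Module.finrank ℝ E = n + 1)]

theorem finrank_tangent {θ : E} (hθ : ‖θ‖ = 1) :
    Module.finrank ℝ (Submodule.span ℝ {θ})ᗮ = n :=
  Submodule.finrank_orthogonal_span_singleton (norm_ne_zero_iff.1 (by rw [hθ]; exact one_ne_zero))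

/-- Near `θ` the map is `K`-bi-Lipschitz comparable with `T` after projection to the tangent
hyperplane, where the Hausdorff measure of a linear image is known exactly. Each comparison costs a
factor `K ^ n`. -/
theorem exists_nhds_hausdorff_projection {Θ : E → E} {T : E →L[ℝ] E} {θ : E} (hθ : ‖θ‖ = 1)
    (hΘ : HasStrictFDerivAt Θ T θ)
    (hT : ∀ v ∈ (Submodule.span ℝ {θ})ᗮ, T v = 0 → v = 0) {K : NNReal} (hK : 1 < K) :
    ∃ U : Set E, IsOpen U ∧ θ ∈ U ∧ ∀ A ⊆ U ∩ Metric.sphere 0 1,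
      μHE[n] (Θ '' A) ≤ (K : ℝ≥0∞) ^ n * (ENNReal.ofReal (tangentJacobian T θ) *
        volume ((Submodule.span ℝ {θ})ᗮ.orthogonalProjectionOnto '' A)) ∧
      ENNReal.ofReal (tangentJacobian T θ) *
        volume ((Submodule.span ℝ {θ})ᗮ.orthogonalProjectionOnto '' A) ≤
          (K : ℝ≥0∞) ^ n * μHE[n] (Θ '' A) := by
  obtain ⟨U, hU, hθU, h⟩ := exists_nhds_norm_sub_le_tangent hθ hΘ hT (K := K) (by exact_mod_cast hK)
  refine ⟨U, hU, hθU, fun A hA => ?_⟩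
  have him : μHE[n] ((fun x => T ((Submodule.span ℝ {θ})ᗮ.orthogonalProjectionOnto x)) '' A) =
      ENNReal.ofReal (tangentJacobian T θ) *
        volume ((Submodule.span ℝ {θ})ᗮ.orthogonalProjectionOnto '' A) := by
    have := LinearMap.euclideanHausdorffMeasure_image_eq_normDet_mul_volume
      (T.toLinearMap ∘ₗ (Submodule.span ℝ {θ})ᗮ.subtype)
      ((Submodule.span ℝ {θ})ᗮ.orthogonalProjectionOnto '' A)
    rw [finrank_tangent (n := n) hθ, image_image] at this
    exact this
  rw [← him]
  exact ⟨euclideanHausdorffMeasure_image_le_of_norm_le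
      (fun x hx y hy => (h x (hA hx) y (hA hy)).1) n,
    euclideanHausdorffMeasure_image_le_of_norm_le (fun x hx y hy => (h x (hA hx) y (hA hy)).2) n⟩

/-- Applying the projection estimate to the identity as well eliminates the projected volume; two
comparisons produce the exponent `2 * n`. -/
theorem exists_nhds_hausdorff_image {Θ : E → E} {T : E →L[ℝ] E} {θ : E} (hθ : ‖θ‖ = 1)
    (hΘ : HasStrictFDerivAt Θ T θ)
    (hT : ∀ v ∈ (Submodule.span ℝ {θ})ᗮ, T v = 0 → v = 0) {K : NNReal} (hK : 1 < K) :
    ∃ U : Set E, IsOpen U ∧ θ ∈ U ∧ ∀ A ⊆ U ∩ Metric.sphere 0 1,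
      μHE[n] (Θ '' A) ≤ (K : ℝ≥0∞) ^ (2 * n) *
        (ENNReal.ofReal (tangentJacobian T θ) * μHE[n] A) ∧
      ENNReal.ofReal (tangentJacobian T θ) * μHE[n] A ≤
        (K : ℝ≥0∞) ^ (2 * n) * μHE[n] (Θ '' A) := by
  obtain ⟨U, hU, hθU, h⟩ := exists_nhds_hausdorff_projection (n := n) hθ hΘ hT hK
  obtain ⟨U', hU', hθU', h'⟩ := exists_nhds_hausdorff_projection (n := n) hθ
    (hasStrictFDerivAt_id (𝕜 := ℝ) θ) (fun v _ hv => hv) hK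
  refine ⟨U ∩ U', hU.inter hU', ⟨hθU, hθU'⟩, fun A hA => ?_⟩
  obtain ⟨h1, h2⟩ := h A fun x hx => ⟨(hA hx).1.1, (hA hx).2⟩
  obtain ⟨h3, h4⟩ := h' A fun x hx => ⟨(hA hx).1.2, (hA hx).2⟩
  rw [tangentJacobian_id] at h3 h4
  simp only [id_eq, image_id', ENNReal.ofReal_one, one_mul] at h3 h4
  set J := ENNReal.ofReal (tangentJacobian T θ)
  rw [two_mul, pow_add]
  constructor
  · calc _ ≤ _ := h1
      _ ≤ (K : ℝ≥0∞) ^ n * (J * ((K : ℝ≥0∞) ^ n * μHE[n] A)) := by gcongr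
      _ = _ := by ring
  · calc J * μHE[n] A ≤ J * ((K : ℝ≥0∞) ^ n *
          volume ((Submodule.span ℝ {θ})ᗮ.orthogonalProjectionOnto '' A)) := by gcongr
      _ = (K : ℝ≥0∞) ^ n * (J *
          volume ((Submodule.span ℝ {θ})ᗮ.orthogonalProjectionOnto '' A)) := by ring
      _ ≤ (K : ℝ≥0∞) ^ n * ((K : ℝ≥0∞) ^ n * μHE[n] (Θ '' A)) := by gcongr
      _ = _ := by ring

theorem euclideanHausdorffMeasure_sphere_lt_top : μHE[n] (Metric.sphere (0 : E) 1) < ⊤ := by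
  refine (isCompact_sphere (0 : E) 1).measure_lt_top_of_nhdsWithin fun θ hθ => ?_
  have hθ1 : ‖θ‖ = 1 := by simpa using hθ
  obtain ⟨U, hU, hθU, h⟩ := exists_nhds_hausdorff_projection (n := n) hθ1
    (hasStrictFDerivAt_id (𝕜 := ℝ) θ) (fun v _ hv => hv) (K := 2) (by norm_num)
  refine ⟨U ∩ Metric.sphere 0 1, Filter.inter_mem (mem_nhdsWithin_of_mem_nhds (hU.mem_nhds hθU))
    self_mem_nhdsWithin, ?_⟩
  have := (h _ subset_rfl).1
  simp only [id_eq, image_id', tangentJacobian_id, ENNReal.ofReal_one, one_mul] at this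
  refine this.trans_lt (ENNReal.mul_lt_top (by finiteness) ?_)
  have hb : Bornology.IsBounded ((Submodule.span ℝ {θ})ᗮ.orthogonalProjectionOnto ''
      (U ∩ Metric.sphere 0 1)) :=
    ((Metric.isBounded_sphere.subset inter_subset_right).image
      (Submodule.span ℝ {θ})ᗮ.orthogonalProjectionOnto)
  exact hb.measure_lt_top

/-- Orthogonal projection to a hyperplane does not increase Hausdorff measure, and the image of the
sphere contains the unit ball of the hyperplane. -/
theorem euclideanHausdorffMeasure_sphere_ne_zero : μHE[n] (Metric.sphere (0 : E) 1) ≠ 0 := by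
  have hfin : Module.finrank ℝ E = n + 1 := Fact.out
  have : Nontrivial E := Module.nontrivial_of_finrank_pos (R := ℝ) (by omega)
  obtain ⟨θ, hθ⟩ := exists_norm_eq E zero_le_one
  set W := (Submodule.span ℝ {θ})ᗮ
  have hW : Module.finrank ℝ W = n := finrank_tangent hθ
  have hle : μHE[n] (W.orthogonalProjectionOnto '' Metric.sphere (0 : E) 1) ≤
      μHE[n] (Metric.sphere (0 : E) 1) := by
    have := euclideanHausdorffMeasure_image_le_of_norm_le (K := 1) (A := Metric.sphere (0 : E) 1)
      (f := W.orthogonalProjectionOnto) (g := id) (fun x _ y _ => by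
        rw [← map_sub]
        simpa using W.norm_orthogonalProjectionOnto_apply_le (x - y)) n
    simpa using this
  intro h0
  rw [h0, nonpos_iff_eq_zero, ← hW, InnerProductSpace.euclideanHausdorffMeasure_eq_volume] at hle
  have hsub : Metric.ball (0 : W) 1 ⊆ W.orthogonalProjectionOnto '' Metric.sphere (0 : E) 1 := by
    intro w hw
    have hw1 : ‖w‖ < 1 := by simpa using hw
    have hin : inner ℝ (w : E) θ = 0 :=
      Submodule.inner_left_of_mem_orthogonal (Submodule.mem_span_singleton_self θ) w.2
    refine ⟨w + √(1 - ‖w‖ ^ 2) • θ, ?_, ?_⟩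
    · have : ‖(w : E) + √(1 - ‖w‖ ^ 2) • θ‖ ^ 2 = 1 := by
        rw [norm_add_sq_real, inner_smul_right, hin, norm_smul, hθ, Real.norm_eq_abs, mul_one,
          sq_abs, Real.sq_sqrt (by nlinarith [norm_nonneg w])]
        simp
      rw [mem_sphere_zero_iff_norm]
      exact (pow_eq_one_iff_of_nonneg (norm_nonneg _) two_ne_zero).1 this
    · rw [map_add, map_smul, Submodule.orthogonalProjectionOnto_mem_subspace_eq_self]
      have : W.orthogonalProjectionOnto θ = 0 := by
        rw [Submodule.orthogonalProjectionOnto_eq_zero_iff]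
        exact Submodule.le_orthogonal_orthogonal _ (Submodule.mem_span_singleton_self θ)
      simp [this]
  exact (Metric.isOpen_ball.measure_pos volume ⟨(0 : W), by simp⟩).ne'
    (measure_mono_null hsub hle)

/-- Both sides are finite rotation-invariant measures on the sphere. The constant is not evaluated:
a positive finite factor does not affect the sign of a second variation. -/
theorem exists_restrict_sphere_eq_smul :
    ∃ c : ℝ≥0∞, c ≠ 0 ∧ c ≠ ⊤ ∧
      (μHE[n] : Measure E).restrict (Metric.sphere 0 1) = c • sphereMeasure E := by
  have hfin : Module.finrank ℝ E = n + 1 := Fact.out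
  have : Nontrivial E := Module.nontrivial_of_finrank_pos (R := ℝ) (by omega)
  set μ := (μHE[n] : Measure E).restrict (Metric.sphere 0 1) with hμ
  have hu : μ univ = μHE[n] (Metric.sphere (0 : E) 1) := by simp [hμ]
  have hf : IsFiniteMeasure μ := ⟨by rw [hu]; exact euclideanHausdorffMeasure_sphere_lt_top⟩
  have hS : MeasurableSet (Metric.sphere (0 : E) 1) := Metric.isClosed_sphere.measurableSet
  have hrot : IsRotationInvariant μ := by
    intro e
    have hmp := (e.toIsometryEquiv.measurePreserving_euclideanHausdorffMeasure n)
    have := hmp.restrict_preimage hS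
    have hpre : e.toIsometryEquiv ⁻¹' (Metric.sphere (0 : E) 1) = Metric.sphere (0 : E) 1 := by
      ext x; simp
    rw [hpre] at this
    exact this.map_eq
  have hσ0 : sphereMeasure E univ ≠ 0 := by
    simpa using sphereMeasure_ne_zero (E := E)
  have h := hrot.smul_eq_smul isRotationInvariant_sphereMeasure (by simp [hμ, hS.compl])
    sphereMeasure_compl
  refine ⟨μ univ / sphereMeasure E univ, ?_, ?_, ?_⟩
  · refine ENNReal.div_ne_zero.2 ⟨?_, measure_ne_top _ _⟩
    rw [hu]
    exact euclideanHausdorffMeasure_sphere_ne_zero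
  · exact ENNReal.div_ne_top (measure_ne_top _ _) hσ0
  · rw [ENNReal.div_eq_inv_mul, ← smul_smul, ← h, smul_smul,
      ENNReal.inv_mul_cancel hσ0 (measure_ne_top _ _), one_smul]

end SphereArea

/-! ### The area formula over the unit sphere. -/

section AreaFormula

variable {E : Type} [NormedAddCommGroup E] [InnerProductSpace ℝ E] [FiniteDimensional ℝ E]
  [MeasurableSpace E] [BorelSpace E] {n : ℕ} [Fact (Module.finrank ℝ E = n + 1)]

/-- **Area formula** for an injective image of the unit sphere. -/
theorem setLIntegral_image_sphere {Θ Ψ : E → E} {T : E → E →L[ℝ] E} (hΘm : Measurable Θ)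
    (hΨm : Measurable Ψ) (hΨ : ∀ θ, ‖θ‖ = 1 → Ψ (Θ θ) = θ)
    (hΘ : ∀ θ, ‖θ‖ = 1 → HasStrictFDerivAt Θ (T θ) θ)
    (hT : ∀ θ, ‖θ‖ = 1 → ∀ v ∈ (Submodule.span ℝ {θ})ᗮ, T θ v = 0 → v = 0)
    {f : E → ℝ≥0∞} (hf : Measurable f) :
    ∫⁻ y in Θ '' Metric.sphere 0 1, f y ∂μHE[n] =
      ∫⁻ θ in Metric.sphere 0 1,
        ENNReal.ofReal (tangentJacobian (T θ) θ) * f (Θ θ) ∂μHE[n] := by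
  set S := Metric.sphere (0 : E) 1 with hSdef
  have hSn : ∀ θ ∈ S, ‖θ‖ = 1 := fun θ hθ => by simpa [hSdef] using hθ
  have hS : MeasurableSet S := Metric.isClosed_sphere.measurableSet
  have hΘS : MeasurableSet (Θ '' S) :=
    ((isCompact_sphere (0 : E) 1).image_of_continuousOn fun θ hθ =>
      (hΘ θ (hSn θ hθ)).continuousAt.continuousWithinAt).isClosed.measurableSet
  set μ := (μHE[n] : Measure E).restrict S with hμ
  have hμfin : IsFiniteMeasure μ :=
    ⟨by simpa [hμ] using euclideanHausdorffMeasure_sphere_lt_top⟩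
  -- Pulling the area of the image back to the sphere reduces the formula to the identification of
  -- the density of `ν` with respect to `μ`.
  set ν := ((μHE[n] : Measure E).restrict (Θ '' S)).map Ψ with hν
  have hνA : ∀ A, MeasurableSet A → ν A = μHE[n] (Θ '' (A ∩ S)) := by
    intro A hA
    rw [hν, Measure.map_apply hΨm hA, Measure.restrict_apply (hΨm hA)]
    congr 1
    ext y
    constructor
    · rintro ⟨hy, θ, hθ, rfl⟩
      exact ⟨θ, ⟨by simpa [hΨ θ (hSn θ hθ)] using hy, hθ⟩, rfl⟩
    · rintro ⟨θ, ⟨hA, hθ⟩, rfl⟩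
      exact ⟨by simpa [hΨ θ (hSn θ hθ)] using hA, θ, hθ, rfl⟩
  have hloc : ∀ K : NNReal, 1 < K → ∀ θ ∈ S, ∃ U : Set E, IsOpen U ∧ θ ∈ U ∧
      ∀ A ⊆ U, MeasurableSet A →
        ν A ≤ (K : ℝ≥0∞) ^ (2 * n) * (ENNReal.ofReal (tangentJacobian (T θ) θ) * μ A) ∧
        ENNReal.ofReal (tangentJacobian (T θ) θ) * μ A ≤ (K : ℝ≥0∞) ^ (2 * n) * ν A := by
    intro K hK θ hθ
    obtain ⟨U, hU, hθU, h⟩ := exists_nhds_hausdorff_image (n := n) (hSn θ hθ) (hΘ θ (hSn θ hθ))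
      (hT θ (hSn θ hθ)) hK
    refine ⟨U, hU, hθU, fun A hA hAm => ?_⟩
    rw [hνA A hAm, hμ, Measure.restrict_apply hAm]
    exact h _ (inter_subset_inter_left _ hA)
  have hνfin : IsFiniteMeasure ν := by
    have hlt : ν S < ⊤ := by
      refine (isCompact_sphere (0 : E) 1).measure_lt_top_of_nhdsWithin fun θ hθ => ?_
      obtain ⟨U, hU, hθU, h⟩ := hloc 2 (by norm_num) θ hθ
      refine ⟨U, mem_nhdsWithin_of_mem_nhds (hU.mem_nhds hθU), ?_⟩
      refine (h U subset_rfl hU.measurableSet).1.trans_lt ?_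
      have := measure_lt_top μ U
      finiteness
    refine ⟨?_⟩
    rwa [hνA univ MeasurableSet.univ, univ_inter, ← inter_self S, ← hνA S hS]
  have hac : ν ≪ μ := by
    refine Measure.AbsolutelyContinuous.mk fun A hA hA0 => ?_
    have hAS : ν A = ν (A ∩ S) := by rw [hνA A hA, hνA _ (hA.inter hS), inter_assoc, inter_self]
    rw [hAS]
    refine measure_null_of_locally_null _ fun θ hθ => ?_
    obtain ⟨U, hU, hθU, h⟩ := hloc 2 (by norm_num) θ hθ.2
    refine ⟨U ∩ (A ∩ S), Filter.inter_mem (mem_nhdsWithin_of_mem_nhds (hU.mem_nhds hθU))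
      self_mem_nhdsWithin, ?_⟩
    have h1 := (h (U ∩ (A ∩ S)) inter_subset_left (hU.measurableSet.inter (hA.inter hS))).1
    have h2 : μ (U ∩ (A ∩ S)) = 0 :=
      measure_mono_null (fun x hx => hx.2.1) hA0
    rw [h2, mul_zero, mul_zero] at h1
    exact nonpos_iff_eq_zero.1 h1
  -- Positivity on balls, needed to form the differentiation quotients, is inherited from the cone
  -- measure.
  have hpos : ∀ x ∈ S, ∀ r > 0, μ (Metric.closedBall x r) ≠ 0 := by
    intro x hx r hr h0
    obtain ⟨c, hc0, -, hc⟩ := exists_restrict_sphere_eq_smul (E := E) (n := n)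
    rw [← hSdef, ← hμ] at hc
    rw [hc, Measure.smul_apply, smul_eq_mul, mul_eq_zero] at h0
    have h1 := h0.resolve_left hc0
    rw [sphereMeasure, Measure.map_apply measurable_subtype_coe
      Metric.isClosed_closedBall.measurableSet] at h1
    have h2 : IsOpen ((Subtype.val : S → E) ⁻¹' Metric.ball x r) :=
      Metric.isOpen_ball.preimage continuous_subtype_val
    refine (h2.measure_pos (volume : Measure E).toSphere ⟨⟨x, hx⟩, by simpa using hr⟩).ne' ?_
    exact measure_mono_null (preimage_mono Metric.ball_subset_closedBall) h1
  -- The quotients over small balls are squeezed between `K ^ (-2n) * J` and `K ^ (2n) * J` for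
  -- every `K > 1`. The radius tends to zero for fixed `K`, and then `K` tends to one.
  have hrn : ∀ᵐ θ ∂μ, ν.rnDeriv μ θ = ENNReal.ofReal (tangentJacobian (T θ) θ) := by
    filter_upwards [Besicovitch.ae_tendsto_rnDeriv ν μ, ae_restrict_mem hS] with θ hlim hθ
    set J := ENNReal.ofReal (tangentJacobian (T θ) θ)
    have hball : ∀ K : NNReal, 1 < K → ∀ᶠ r in 𝓝[>] (0 : ℝ),
        ν (Metric.closedBall θ r) / μ (Metric.closedBall θ r) ≤ (K : ℝ≥0∞) ^ (2 * n) * J ∧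
        J ≤ (K : ℝ≥0∞) ^ (2 * n) *
          (ν (Metric.closedBall θ r) / μ (Metric.closedBall θ r)) := by
      intro K hK
      obtain ⟨U, hU, hθU, h⟩ := hloc K hK θ hθ
      obtain ⟨e, he, hb⟩ := Metric.nhds_basis_closedBall.mem_iff.1 (hU.mem_nhds hθU)
      filter_upwards [Ioc_mem_nhdsGT he] with r hr
      obtain ⟨h1, h2⟩ := h (Metric.closedBall θ r)
        ((Metric.closedBall_subset_closedBall hr.2).trans hb)
        Metric.isClosed_closedBall.measurableSet
      have hm0 := hpos θ hθ r hr.1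
      have hm1 := measure_ne_top μ (Metric.closedBall θ r)
      constructor
      · rw [ENNReal.div_le_iff hm0 hm1, mul_assoc]
        exact h1
      · rw [← mul_div_assoc, ENNReal.le_div_iff_mul_le (Or.inl hm0) (Or.inl hm1)]
        exact h2
    have hK1 : ∀ K : NNReal, 1 < K → ν.rnDeriv μ θ ≤ (K : ℝ≥0∞) ^ (2 * n) * J := fun K hK =>
      le_of_tendsto hlim ((hball K hK).mono fun r hr => hr.1)
    have hK2 : ∀ K : NNReal, 1 < K → J ≤ (K : ℝ≥0∞) ^ (2 * n) * ν.rnDeriv μ θ := fun K hK =>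
      ge_of_tendsto (ENNReal.Tendsto.const_mul hlim (Or.inr (by finiteness)))
        ((hball K hK).mono fun r hr => hr.2)
    have hKlim : ∀ a : ℝ≥0∞, a ≠ ⊤ → Tendsto (fun K : NNReal => (K : ℝ≥0∞) ^ (2 * n) * a)
        (𝓝[>] 1) (𝓝 a) := by
      intro a ha
      have h1 : Tendsto (fun K : NNReal => (K : ℝ≥0∞) ^ (2 * n)) (𝓝[>] 1) (𝓝 1) := by
        have : Continuous fun K : NNReal => ((K ^ (2 * n) : NNReal) : ℝ≥0∞) := by fun_prop
        have h := (this.tendsto 1).mono_left (nhdsWithin_le_nhds (s := Ioi 1))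
        simpa using h
      simpa using ENNReal.Tendsto.mul_const h1 (Or.inr ha)
    have hfin : ν.rnDeriv μ θ ≠ ⊤ := ne_top_of_le_ne_top (by finiteness) (hK1 2 (by norm_num))
    refine le_antisymm ?_ ?_
    · exact ge_of_tendsto (hKlim J (by finiteness)) (eventually_mem_nhdsWithin.mono hK1)
    · exact ge_of_tendsto (hKlim _ hfin) (eventually_mem_nhdsWithin.mono hK2)
  calc ∫⁻ y in Θ '' S, f y ∂μHE[n] = ∫⁻ y in Θ '' S, f (Θ (Ψ y)) ∂μHE[n] := by
        refine setLIntegral_congr_fun hΘS ?_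
        rintro _ ⟨θ, hθ, rfl⟩
        simp only [hΨ θ (hSn θ hθ)]
    _ = ∫⁻ θ, f (Θ θ) ∂ν := (lintegral_map (f := fun y => f (Θ y)) (hf.comp hΘm) hΨm).symm
    _ = ∫⁻ θ, ν.rnDeriv μ θ * f (Θ θ) ∂μ := by
        conv_lhs => rw [← Measure.withDensity_rnDeriv_eq ν μ hac]
        exact lintegral_withDensity_eq_lintegral_mul _ (Measure.measurable_rnDeriv _ _)
          (hf.comp hΘm)
    _ = _ := lintegral_congr_ae (hrn.mono fun θ h => by simp only [h])

/-- The area formula for a radial graph over the unit sphere. -/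
theorem setLIntegral_radialGraph {ρ : E → ℝ} (hρm : Measurable ρ)
    (hρ0 : ∀ θ, ‖θ‖ = 1 → 0 < ρ θ) (hρ : ∀ θ, ‖θ‖ = 1 → ContDiffAt ℝ 1 ρ θ)
    (hrad : ∀ θ, ‖θ‖ = 1 → fderiv ℝ ρ θ θ = 0)
    {f : E → ℝ≥0∞} (hf : Measurable f) :
    ∫⁻ y in (fun x => ρ x • x) '' Metric.sphere 0 1, f y ∂μHE[n] =
      ∫⁻ θ in Metric.sphere 0 1,
        ENNReal.ofReal (ρ θ ^ n * √(1 + ‖fderiv ℝ ρ θ‖ ^ 2 / ρ θ ^ 2)) *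
          f (ρ θ • θ) ∂μHE[n] := by
  set T : E → E →L[ℝ] E := fun θ =>
    ρ θ • ContinuousLinearMap.id ℝ E + (fderiv ℝ ρ θ).smulRight θ with hTdef
  -- On tangent vectors the two summands of `T θ` are orthogonal, one tangential and one along `θ`;
  -- this is the first fundamental form of the graph.
  have hinner : ∀ θ, ‖θ‖ = 1 → ∀ v ∈ (Submodule.span ℝ {θ})ᗮ, ∀ w ∈ (Submodule.span ℝ {θ})ᗮ,
      inner ℝ (T θ v) (T θ w) =
        ρ θ ^ 2 * inner ℝ v w + fderiv ℝ ρ θ v * fderiv ℝ ρ θ w := by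
    intro θ hθ v hv w hw
    have h1 : inner ℝ v θ = 0 :=
      Submodule.inner_left_of_mem_orthogonal (Submodule.mem_span_singleton_self θ) hv
    have h2 : inner ℝ θ w = 0 :=
      Submodule.inner_right_of_mem_orthogonal (Submodule.mem_span_singleton_self θ) hw
    simp only [hTdef, add_apply, smul_apply,
      ContinuousLinearMap.id_apply, ContinuousLinearMap.smulRight_apply, inner_add_left,
      inner_add_right, inner_smul_left, inner_smul_right, h1, h2, real_inner_self_eq_norm_sq, hθ]
    simp
    ring
  have hstrict : ∀ θ, ‖θ‖ = 1 → HasStrictFDerivAt (fun x => ρ x • x) (T θ) θ := fun θ hθ =>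
    ((hρ θ hθ).hasStrictFDerivAt one_ne_zero).smul (hasStrictFDerivAt_id θ)
  have hinj : ∀ θ, ‖θ‖ = 1 → ∀ v ∈ (Submodule.span ℝ {θ})ᗮ, T θ v = 0 → v = 0 := by
    intro θ hθ v hv h0
    have h := hinner θ hθ v hv v hv
    rw [h0, inner_zero_left, real_inner_self_eq_norm_sq] at h
    have h3 : 0 < ρ θ ^ 2 := pow_pos (hρ0 θ hθ) 2
    have h4 : ρ θ ^ 2 * ‖v‖ ^ 2 = 0 := by
      nlinarith [mul_self_nonneg (fderiv ℝ ρ θ v), mul_nonneg h3.le (sq_nonneg ‖v‖)]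
    simpa [h3.ne'] using h4
  have hJ : ∀ θ, ‖θ‖ = 1 → tangentJacobian (T θ) θ =
      ρ θ ^ n * √(1 + ‖fderiv ℝ ρ θ‖ ^ 2 / ρ θ ^ 2) := by
    intro θ hθ
    have hp := hρ0 θ hθ
    set g := (InnerProductSpace.toDual ℝ E).symm (fderiv ℝ ρ θ) with hg
    have hgv : ∀ v, inner ℝ g v = fderiv ℝ ρ θ v := fun v =>
      InnerProductSpace.toDual_symm_apply
    -- The radial derivative vanishes, so the ambient gradient is tangential and its full norm
    -- enters the Jacobian.
    have hgW : g ∈ (Submodule.span ℝ {θ})ᗮ := by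
      rw [Submodule.mem_orthogonal_singleton_iff_inner_left, hgv, hrad θ hθ]
    have h := normDet_sq_of_inner_eq
      ((T θ).toLinearMap ∘ₗ (Submodule.span ℝ {θ})ᗮ.subtype) ⟨g, hgW⟩ hp (by
        intro v w
        have := hinner θ hθ v v.2 w w.2
        rw [← hgv, ← hgv] at this
        exact this)
    rw [finrank_tangent (n := n) hθ] at h
    have hgn : ‖(⟨g, hgW⟩ : (Submodule.span ℝ {θ})ᗮ)‖ = ‖fderiv ℝ ρ θ‖ := by
      simp [hg]
    rw [hgn] at h
    rw [tangentJacobian, ← Real.sqrt_sq (LinearMap.normDet_nonneg _), h,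
      Real.sqrt_mul (by positivity),
      ← pow_mul, mul_comm 2 n, pow_mul, Real.sqrt_sq (by positivity)]
  rw [setLIntegral_image_sphere (n := n) (Θ := fun x => ρ x • x) (Ψ := fun x => ‖x‖⁻¹ • x) (T := T)
    (hρm.smul measurable_id) (by fun_prop) ?_ hstrict hinj hf]
  · refine setLIntegral_congr_fun Metric.isClosed_sphere.measurableSet fun θ hθ => ?_
    rw [hJ θ (by simpa using hθ)]
  · intro θ hθ
    have := hρ0 θ hθ
    rw [norm_smul, hθ, mul_one, Real.norm_eq_abs, abs_of_pos this, smul_smul,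
      inv_mul_cancel₀ this.ne', one_smul]

end AreaFormula

/-! ### Variance on product spaces. -/

section VarianceProd

open ProbabilityTheory

variable {X Y : Type} [MeasurableSpace X] [MeasurableSpace Y] {μ : Measure X} {ν : Measure Y}
  [IsProbabilityMeasure μ] [IsProbabilityMeasure ν]

/-- The square of a partial mean is at most the partial mean of the square, because the variance in
`y` is nonnegative. -/
theorem MeasureTheory.MemLp.integral_prod_two {g : X × Y → ℝ} (hg : MemLp g 2 (μ.prod ν)) :
    MemLp (fun x => ∫ y, g (x, y) ∂ν) 2 μ := by
  have hsq := hg.integrable_sq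
  have hint : Integrable g (μ.prod ν) := hg.integrable one_le_two
  have hmeas : AEStronglyMeasurable (fun x => ∫ y, g (x, y) ∂ν) μ :=
    hg.aestronglyMeasurable.integral_prod_right'
  rw [memLp_two_iff_integrable_sq hmeas]
  refine hsq.integral_prod_left.mono' (hmeas.pow 2) ?_
  filter_upwards [hsq.prod_right_ae, hint.prod_right_ae] with x hx hx'
  have h2 : MemLp (fun y => g (x, y)) 2 ν :=
    (memLp_two_iff_integrable_sq hx'.aestronglyMeasurable).2 hx
  have h := variance_nonneg (fun y => g (x, y)) ν
  rw [variance_eq_sub h2] at h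
  rw [Real.norm_eq_abs, abs_of_nonneg (sq_nonneg _)]
  simp only [Pi.pow_apply] at h
  linarith

/-- The Efron–Stein inequality for a product of two probability measures. -/
theorem variance_prod_le {g : X × Y → ℝ} (hg : MemLp g 2 (μ.prod ν)) :
    Var[g; μ.prod ν] ≤ ∫ x, Var[fun y => g (x, y); ν] ∂μ + ∫ y, Var[fun x => g (x, y); μ] ∂ν := by
  have hsq := hg.integrable_sq
  have hint : Integrable g (μ.prod ν) := hg.integrable one_le_two
  have hgs : MemLp (fun p : Y × X => g (p.2, p.1)) 2 (ν.prod μ) :=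
    hg.comp_measurePreserving (Measure.measurePreserving_swap)
  set G : X → ℝ := fun x => ∫ y, g (x, y) ∂ν with hGdef
  set H : Y → ℝ := fun y => ∫ x, g (x, y) ∂μ with hHdef
  have hG : MemLp G 2 μ := hg.integral_prod_two
  have hH : MemLp H 2 ν := hgs.integral_prod_two
  set m := ∫ p, g p ∂(μ.prod ν) with hm
  have hmG : ∫ x, G x ∂μ = m := (integral_prod g hint).symm
  have hmH : ∫ y, H y ∂ν = m := (integral_prod_symm g hint).symm
  have hVx : ∫ x, Var[fun y => g (x, y); ν] ∂μ =
      ∫ p, g p ^ 2 ∂(μ.prod ν) - ∫ x, G x ^ 2 ∂μ := by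
    rw [integral_prod _ hsq, ← integral_sub hsq.integral_prod_left hG.integrable_sq]
    refine integral_congr_ae ?_
    filter_upwards [hsq.prod_right_ae, hint.prod_right_ae] with x hx hx'
    have h2 : MemLp (fun y => g (x, y)) 2 ν :=
      (memLp_two_iff_integrable_sq hx'.aestronglyMeasurable).2 hx
    rw [variance_eq_sub h2]
    rfl
  have hVy : ∫ y, Var[fun x => g (x, y); μ] ∂ν =
      ∫ p, g p ^ 2 ∂(μ.prod ν) - ∫ y, H y ^ 2 ∂ν := by
    rw [integral_prod_symm _ hsq, ← integral_sub hsq.integral_prod_right hH.integrable_sq]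
    refine integral_congr_ae ?_
    filter_upwards [hsq.prod_left_ae, hint.prod_left_ae] with x hx hx'
    have h2 : MemLp (fun y => g (y, x)) 2 μ :=
      (memLp_two_iff_integrable_sq hx'.aestronglyMeasurable).2 hx
    rw [variance_eq_sub h2]
    rfl
  rw [variance_eq_sub hg, hVx, hVy]
  have hG' : MemLp (fun p : X × Y => G p.1) 2 (μ.prod ν) :=
    hG.comp_measurePreserving measurePreserving_fst
  have hH' : MemLp (fun p : X × Y => H p.2) 2 (μ.prod ν) :=
    hH.comp_measurePreserving measurePreserving_snd
  have iG := hG.integrable one_le_two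
  have iH := hH.integrable one_le_two
  have iG' := hG'.integrable one_le_two
  have iH' := hH'.integrable one_le_two
  have igG : Integrable (fun p => g p * G p.1) (μ.prod ν) := hg.integrable_mul hG'
  have igH : Integrable (fun p => g p * H p.2) (μ.prod ν) := hg.integrable_mul hH'
  have iGH : Integrable (fun p : X × Y => G p.1 * H p.2) (μ.prod ν) := hG'.integrable_mul hH'
  have iGG := hG'.integrable_sq
  have iHH := hH'.integrable_sq
  have e1 : ∫ p, g p * G p.1 ∂(μ.prod ν) = ∫ x, G x ^ 2 ∂μ := by
    rw [integral_prod _ igG]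
    refine integral_congr_ae (Eventually.of_forall fun x => ?_)
    simp only [integral_mul_const]
    rw [sq]
  have e2 : ∫ p, g p * H p.2 ∂(μ.prod ν) = ∫ y, H y ^ 2 ∂ν := by
    rw [integral_prod_symm _ igH]
    refine integral_congr_ae (Eventually.of_forall fun x => ?_)
    simp only [integral_mul_const]
    rw [sq]
  have e3 : ∫ p : X × Y, G p.1 * H p.2 ∂(μ.prod ν) = m * m := by
    rw [integral_prod_mul, hmG, hmH]
  have e4 : ∫ p : X × Y, G p.1 ^ 2 ∂(μ.prod ν) = ∫ x, G x ^ 2 ∂μ := by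
    simpa using integral_fun_fst (μ := μ) (ν := ν) (fun x => G x ^ 2)
  have e5 : ∫ p : X × Y, H p.2 ^ 2 ∂(μ.prod ν) = ∫ y, H y ^ 2 ∂ν := by
    simpa using integral_fun_snd (μ := μ) (ν := ν) (fun x => H x ^ 2)
  have e6 : ∫ p : X × Y, G p.1 ∂(μ.prod ν) = m := by
    simpa [hmG] using integral_fun_fst (μ := μ) (ν := ν) G
  have e7 : ∫ p : X × Y, H p.2 ∂(μ.prod ν) = m := by
    simpa [hmH] using integral_fun_snd (μ := μ) (ν := ν) H
  -- The interaction term of the decomposition of `g` into its mean, its two marginal effects and a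
  -- remainder. The inequality is exactly that its square has nonnegative integral.
  have hpos : 0 ≤ ∫ p, (g p - G p.1 - H p.2 + m) ^ 2 ∂(μ.prod ν) :=
    integral_nonneg fun p => sq_nonneg _
  have hexp : ∀ p : X × Y, (g p - G p.1 - H p.2 + m) ^ 2 =
      ((g p ^ 2 + G p.1 ^ 2) + (H p.2 ^ 2 + m ^ 2)) + ((-2) * (g p * G p.1) + (-2) * (g p * H p.2))
      + ((2 * m) * g p + 2 * (G p.1 * H p.2)) + ((-2 * m) * G p.1 + (-2 * m) * H p.2) :=
    fun p => by ring
  simp only [hexp] at hpos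
  rw [integral_add (((hsq.fun_add iGG).fun_add (iHH.fun_add (integrable_const _))).fun_add
      ((igG.const_mul _).fun_add (igH.const_mul _)) |>.fun_add
      ((hint.const_mul _).fun_add (iGH.const_mul _))) ((iG'.const_mul _).fun_add (iH'.const_mul _)),
    integral_add (((hsq.fun_add iGG).fun_add (iHH.fun_add (integrable_const _))).fun_add
      ((igG.const_mul _).fun_add (igH.const_mul _))) ((hint.const_mul _).fun_add (iGH.const_mul _)),
    integral_add ((hsq.fun_add iGG).fun_add (iHH.fun_add (integrable_const _)))
      ((igG.const_mul _).fun_add (igH.const_mul _)),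
    integral_add (hsq.fun_add iGG) (iHH.fun_add (integrable_const _)), integral_add hsq iGG,
    integral_add iHH (integrable_const _), integral_add (igG.const_mul _) (igH.const_mul _),
    integral_add (hint.const_mul _) (iGH.const_mul _),
    integral_add (iG'.const_mul _) (iH'.const_mul _)] at hpos
  simp only [integral_const_mul, e1, e2, e3, e4, e5, e6, e7, ← hm, integral_const,
    probReal_univ, one_smul] at hpos
  simp only [Pi.pow_apply]
  rw [← hm]
  nlinarith

/-- Variance is half the mean square difference of two independent copies. The `ℝ≥0∞` form allows
Tonelli's theorem to be used without integrability checks. -/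
theorem lintegral_lintegral_sub_sq {f : X → ℝ} (hf : MemLp f 2 μ) :
    ∫⁻ a, ∫⁻ b, ENNReal.ofReal ((f a - f b) ^ 2) ∂μ ∂μ = ENNReal.ofReal (2 * Var[f; μ]) := by
  have h1 : Integrable f μ := hf.integrable one_le_two
  have h2 : Integrable (fun x => f x ^ 2) μ := hf.integrable_sq
  have hexp : ∀ a b, (f a - f b) ^ 2 = f a ^ 2 + (f b ^ 2 + (-2 * f a) * f b) :=
    fun a b => by ring
  have hin : ∀ a, Integrable (fun b => (f a - f b) ^ 2) μ := fun a => by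
    simp only [hexp]
    exact (integrable_const _).fun_add (h2.fun_add (h1.const_mul _))
  have hval : ∀ a, ∫ b, (f a - f b) ^ 2 ∂μ =
      f a ^ 2 + (∫ b, f b ^ 2 ∂μ + (-2 * ∫ b, f b ∂μ) * f a) := fun a => by
    simp only [hexp]
    rw [integral_add (integrable_const _) (h2.fun_add (h1.const_mul _)),
      integral_add h2 (h1.const_mul _), integral_const_mul, integral_const, probReal_univ,
      one_smul]
    ring
  have hout : Integrable (fun a => ∫ b, (f a - f b) ^ 2 ∂μ) μ := by
    simp only [hval]
    exact h2.fun_add ((integrable_const _).fun_add (h1.const_mul _))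
  calc _ = ∫⁻ a, ENNReal.ofReal (∫ b, (f a - f b) ^ 2 ∂μ) ∂μ :=
        lintegral_congr fun a => (ofReal_integral_eq_lintegral_ofReal (hin a)
          (Eventually.of_forall fun b => sq_nonneg _)).symm
    _ = ENNReal.ofReal (∫ a, ∫ b, (f a - f b) ^ 2 ∂μ ∂μ) :=
        (ofReal_integral_eq_lintegral_ofReal hout
          (Eventually.of_forall fun a => integral_nonneg fun b => sq_nonneg _)).symm
    _ = _ := by
        simp only [hval]
        rw [integral_add h2 ((integrable_const _).fun_add (h1.const_mul _)),
          integral_add (integrable_const _) (h1.const_mul _), integral_const_mul, integral_const,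
          probReal_univ, one_smul, variance_eq_sub hf]
        simp only [Pi.pow_apply]
        congr 1
        ring

end VarianceProd

/-! ### The Gaussian Poincaré inequality in one dimension. -/

section GaussianLine

open ProbabilityTheory

theorem gaussianPDFReal_zero_one (x : ℝ) :
    gaussianPDFReal 0 1 x = (√(2 * Real.pi))⁻¹ * Real.exp (-x ^ 2 / 2) := by
  simp [gaussianPDFReal_def]

theorem hasDerivAt_gaussianPDFReal (x : ℝ) :
    HasDerivAt (gaussianPDFReal 0 1) (-(x * gaussianPDFReal 0 1 x)) x := by
  have h : HasDerivAt (fun x : ℝ => (√(2 * Real.pi))⁻¹ * Real.exp (-x ^ 2 / 2))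
      ((√(2 * Real.pi))⁻¹ * (Real.exp (-x ^ 2 / 2) * (-(2 * x) / 2))) x := by
    have h1 : HasDerivAt (fun x : ℝ => -x ^ 2 / 2) (-(2 * x) / 2) x := by
      simpa using ((hasDerivAt_pow 2 x).neg.div_const 2)
    exact (h1.exp).const_mul _
  have hf : gaussianPDFReal 0 1 = fun x : ℝ => (√(2 * Real.pi))⁻¹ * Real.exp (-x ^ 2 / 2) :=
    funext gaussianPDFReal_zero_one
  rw [hf]
  convert h using 1
  ring

theorem tendsto_gaussianPDFReal_atTop : Tendsto (gaussianPDFReal 0 1) atTop (𝓝 0) := by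
  have hf : gaussianPDFReal 0 1 = fun x : ℝ => (√(2 * Real.pi))⁻¹ * Real.exp (-x ^ 2 / 2) :=
    funext gaussianPDFReal_zero_one
  rw [hf]
  have h1 : Tendsto (fun x : ℝ => -x ^ 2 / 2) atTop atBot := by
    have : Tendsto (fun x : ℝ => x ^ 2 / 2) atTop atTop :=
      (tendsto_pow_atTop two_ne_zero).atTop_div_const two_pos
    exact (tendsto_neg_atTop_atBot.comp this).congr fun x => by simp [neg_div]
  simpa using (Real.tendsto_exp_atBot.comp h1).const_mul (√(2 * Real.pi))⁻¹

/-- The integrand `a * gaussianPDFReal 0 1 a` is minus the derivative of the density. -/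
theorem setIntegral_Ici_id_gaussianReal (x : ℝ) :
    ∫ a in Ici x, a ∂(gaussianReal 0 1) = gaussianPDFReal 0 1 x := by
  have hid : Integrable (fun a : ℝ => a) (gaussianReal 0 1) :=
    (memLp_id_gaussianReal (μ := 0) (v := 1) 1).integrable (by simp)
  have hint : Integrable (fun a : ℝ => a * gaussianPDFReal 0 1 a) := by
    rw [gaussianReal_of_var_ne_zero _ one_ne_zero,
      integrable_withDensity_iff_integrable_smul₀' (by fun_prop)
        (Eventually.of_forall fun _ => gaussianPDF_lt_top)] at hid
    simpa [toReal_gaussianPDF, mul_comm] using hid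
  have h1 : ∫ a in Ici x, a ∂(gaussianReal 0 1) = ∫ a in Ioi x, a * gaussianPDFReal 0 1 a := by
    rw [← integral_indicator measurableSet_Ici, integral_gaussianReal_eq_integral_smul one_ne_zero,
      ← integral_Ici_eq_integral_Ioi, ← integral_indicator measurableSet_Ici]
    refine integral_congr_ae (Eventually.of_forall fun a => ?_)
    by_cases ha : a ∈ Ici x
    · simp [indicator_of_mem ha, mul_comm]
    · simp [indicator_of_notMem ha]
  rw [h1]
  have h2 := integral_Ioi_of_hasDerivAt_of_tendsto' (a := x) (f := fun a => -gaussianPDFReal 0 1 a)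
    (f' := fun a => a * gaussianPDFReal 0 1 a) (m := 0)
    (fun a _ => by simpa using (hasDerivAt_gaussianPDFReal a).fun_neg) hint.integrableOn
    (by simpa using tendsto_gaussianPDFReal_atTop.neg)
  rw [h2]
  ring

/-- This is the weight a point `x` receives from all pairs `b < x ≤ a`. That it is the Gaussian
density itself is the source of the constant one in the Poincaré inequality. -/
theorem lintegral_lintegral_gaussianReal_kernel (x : ℝ) :
    ∫⁻ a in Ici x, ∫⁻ b in Iio x, ENNReal.ofReal (a - b) ∂(gaussianReal 0 1) ∂(gaussianReal 0 1) =
      gaussianPDF 0 1 x := by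
  set γ := gaussianReal 0 1
  have hid : Integrable (fun a : ℝ => a) γ :=
    (memLp_id_gaussianReal (μ := 0) (v := 1) 1).integrable (by simp)
  set p := γ.real (Iio x)
  set q := γ.real (Ici x)
  have hpq : p + q = 1 := by
    have := measureReal_add_measureReal_compl (μ := γ) (measurableSet_Iio (a := x))
    rw [compl_Iio, probReal_univ] at this
    exact this
  have hA : ∫ a in Ici x, a ∂γ = gaussianPDFReal 0 1 x := setIntegral_Ici_id_gaussianReal x
  have hB : ∫ b in Iio x, b ∂γ = -gaussianPDFReal 0 1 x := by
    have := integral_add_compl (measurableSet_Iio (a := x)) hid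
    rw [compl_Iio, hA, integral_id_gaussianReal] at this
    linarith
  have hin : ∀ a, IntegrableOn (fun b => a - b) (Iio x) γ := fun a =>
    ((integrable_const a).sub hid).integrableOn
  have hval : ∀ a, ∫ b in Iio x, (a - b) ∂γ = p * a + gaussianPDFReal 0 1 x := fun a => by
    rw [integral_sub (integrable_const a).integrableOn hid.integrableOn, hB, setIntegral_const,
      smul_eq_mul, sub_neg_eq_add]
  have hout : IntegrableOn (fun a => ∫ b in Iio x, (a - b) ∂γ) (Ici x) γ := by
    simp only [hval]
    exact ((hid.const_mul _).add (integrable_const _)).integrableOn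
  have hnn : ∀ a ∈ Ici x, 0 ≤ᵐ[γ.restrict (Iio x)] fun b => a - b := fun a ha => by
    filter_upwards [ae_restrict_mem measurableSet_Iio] with b hb
    exact sub_nonneg.2 ((mem_Iio.1 hb).le.trans ha)
  calc _ = ∫⁻ a in Ici x, ENNReal.ofReal (∫ b in Iio x, (a - b) ∂γ) ∂γ :=
        setLIntegral_congr_fun measurableSet_Ici fun a ha =>
          (ofReal_integral_eq_lintegral_ofReal (hin a) (hnn a ha)).symm
    _ = ENNReal.ofReal (∫ a in Ici x, ∫ b in Iio x, (a - b) ∂γ ∂γ) := by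
        refine (ofReal_integral_eq_lintegral_ofReal hout ?_).symm
        filter_upwards [ae_restrict_mem measurableSet_Ici] with a ha
        exact integral_nonneg_of_ae (hnn a ha)
    _ = _ := by
        simp only [hval]
        rw [integral_add (hid.const_mul _).integrableOn (integrable_const _).integrableOn,
          integral_const_mul, hA, setIntegral_const, smul_eq_mul, gaussianPDF]
        congr 1
        linear_combination gaussianPDFReal 0 1 x * hpq

/-- Cauchy–Schwarz for `∫ d`, in the form `∫ (d - c) ^ 2 ≥ 0` with `c` the mean slope. -/
theorem sq_sub_le_mul_integral_sq {g d : ℝ → ℝ} {s : Set ℝ} {C a b : ℝ} (hs : s.Countable)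
    (hg : Continuous g) (hd : ∀ x ∉ s, HasDerivAt g (d x) x) (hdm : Measurable d)
    (hC : ∀ x, |d x| ≤ C) (hab : b < a) :
    (g a - g b) ^ 2 ≤ (a - b) * ∫ x in b..a, d x ^ 2 := by
  have hi : IntervalIntegrable d volume b a :=
    (intervalIntegrable_const (c := C)).mono_fun' hdm.aestronglyMeasurable
      (Eventually.of_forall hC)
  have hi2 : IntervalIntegrable (fun x => d x ^ 2) volume b a :=
    (intervalIntegrable_const (c := C ^ 2)).mono_fun' (hdm.pow_const 2).aestronglyMeasurable
      (Eventually.of_forall fun x => by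
        change ‖d x ^ 2‖ ≤ C ^ 2
        rw [Real.norm_eq_abs, abs_pow]
        exact pow_le_pow_left₀ (abs_nonneg _) (hC x) 2)
  have hF : ∫ x in b..a, d x = g a - g b :=
    integral_eq_of_hasDerivAt_off_countable g d hs hg.continuousOn (fun x hx => hd x hx.2) hi
  set c := (g a - g b) / (a - b) with hc
  have hab' : 0 < a - b := sub_pos.2 hab
  have h0 : 0 ≤ ∫ x in b..a, (d x - c) ^ 2 :=
    intervalIntegral.integral_nonneg hab.le fun x _ => sq_nonneg _
  have hexp : ∀ x, (d x - c) ^ 2 = d x ^ 2 + ((-2 * c) * d x + c ^ 2) := fun x => by ring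
  simp only [hexp] at h0
  rw [intervalIntegral.integral_add hi2 ((hi.const_mul _).add intervalIntegrable_const),
    intervalIntegral.integral_add (hi.const_mul _) intervalIntegrable_const,
    intervalIntegral.integral_const_mul, hF, intervalIntegral.integral_const, smul_eq_mul] at h0
  have hcc : g a - g b = c * (a - b) := by rw [hc]; field_simp
  rw [hcc] at h0 ⊢
  nlinarith

theorem memLp_two_gaussianReal_of_growth {g : ℝ → ℝ} {C : ℝ} (hg : Continuous g)
    (hC : ∀ x, |g x| ≤ C * (1 + |x|)) : MemLp g 2 (gaussianReal 0 1) := by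
  have hid : MemLp (fun x : ℝ => |x|) 2 (gaussianReal 0 1) :=
    (memLp_id_gaussianReal' (μ := 0) (v := 1) 2 (by simp)).norm
  have h1 : MemLp (fun x : ℝ => C * (1 + |x|)) 2 (gaussianReal 0 1) :=
    ((memLp_const (1 : ℝ)).add hid).const_mul C
  exact h1.mono' hg.aestronglyMeasurable (Eventually.of_forall hC)

/-- The Gaussian Poincaré inequality on the line. -/
theorem variance_gaussianReal_le {g d : ℝ → ℝ} {s : Set ℝ} {C C' : ℝ} (hs : s.Countable)
    (hg : Continuous g) (hd : ∀ x ∉ s, HasDerivAt g (d x) x) (hdm : Measurable d)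
    (hC : ∀ x, |d x| ≤ C) (hC' : ∀ x, |g x| ≤ C' * (1 + |x|)) :
    Var[g; gaussianReal 0 1] ≤ ∫ x, d x ^ 2 ∂(gaussianReal 0 1) := by
  set γ := gaussianReal 0 1
  have hL := memLp_two_gaussianReal_of_growth hg hC'
  have hdi : Integrable (fun x => d x ^ 2) γ :=
    (integrable_const (C ^ 2)).mono' (hdm.pow_const 2).aestronglyMeasurable
      (Eventually.of_forall fun x => by
        rw [Real.norm_eq_abs, abs_pow]
        exact pow_le_pow_left₀ (abs_nonneg _) (hC x) 2)
  set D : ℝ → ℝ≥0∞ := fun x => ENNReal.ofReal (d x ^ 2) with hD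
  have hDm : Measurable D := (hdm.pow_const 2).ennreal_ofReal
  -- The kernel is `a - b` when `b < x ≤ a` and zero otherwise, so one of `k a b` and `k b a` always
  -- vanishes.
  set k : ℝ → ℝ → ℝ → ℝ≥0∞ := fun a b x =>
    (Ici x).indicator (fun a => (Iio x).indicator (fun b => ENNReal.ofReal (a - b)) b) a with hk
  have hkm : Measurable fun z : ℝ × ℝ × ℝ => k z.1 z.2.1 z.2.2 := by
    have : (fun z : ℝ × ℝ × ℝ => k z.1 z.2.1 z.2.2) =
        {z : ℝ × ℝ × ℝ | z.2.2 ≤ z.1 ∧ z.2.1 < z.2.2}.indicator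
          (fun z => ENNReal.ofReal (z.1 - z.2.1)) := by
      ext z
      simp only [hk, indicator, mem_Ici, mem_Iio, mem_ofPred_eq]
      split_ifs <;> simp_all
    rw [this]
    refine Measurable.indicator (by fun_prop) ?_
    exact (measurableSet_le (f := fun z : ℝ × ℝ × ℝ => z.2.2) (g := fun z => z.1) (by fun_prop)
      (by fun_prop)).inter (measurableSet_lt (f := fun z : ℝ × ℝ × ℝ => z.2.1)
        (g := fun z => z.2.2) (by fun_prop) (by fun_prop))
  have hlt : ∀ a b, b < a → ENNReal.ofReal ((g a - g b) ^ 2) ≤ (∫⁻ x, k a b x * D x) := by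
    intro a b hab
    have h1 := sq_sub_le_mul_integral_sq hs hg hd hdm hC hab
    have hfin : IntegrableOn (fun x => d x ^ 2) (Ioc b a) :=
      (integrable_const (μ := volume.restrict (Ioc b a)) (C ^ 2)).mono'
        (hdm.pow_const 2).aestronglyMeasurable
        (Eventually.of_forall fun x => by
          rw [Real.norm_eq_abs, abs_pow]
          exact pow_le_pow_left₀ (abs_nonneg _) (hC x) 2)
    calc _ ≤ ENNReal.ofReal ((a - b) * ∫ x in b..a, d x ^ 2) := ENNReal.ofReal_le_ofReal h1
      _ = ENNReal.ofReal (a - b) * ∫⁻ x in Ioc b a, D x := by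
          rw [ENNReal.ofReal_mul (sub_nonneg.2 hab.le), intervalIntegral.integral_of_le hab.le,
            ofReal_integral_eq_lintegral_ofReal hfin (Eventually.of_forall fun x => sq_nonneg _)]
      _ = (∫⁻ x, k a b x * D x) := by
          rw [← lintegral_const_mul _ hDm, ← lintegral_indicator measurableSet_Ioc]
          refine lintegral_congr fun x => ?_
          simp only [hk, indicator, mem_Ici, mem_Iio, mem_Ioc]
          split_ifs <;> simp_all
  have hle : ∀ a b, ENNReal.ofReal ((g a - g b) ^ 2) ≤
      (∫⁻ x, k a b x * D x) + (∫⁻ x, k b a x * D x) := by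
    intro a b
    rcases lt_trichotomy b a with h | h | h
    · exact (hlt a b h).trans le_self_add
    · simp [h]
    · rw [← neg_sq, neg_sub]
      exact (hlt b a h).trans le_add_self
  -- Tonelli moves `x` outermost; the remaining double integral of the kernel is the Gaussian
  -- density at `x`.
  have hI : ∫⁻ a, ∫⁻ b, (∫⁻ x, k a b x * D x) ∂γ ∂γ = ∫⁻ x, D x ∂γ := by
    have hm3 : Measurable fun z : ℝ × ℝ × ℝ => k z.1 z.2.1 z.2.2 * D z.2.2 :=
      hkm.mul (hDm.comp (f := fun z : ℝ × ℝ × ℝ => z.2.2) (by fun_prop))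
    calc _ = ∫⁻ a, (∫⁻ x, ∫⁻ b, k a b x * D x ∂γ) ∂γ := by
          refine lintegral_congr fun a => lintegral_lintegral_swap ?_
          exact (hm3.comp (f := fun z : ℝ × ℝ => (a, z.1, z.2)) (by fun_prop)).aemeasurable
      _ = ∫⁻ x, ∫⁻ a, ∫⁻ b, k a b x * D x ∂γ ∂γ := by
          refine lintegral_lintegral_swap ?_
          have : Measurable fun w : (ℝ × ℝ) × ℝ => k w.1.1 w.2 w.1.2 * D w.1.2 :=
            hm3.comp (f := fun w : (ℝ × ℝ) × ℝ => (w.1.1, w.2, w.1.2)) (by fun_prop)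
          exact this.lintegral_prod_right'.aemeasurable
      _ = ∫⁻ x, gaussianPDF 0 1 x * D x := by
          refine lintegral_congr fun x => ?_
          have hkx : ∀ a, Measurable fun b => k a b x := fun a =>
            hkm.comp (f := fun b : ℝ => (a, b, x)) (by fun_prop)
          have hkx' : Measurable fun a => ∫⁻ b, k a b x ∂γ := by
            have : Measurable fun w : ℝ × ℝ => k w.1 w.2 x :=
              hkm.comp (f := fun w : ℝ × ℝ => (w.1, w.2, x)) (by fun_prop)
            exact this.lintegral_prod_right'
          simp only [lintegral_mul_const _ (hkx _)]
          rw [lintegral_mul_const _ hkx', ← lintegral_lintegral_gaussianReal_kernel,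
            ← lintegral_indicator measurableSet_Ici]
          congr 1
          refine lintegral_congr fun a => ?_
          by_cases ha : a ∈ Ici x
          · simp only [hk, indicator_of_mem ha]
            rw [lintegral_indicator measurableSet_Iio]
          · simp only [hk, indicator_of_notMem ha, lintegral_zero]
      _ = ∫⁻ x, D x ∂γ := by
          rw [show γ = volume.withDensity (gaussianPDF 0 1) from
            gaussianReal_of_var_ne_zero 0 one_ne_zero,
            lintegral_withDensity_eq_lintegral_mul _ (measurable_gaussianPDF 0 1) hDm]
          rfl
  have hI' : ∫⁻ a, ∫⁻ b, (∫⁻ x, k b a x * D x) ∂γ ∂γ = ∫⁻ x, D x ∂γ := by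
    rw [← hI]
    refine lintegral_lintegral_swap ?_
    have : Measurable fun w : (ℝ × ℝ) × ℝ => k w.1.2 w.1.1 w.2 * D w.2 :=
      (hkm.mul (hDm.comp (f := fun z : ℝ × ℝ × ℝ => z.2.2) (by fun_prop))).comp
        (f := fun w : (ℝ × ℝ) × ℝ => (w.1.2, w.1.1, w.2)) (by fun_prop)
    exact (Measurable.lintegral_prod_right' this).aemeasurable
  have hDD : ∫⁻ x, D x ∂γ = ENNReal.ofReal (∫ x, d x ^ 2 ∂γ) :=
    (ofReal_integral_eq_lintegral_ofReal hdi (Eventually.of_forall fun x => sq_nonneg _)).symm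
  have hd0 : 0 ≤ ∫ x, d x ^ 2 ∂γ := integral_nonneg fun x => sq_nonneg _
  -- The two orderings of `a` and `b` contribute one copy of `∫ d²` each, matching the factor two in
  -- front of the variance.
  have hfinal : ENNReal.ofReal (2 * Var[g; γ]) ≤ ENNReal.ofReal (2 * ∫ x, d x ^ 2 ∂γ) := by
    rw [← lintegral_lintegral_sub_sq hL]
    have hm1 : Measurable fun w : (ℝ × ℝ) => ∫⁻ x, k w.1 w.2 x * D x := by
      have : Measurable fun w : (ℝ × ℝ) × ℝ => k w.1.1 w.1.2 w.2 * D w.2 :=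
        (hkm.mul (hDm.comp (f := fun z : ℝ × ℝ × ℝ => z.2.2) (by fun_prop))).comp
          (f := fun w : (ℝ × ℝ) × ℝ => (w.1.1, w.1.2, w.2)) (by fun_prop)
      exact this.lintegral_prod_right'
    calc _ ≤ ∫⁻ a, ∫⁻ b, ((∫⁻ x, k a b x * D x) + (∫⁻ x, k b a x * D x)) ∂γ ∂γ :=
          lintegral_mono fun a => lintegral_mono fun b => hle a b
      _ = (∫⁻ x, D x ∂γ) + ∫⁻ x, D x ∂γ := by
          have hm2 : Measurable fun a => ∫⁻ b, (∫⁻ x, k a b x * D x) ∂γ := hm1.lintegral_prod_right'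
          rw [show (∫⁻ x, D x ∂γ) + ∫⁻ x, D x ∂γ = (∫⁻ a, ∫⁻ b, (∫⁻ x, k a b x * D x) ∂γ ∂γ) +
            ∫⁻ a, ∫⁻ b, (∫⁻ x, k b a x * D x) ∂γ ∂γ by rw [hI, hI'], ← lintegral_add_left hm2]
          refine lintegral_congr fun a => ?_
          exact lintegral_add_left (hm1.comp (f := fun b : ℝ => (a, b)) (by fun_prop)) _
      _ = _ := by rw [hDD, ← ENNReal.ofReal_add hd0 hd0, two_mul]
  rw [ENNReal.ofReal_le_ofReal_iff (by positivity)] at hfinal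
  linarith

end GaussianLine

/-! ### Tensorisation of the Gaussian Poincaré inequality. -/

section GaussianPi

open ProbabilityTheory

/-- The standard Gaussian measure on `Fin m → ℝ`. -/
noncomputable abbrev gaussianPi (m : ℕ) : Measure (Fin m → ℝ) :=
  Measure.pi fun _ => gaussianReal 0 1

theorem memLp_norm_gaussianPi (m : ℕ) : MemLp (fun x : Fin m → ℝ => ‖x‖) 2 (gaussianPi m) := by
  have h1 : ∀ i, MemLp (fun x : Fin m → ℝ => ‖x i‖) 2 (gaussianPi m) := fun i =>
    ((memLp_id_gaussianReal' (μ := 0) (v := 1) 2 (by simp)).comp_measurePreserving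
      (measurePreserving_eval (fun _ : Fin m => gaussianReal 0 1) i)).norm
  have h2 : MemLp (fun x : Fin m → ℝ => ∑ i, ‖x i‖) 2 (gaussianPi m) :=
    memLp_finsetSum _ fun i _ => h1 i
  refine h2.mono' (by fun_prop) (Eventually.of_forall fun x => ?_)
  rw [norm_norm, pi_norm_le_iff_of_nonneg (Finset.sum_nonneg fun i _ => norm_nonneg _)]
  intro i
  exact Finset.single_le_sum (f := fun i => ‖x i‖) (fun i _ => norm_nonneg _) (Finset.mem_univ i)

theorem norm_finCons_le {m : ℕ} (a : ℝ) (y : Fin m → ℝ) :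
    ‖(Fin.cons a y : Fin (m + 1) → ℝ)‖ ≤ |a| + ‖y‖ := by
  rw [pi_norm_le_iff_of_nonneg (by positivity)]
  intro i
  refine Fin.cases ?_ (fun i => ?_) i
  · simp
  · simp only [Fin.cons_succ]
    exact (norm_le_pi_norm y i).trans (by simp)

theorem continuous_finCons {m : ℕ} :
    Continuous fun p : ℝ × (Fin m → ℝ) => (Fin.cons p.1 p.2 : Fin (m + 1) → ℝ) := by
  refine continuous_pi fun i => ?_
  refine Fin.cases ?_ (fun i => ?_) i
  · simpa using continuous_fst
  · simp only [Fin.cons_succ]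
    fun_prop

theorem measurePreserving_finCons (m : ℕ) :
    MeasurePreserving (fun p : ℝ × (Fin m → ℝ) => (Fin.cons p.1 p.2 : Fin (m + 1) → ℝ))
      ((gaussianReal 0 1).prod (gaussianPi m)) (gaussianPi (m + 1)) := by
  have h := (measurePreserving_piFinSuccAbove (fun _ : Fin (m + 1) => gaussianReal 0 1) 0).symm
  convert h using 1
  ext p i
  simp [MeasurableEquiv.piFinSuccAbove, Fin.insertNthEquiv]

/-- The Gaussian Poincaré inequality, for functions differentiable off a countable set. -/
theorem variance_gaussianPi_le (m : ℕ) :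
    ∀ {g : (Fin m → ℝ) → ℝ} {g' : (Fin m → ℝ) → Fin m → ℝ} {S : Set (Fin m → ℝ)} {C C' : ℝ},
      S.Countable → Continuous g →
      (∀ x ∉ S, ∀ i, HasDerivAt (fun s => g (Function.update x i s)) (g' x i) (x i)) →
      Measurable g' → (∀ x i, |g' x i| ≤ C) → (∀ x, |g x| ≤ C' * (1 + ‖x‖)) →
      Var[g; gaussianPi m] ≤ ∑ i, ∫ x, g' x i ^ 2 ∂(gaussianPi m) := by
  induction m with
  | zero =>
    intro g g' S C C' _ _ _ _ _ _
    have : g = fun _ => g 0 := funext fun x => congrArg g (Subsingleton.elim _ _)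
    rw [this, variance_eq_sub (memLp_const _)]
    simp
  | succ m ih =>
    intro g g' S C C' hS hg hd hdm hC hC'
    have hC'0 : 0 ≤ C' := by
      have := (abs_nonneg _).trans (hC' 0)
      simpa using this
    have hmp := measurePreserving_finCons m
    set G : ℝ × (Fin m → ℝ) → ℝ := fun p => g (Fin.cons p.1 p.2) with hG
    set γ := gaussianReal 0 1
    have hGc : Continuous G := hg.comp continuous_finCons
    have hVar : Var[g; gaussianPi (m + 1)] = Var[G; γ.prod (gaussianPi m)] := by
      rw [← hmp.map_eq, variance_map hg.measurable.aemeasurable hmp.measurable.aemeasurable]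
      rfl
    have hGb : ∀ p, |G p| ≤ C' * (1 + (|p.1| + ‖p.2‖)) := fun p =>
      (hC' _).trans (by gcongr; exact norm_finCons_le _ _)
    have hGL : MemLp G 2 (γ.prod (gaussianPi m)) := by
      have h1 : MemLp (fun p : ℝ × (Fin m → ℝ) => |p.1|) 2 (γ.prod (gaussianPi m)) :=
        (memLp_id_gaussianReal' (μ := 0) (v := 1) 2 (by simp)).norm.comp_measurePreserving
          measurePreserving_fst
      have h2 : MemLp (fun p : ℝ × (Fin m → ℝ) => ‖p.2‖) 2 (γ.prod (gaussianPi m)) :=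
        (memLp_norm_gaussianPi m).comp_measurePreserving measurePreserving_snd
      have h3 : MemLp (fun p : ℝ × (Fin m → ℝ) => C' * (1 + (|p.1| + ‖p.2‖))) 2
          (γ.prod (gaussianPi m)) := ((memLp_const (1 : ℝ)).add (h1.add h2)).const_mul C'
      exact h3.mono' hGc.aestronglyMeasurable (Eventually.of_forall hGb)
    have hbd : ∀ x i, ‖g' x i ^ 2‖ ≤ C ^ 2 := fun x i => by
      rw [Real.norm_eq_abs, abs_pow]
      exact pow_le_pow_left₀ (abs_nonneg _) (hC x i) 2
    have hcm := (continuous_finCons (m := m)).measurable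
    have hdi : ∀ i, Measurable fun p : ℝ × (Fin m → ℝ) => g' (Fin.cons p.1 p.2) i ^ 2 := fun i =>
      (((measurable_pi_apply i).comp hdm).comp hcm).pow_const 2
    have hint : ∀ i, Integrable (fun p : ℝ × (Fin m → ℝ) => g' (Fin.cons p.1 p.2) i ^ 2)
        (γ.prod (gaussianPi m)) := fun i =>
      (integrable_const (C ^ 2)).mono' (hdi i).aestronglyMeasurable
        (Eventually.of_forall fun p => hbd _ _)
    have hInt : ∀ i, ∫ x, g' x i ^ 2 ∂(gaussianPi (m + 1)) =
        ∫ p, g' (Fin.cons p.1 p.2) i ^ 2 ∂(γ.prod (gaussianPi m)) := by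
      intro i
      rw [← hmp.map_eq, integral_map hmp.measurable.aemeasurable]
      exact (((measurable_pi_apply i).comp hdm).pow_const 2).aestronglyMeasurable
    -- Freezing coordinates is injective in the free ones, so slices of the countable exceptional
    -- set are countable.
    have hinj0 : ∀ y : Fin m → ℝ,
        Function.Injective fun a : ℝ => (Fin.cons a y : Fin (m + 1) → ℝ) :=
      fun y a b h => by simpa using congrFun h 0
    have hinj1 : ∀ a : ℝ,
        Function.Injective fun y : Fin m → ℝ => (Fin.cons a y : Fin (m + 1) → ℝ) :=
      fun a y z h => by
        funext i
        simpa using congrFun h i.succ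
    -- The growth constant of a slice is enlarged by `1 + |a|` to absorb the frozen coordinate.
    have hx : ∀ a, Var[fun y => G (a, y); gaussianPi m] ≤
        ∑ i, ∫ y, g' (Fin.cons a y) (Fin.succ i) ^ 2 ∂(gaussianPi m) := by
      intro a
      refine ih (g := fun y => G (a, y)) (g' := fun y i => g' (Fin.cons a y) i.succ)
        (S := (fun y : Fin m → ℝ => (Fin.cons a y : Fin (m + 1) → ℝ)) ⁻¹' S) (C := C)
        (C' := C' * (1 + |a|)) (hS.preimage (hinj1 a)) (hGc.comp (by fun_prop)) ?_ ?_ ?_ ?_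
      · intro y hy i
        have := hd _ hy i.succ
        simp only [Fin.cons_succ, ← Fin.cons_update] at this
        exact this
      · refine measurable_pi_lambda _ fun i => ?_
        exact ((measurable_pi_apply i.succ).comp hdm).comp
          (hcm.comp (f := fun y : Fin m → ℝ => (a, y)) (by fun_prop))
      · exact fun y i => hC _ _
      · intro y
        refine (hGb _).trans ?_
        rw [mul_assoc]
        gcongr
        nlinarith [mul_nonneg (abs_nonneg a) (norm_nonneg y)]
    have hy : ∀ y, Var[fun a => G (a, y); γ] ≤ ∫ a, g' (Fin.cons a y) 0 ^ 2 ∂γ := by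
      intro y
      refine variance_gaussianReal_le (g := fun a => G (a, y)) (d := fun a => g' (Fin.cons a y) 0)
        (s := (fun a : ℝ => (Fin.cons a y : Fin (m + 1) → ℝ)) ⁻¹' S) (C := C)
        (C' := C' * (1 + ‖y‖)) (hS.preimage (hinj0 y)) (hGc.comp (by fun_prop)) ?_ ?_ ?_ ?_
      · intro a ha
        have := hd _ ha 0
        simp only [Fin.cons_zero, Fin.update_cons_zero] at this
        exact this
      · exact ((measurable_pi_apply 0).comp hdm).comp
          (hcm.comp (f := fun a : ℝ => (a, y)) (by fun_prop))
      · exact fun a => hC _ _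
      · intro a
        refine (hGb _).trans ?_
        rw [mul_assoc]
        gcongr
        nlinarith [mul_nonneg (abs_nonneg a) (norm_nonneg y)]
    rw [hVar, Fin.sum_univ_succ]
    refine (variance_prod_le hGL).trans ?_
    rw [add_comm]
    refine add_le_add ?_ ?_
    · rw [hInt 0, integral_prod_symm _ (hint 0)]
      exact integral_mono_of_nonneg (Eventually.of_forall fun y => variance_nonneg _ _)
        (hint 0).integral_prod_right (Eventually.of_forall hy)
    · have : ∑ i : Fin m, ∫ x, g' x i.succ ^ 2 ∂(gaussianPi (m + 1)) =
          ∫ a, ∑ i : Fin m, ∫ y, g' (Fin.cons a y) i.succ ^ 2 ∂(gaussianPi m) ∂γ := by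
        rw [integral_finsetSum _ fun i _ => (hint i.succ).integral_prod_left]
        refine Finset.sum_congr rfl fun i _ => ?_
        rw [hInt i.succ, integral_prod _ (hint i.succ)]
      rw [this]
      exact integral_mono_of_nonneg (Eventually.of_forall fun y => variance_nonneg _ _)
        (integrable_finsetSum _ fun i _ => (hint i.succ).integral_prod_left)
        (Eventually.of_forall hx)

end GaussianPi

/-! ### The sharp Poincaré inequality on the sphere. -/

section SpherePoincare

open ProbabilityTheory

variable {m : ℕ}

theorem integral_stdGaussian_eq {f : EuclideanSpace ℝ (Fin m) → ℝ} (hf : Measurable f) :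
    ∫ x, f x ∂(stdGaussian (EuclideanSpace ℝ (Fin m))) =
      ∫ x, f (WithLp.toLp 2 x) ∂(gaussianPi m) := by
  rw [← map_pi_eq_stdGaussian, integral_map (by fun_prop) hf.aestronglyMeasurable]

theorem norm_sq_eq_sum_sq_basisFun (L : EuclideanSpace ℝ (Fin m) →L[ℝ] ℝ) :
    ‖L‖ ^ 2 = ∑ i, L (EuclideanSpace.basisFun (Fin m) ℝ i) ^ 2 := by
  have h := (EuclideanSpace.basisFun (Fin m) ℝ).sum_sq_norm_inner_left
    ((InnerProductSpace.toDual ℝ _).symm L)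
  simp only [InnerProductSpace.toDual_symm_apply, LinearIsometryEquiv.norm_map,
    Real.norm_eq_abs, sq_abs] at h
  exact h.symm

/-- Euler's identity in degree zero: `c ↦ u (c • x)` is constant near `c = 1`. -/
theorem fderiv_apply_self_eq_zero {E : Type} [NormedAddCommGroup E] [NormedSpace ℝ E] {u : E → ℝ}
    (hhom : ∀ c : ℝ, 0 < c → ∀ x, u (c • x) = u x) {x : E} (hu : DifferentiableAt ℝ u x) :
    fderiv ℝ u x x = 0 := by
  have h1 : HasDerivAt (fun c : ℝ => u (c • x)) (fderiv ℝ u x x) 1 := by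
    have hl : HasDerivAt (fun c : ℝ => c • x) x 1 := by
      simpa using (hasDerivAt_id (1 : ℝ)).smul_const x
    exact HasFDerivAt.comp_hasDerivAt_of_eq 1 hu.hasFDerivAt hl (by simp)
  have h2 : HasDerivAt (fun c : ℝ => u (c • x)) 0 1 := by
    refine (hasDerivAt_const (1 : ℝ) (u x)).congr_of_eventuallyEq ?_
    filter_upwards [lt_mem_nhds (zero_lt_one' ℝ)] with c hc
    exact hhom c hc x
  exact h1.unique h2

/-- The coordinate version transferred to the Euclidean norm. Leaving out the origin admits
functions homogeneous of degree one. -/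
theorem variance_stdGaussian_le {g : EuclideanSpace ℝ (Fin m) → ℝ}
    {d : EuclideanSpace ℝ (Fin m) → EuclideanSpace ℝ (Fin m) →L[ℝ] ℝ} {C C' : ℝ}
    (hg : Continuous g) (hd : ∀ x ≠ 0, HasFDerivAt g (d x) x) (hdm : Measurable d)
    (hC : ∀ x, ‖d x‖ ≤ C) (hC' : ∀ x, |g x| ≤ C' * ‖x‖) :
    Var[g; stdGaussian (EuclideanSpace ℝ (Fin m))] ≤
      ∫ x, ‖d x‖ ^ 2 ∂(stdGaussian (EuclideanSpace ℝ (Fin m))) := by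
  have hLp : Continuous fun x : Fin m → ℝ => (WithLp.toLp 2 x : EuclideanSpace ℝ (Fin m)) := by
    fun_prop
  rcases Nat.eq_zero_or_pos m with rfl | hm
  · have : g = fun _ => g 0 := funext fun x => congrArg g (Subsingleton.elim _ _)
    rw [this, variance_eq_sub (memLp_const _)]
    simp
  have hC0 : 0 ≤ C := (norm_nonneg _).trans (hC 0)
  have hC'0 : 0 ≤ C' := by
    have : Nonempty (Fin m) := ⟨⟨0, hm⟩⟩
    obtain ⟨x, hx⟩ := exists_norm_eq (EuclideanSpace ℝ (Fin m)) zero_le_one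
    have := (abs_nonneg _).trans (hC' x)
    rwa [hx, mul_one] at this
  obtain ⟨K, hK0, hK⟩ : ∃ K : ℝ, 0 ≤ K ∧ ∀ x : Fin m → ℝ,
      ‖(WithLp.toLp 2 x : EuclideanSpace ℝ (Fin m))‖ ≤ K * ‖x‖ := by
    have h := PiLp.lipschitzWith_toLp 2 (fun _ : Fin m => ℝ)
    refine ⟨((Fintype.card (Fin m) : NNReal) ^ (1 / 2 : ENNReal).toReal : NNReal),
      NNReal.coe_nonneg _, fun x => ?_⟩
    simpa only [WithLp.toLp_zero, dist_zero_right] using h.dist_le_mul x 0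
  set b := EuclideanSpace.basisFun (Fin m) ℝ
  have hVar : Var[g; stdGaussian (EuclideanSpace ℝ (Fin m))] =
      Var[fun x => g (WithLp.toLp 2 x); gaussianPi m] := by
    rw [← map_pi_eq_stdGaussian, variance_map hg.measurable.aemeasurable (by fun_prop)]
    rfl
  have hdi : ∀ v, Measurable fun x => d x v := fun v => hdm.apply_continuousLinearMap v
  have hsum : ∀ x, ‖d x‖ ^ 2 = ∑ i, d x (b i) ^ 2 := fun x => norm_sq_eq_sum_sq_basisFun (d x)
  have hbd : ∀ x i, |d x (b i)| ≤ C := fun x i => by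
    have := (d x).le_opNorm (b i)
    rw [b.orthonormal.1 i, mul_one] at this
    exact this.trans (hC x)
  rw [hVar, integral_stdGaussian_eq (hdm.norm.pow_const 2)]
  have h := variance_gaussianPi_le m (g := fun x => g (WithLp.toLp 2 x))
    (g' := fun x i => d (WithLp.toLp 2 x) (b i)) (S := {0}) (C := C) (C' := C' * K)
    (countable_singleton 0) (hg.comp hLp) ?_ ?_ (fun x i => hbd _ _) ?_
  · refine h.trans_eq ?_
    rw [← integral_finsetSum]
    · simp only [hsum]
    · intro i _
      refine (integrable_const (C ^ 2)).mono'
        (((hdi (b i)).comp hLp.measurable).pow_const 2).aestronglyMeasurable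
        (Eventually.of_forall fun x => ?_)
      rw [Real.norm_eq_abs, abs_pow]
      exact pow_le_pow_left₀ (abs_nonneg _) (hbd _ _) 2
  · intro x hx i
    have hx' : (WithLp.toLp 2 x : EuclideanSpace ℝ (Fin m)) ≠ 0 := by
      simpa using hx
    have hline : HasDerivAt (fun s : ℝ => (WithLp.toLp 2 (Function.update x i s) :
        EuclideanSpace ℝ (Fin m))) (b i) (x i) := by
      have heq : (fun s : ℝ => (WithLp.toLp 2 (Function.update x i s) :
          EuclideanSpace ℝ (Fin m))) = fun s => WithLp.toLp 2 x + (s - x i) • b i := by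
        funext s
        ext j
        by_cases hj : j = i
        · subst hj; simp [b]
        · simp [b, hj]
      rw [heq]
      simpa using (((hasDerivAt_id (x i)).sub_const (x i)).smul_const (b i)).const_add
        (WithLp.toLp 2 x : EuclideanSpace ℝ (Fin m))
    refine HasFDerivAt.comp_hasDerivAt_of_eq (x i) (hd _ hx') hline ?_
    simp
  · exact measurable_pi_lambda _ fun i => (hdi (b i)).comp hLp.measurable
  · intro x
    calc _ ≤ C' * (K * ‖x‖) := (hC' _).trans (by gcongr; exact hK x)
      _ = C' * K * ‖x‖ := by ring
      _ ≤ _ := by gcongr; linarith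

theorem integral_norm_sq_stdGaussian :
    ∫ x, ‖x‖ ^ 2 ∂(stdGaussian (EuclideanSpace ℝ (Fin m))) = m := by
  have hvar : ∫ x : ℝ, x ^ 2 ∂(gaussianReal 0 1) = 1 := by
    have h1 := variance_eq_sub (memLp_id_gaussianReal' (μ := 0) (v := 1) 2 (by simp))
    simpa using h1.symm
  have hsq : Integrable (fun x : ℝ => x ^ 2) (gaussianReal 0 1) :=
    (memLp_id_gaussianReal' (μ := 0) (v := 1) 2 (by simp)).integrable_sq
  rw [integral_stdGaussian_eq (by fun_prop)]
  simp only [EuclideanSpace.norm_sq_eq, Real.norm_eq_abs, sq_abs]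
  rw [integral_finsetSum]
  · have : ∀ i : Fin m, ∫ x : Fin m → ℝ, x i ^ 2 ∂(gaussianPi m) = 1 := fun i => by
      rw [← hvar, ← (measurePreserving_eval (fun _ : Fin m => gaussianReal 0 1) i).map_eq,
        integral_map (measurable_pi_apply i).aemeasurable (by fun_prop)]
    simp [this]
  · intro i _
    exact (measurePreserving_eval
      (fun _ : Fin m => gaussianReal 0 1) i).integrable_comp_of_integrable
      hsq

theorem stdGaussian_singleton [NeZero m] :
    stdGaussian (EuclideanSpace ℝ (Fin m)) {0} = 0 := by
  have : NullSingletonClass (gaussianReal 0 1) := nullSingletonClass_gaussianReal one_ne_zero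
  rw [← map_pi_eq_stdGaussian, Measure.map_apply (by fun_prop) (measurableSet_singleton _)]
  refine measure_mono_null (t := {0}) (fun x hx => ?_) (measure_singleton _)
  simpa using hx

/-- Integrals of positively homogeneous functions against the standard Gaussian measure reduce to
integrals over the sphere. -/
theorem sphereMeasure_smul_integral_stdGaussian [NeZero m] (p : ℕ)
    {k : EuclideanSpace ℝ (Fin m) → ℝ} (hk : Measurable k) :
    (sphereMeasure (EuclideanSpace ℝ (Fin m))).real univ *
      ∫ x, ‖x‖ ^ p * k (‖x‖⁻¹ • x) ∂(stdGaussian (EuclideanSpace ℝ (Fin m))) =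
    (∫ x, ‖x‖ ^ p ∂(stdGaussian (EuclideanSpace ℝ (Fin m)))) *
      ∫ θ, k θ ∂(sphereMeasure (EuclideanSpace ℝ (Fin m))) := by
  set γ := stdGaussian (EuclideanSpace ℝ (Fin m))
  set w : (EuclideanSpace ℝ (Fin m)) → ℝ≥0∞ := fun x => ENNReal.ofReal (‖x‖ ^ p) with hw
  have hwm : Measurable w := by fun_prop
  set Ψ : (EuclideanSpace ℝ (Fin m)) → (EuclideanSpace ℝ (Fin m)) := fun x => ‖x‖⁻¹ • x with hΨ
  have hΨm : Measurable Ψ := by fun_prop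
  -- The weighted Gaussian pushed to the sphere along rays is finite and rotation-invariant, hence
  -- proportional to the cone measure; integrating `k` compares the two.
  set τ := (γ.withDensity w).map Ψ with hτ
  have hwint : Integrable (fun x : (EuclideanSpace ℝ (Fin m)) => ‖x‖ ^ p) γ := by
    have := (IsGaussian.memLp_id γ p (by simp)).integrable_norm_pow'
    simpa using this
  have hτu : τ univ = ENNReal.ofReal (∫ x, ‖x‖ ^ p ∂γ) := by
    rw [hτ, Measure.map_apply hΨm MeasurableSet.univ, preimage_univ, withDensity_apply _
      MeasurableSet.univ, Measure.restrict_univ,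
      ofReal_integral_eq_lintegral_ofReal hwint (Eventually.of_forall fun x => by positivity)]
  have hfin : IsFiniteMeasure τ := ⟨by rw [hτu]; exact ENNReal.ofReal_lt_top⟩
  have hrot : IsRotationInvariant τ := by
    intro e
    have he : Measurable e := e.continuous.measurable
    have hγe : γ.map e = γ := stdGaussian_map e
    have hpre : ∀ A : Set (EuclideanSpace ℝ (Fin m)), MeasurableSet A →
        τ A = ∫⁻ x in Ψ ⁻¹' A, w x ∂γ := fun A hA => by
      rw [hτ, Measure.map_apply hΨm hA, withDensity_apply _ (hΨm hA)]
    ext A hA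
    rw [Measure.map_apply he hA, hpre _ (he hA), hpre _ hA]
    conv_rhs => rw [← hγe]
    rw [setLIntegral_map (hΨm hA) hwm he]
    have hset : Ψ ⁻¹' (e ⁻¹' A) = e ⁻¹' (Ψ ⁻¹' A) := by
      ext x
      simp [hΨ]
    rw [hset]
    simp [hw]
  have hS : τ (Metric.sphere 0 1)ᶜ = 0 := by
    have hSm : MeasurableSet (Metric.sphere (0 : (EuclideanSpace ℝ (Fin m))) 1)ᶜ :=
      Metric.isClosed_sphere.measurableSet.compl
    rw [hτ, Measure.map_apply hΨm hSm]
    refine withDensity_absolutelyContinuous γ w ?_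
    refine measure_mono_null (t := {0}) (fun x hx => ?_) stdGaussian_singleton
    by_contra h0
    have h0' : ‖x‖ ≠ 0 := norm_ne_zero_iff.2 h0
    exact hx (by simp [hΨ, norm_smul, h0'])
  have huniq := hrot.smul_eq_smul isRotationInvariant_sphereMeasure hS sphereMeasure_compl
  have h1 : ∫ θ, k θ ∂τ = ∫ x, ‖x‖ ^ p * k (‖x‖⁻¹ • x) ∂γ := by
    rw [hτ, integral_map hΨm.aemeasurable hk.aestronglyMeasurable,
      integral_withDensity_eq_integral_toReal_smul hwm
        (Eventually.of_forall fun x => ENNReal.ofReal_lt_top)]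
    refine integral_congr_ae (Eventually.of_forall fun x => ?_)
    simp [hw, hΨ]
  have h2 := congrArg (fun μ : Measure (EuclideanSpace ℝ (Fin m)) => ∫ θ, k θ ∂μ) huniq
  simp only [integral_smul_measure, h1, smul_eq_mul] at h2
  rw [hτu, ENNReal.toReal_ofReal (integral_nonneg fun x => by positivity)] at h2
  exact h2

/-- **Poincaré inequality on the unit sphere**, for the restriction of a function that is
homogeneous of degree zero. -/
theorem sphere_poincare {n : ℕ} {u : EuclideanSpace ℝ (Fin (n + 1)) → ℝ}
    (hu : ContDiffOn ℝ 1 u {0}ᶜ) (hhom : ∀ c : ℝ, 0 < c → ∀ x, u (c • x) = u x)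
    (hmean : ∫ θ, u θ ∂(sphereMeasure (EuclideanSpace ℝ (Fin (n + 1)))) = 0) :
    n * ∫ θ, u θ ^ 2 ∂(sphereMeasure (EuclideanSpace ℝ (Fin (n + 1)))) ≤
      ∫ θ, ‖fderiv ℝ u θ‖ ^ 2 ∂(sphereMeasure (EuclideanSpace ℝ (Fin (n + 1)))) := by
  set σ := sphereMeasure (EuclideanSpace ℝ (Fin (n + 1)))
  set γ := stdGaussian (EuclideanSpace ℝ (Fin (n + 1)))
  have : NeZero (sphereMeasure (EuclideanSpace ℝ (Fin (n + 1)))) := ⟨sphereMeasure_ne_zero⟩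
  have hopen : IsOpen ({0}ᶜ : Set (EuclideanSpace ℝ (Fin (n + 1)))) := isOpen_compl_singleton
  have hud : ∀ x ≠ 0, HasFDerivAt u (fderiv ℝ u x) x := fun x hx =>
    ((hu.contDiffAt (hopen.mem_nhds hx)).differentiableAt one_ne_zero).hasFDerivAt
  have hfd : ContinuousOn (fderiv ℝ u) {0}ᶜ := hu.continuousOn_fderiv_of_isOpen hopen le_rfl
  have hSsub : Metric.sphere (0 : (EuclideanSpace ℝ (Fin (n + 1)))) 1 ⊆ {0}ᶜ := fun x hx h0 => by
    simp [mem_singleton_iff.1 h0] at hx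
  have hrad : ∀ x ≠ 0, fderiv ℝ u x x = 0 :=
    fun x hx => fderiv_apply_self_eq_zero hhom (hud x hx).differentiableAt
  have hfhom : ∀ c : ℝ, 0 < c → ∀ x ≠ 0, fderiv ℝ u (c • x) = c⁻¹ • fderiv ℝ u x := by
    intro c hc x hx
    have hcx : c • x ≠ 0 := smul_ne_zero hc.ne' hx
    have hl : HasFDerivAt (fun y : EuclideanSpace ℝ (Fin (n + 1)) => c • y)
        (c • ContinuousLinearMap.id ℝ (EuclideanSpace ℝ (Fin (n + 1)))) x :=
      (hasFDerivAt_id x).const_smul c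
    have h1 : HasFDerivAt (fun y : EuclideanSpace ℝ (Fin (n + 1)) => u (c • y))
        ((fderiv ℝ u (c • x)).comp (c • ContinuousLinearMap.id ℝ
          (EuclideanSpace ℝ (Fin (n + 1))))) x :=
      (hud _ hcx).comp x hl
    have h2 : HasFDerivAt (fun y : EuclideanSpace ℝ (Fin (n + 1)) => u (c • y))
        (fderiv ℝ u x) x := by
      refine (hud x hx).congr_of_eventuallyEq ?_
      filter_upwards [hopen.mem_nhds hx] with y hy
      exact hhom c hc y
    rw [← h1.unique h2]
    ext v
    simp [hc.ne']
  obtain ⟨M, hM⟩ := (isCompact_sphere (0 : (EuclideanSpace ℝ (Fin (n + 1)))) 1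
    ).exists_bound_of_continuousOn
    (hu.continuousOn.mono hSsub)
  obtain ⟨M', hM'⟩ := (isCompact_sphere (0 : (EuclideanSpace ℝ (Fin (n + 1)))) 1
    ).exists_bound_of_continuousOn (hfd.mono hSsub)
  have hunit : ∀ x : (EuclideanSpace ℝ (Fin (n + 1))), x ≠ 0 →
      ‖x‖⁻¹ • x ∈ Metric.sphere (0 : (EuclideanSpace ℝ (Fin (n + 1)))) 1 := fun x hx => by
    have := norm_ne_zero_iff.2 hx
    simp [norm_smul, this]
  have hu_unit : ∀ x ≠ 0, u (‖x‖⁻¹ • x) = u x := fun x hx =>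
    hhom _ (inv_pos.2 (norm_pos_iff.2 hx)) x
  have hf_unit : ∀ x ≠ 0, fderiv ℝ u (‖x‖⁻¹ • x) = ‖x‖ • fderiv ℝ u x := fun x hx => by
    rw [hfhom _ (inv_pos.2 (norm_pos_iff.2 hx)) x hx, inv_inv]
  have hub : ∀ x ≠ 0, |u x| ≤ M := fun x hx => by
    rw [← hu_unit x hx]
    exact hM _ (hunit x hx)
  -- Degree one is the extension that gives the sharp constant. In each direction `|∇g|² = |∇u|² +
  -- u²`, while the Gaussian mean of `|x|²` is `n + 1`. The Gaussian inequality thus reads `(n + 1)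
  -- ∫ u² ≤ ∫ |∇u|² + ∫ u²`.
  set g : (EuclideanSpace ℝ (Fin (n + 1))) → ℝ := fun x => ‖x‖ * u x with hg
  set d : (EuclideanSpace ℝ (Fin (n + 1))) → (EuclideanSpace ℝ (Fin (n + 1))) →L[ℝ] ℝ := fun x =>
    ({0}ᶜ : Set (EuclideanSpace ℝ (Fin (n + 1)))).indicator
      (fun x => ‖x‖ • fderiv ℝ u x + (u x * ‖x‖⁻¹) • innerSL ℝ x) x with hd
  have hum : Measurable u := measurable_of_continuousOn_compl_singleton 0 hu.continuousOn
  have hdm : Measurable d := by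
    refine Measurable.indicator ?_ (measurableSet_singleton _).compl
    exact (measurable_norm.smul (measurable_fderiv ℝ u)).add
      ((hum.mul measurable_norm.inv).smul (innerSL ℝ).continuous.measurable)
  have hdx : ∀ x ≠ 0, d x = ‖x‖ • fderiv ℝ u x + (u x * ‖x‖⁻¹) • innerSL ℝ x := fun x hx =>
    indicator_of_mem (s := ({0}ᶜ : Set (EuclideanSpace ℝ (Fin (n + 1))))) hx _
  have hdg : ∀ x ≠ 0, HasFDerivAt g (d x) x := by
    intro x hx
    rw [hdx x hx]
    have h1 : HasFDerivAt (fun x : EuclideanSpace ℝ (Fin (n + 1)) => ‖x‖)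
        (‖x‖⁻¹ • innerSL ℝ x) x := by
      have := (hasStrictFDerivAt_norm_sq x).hasFDerivAt.sqrt (by simpa using hx)
      simp only [Real.sqrt_sq (norm_nonneg _)] at this
      refine this.congr_fderiv ?_
      ext v
      simp
      ring
    refine (h1.mul (hud x hx)).congr_fderiv ?_
    rw [smul_smul]
  have hdn : ∀ x ≠ 0, ‖d x‖ ^ 2 = ‖fderiv ℝ u (‖x‖⁻¹ • x)‖ ^ 2 + u (‖x‖⁻¹ • x) ^ 2 := by
    intro x hx
    have hx0 := norm_ne_zero_iff.2 hx
    rw [hdx x hx, hf_unit x hx, hu_unit x hx]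
    set L := ‖x‖ • fderiv ℝ u x
    set gv := (InnerProductSpace.toDual ℝ (EuclideanSpace ℝ (Fin (n + 1)))).symm L with hgv
    have hgL : ∀ v, inner ℝ gv v = L v := fun v => InnerProductSpace.toDual_symm_apply
    have hLx : inner ℝ gv x = 0 := by
      rw [hgL]
      simp [L, hrad x hx]
    have heq : L + (u x * ‖x‖⁻¹) • innerSL ℝ x =
        InnerProductSpace.toDual ℝ (EuclideanSpace ℝ (Fin (n + 1))) (gv + (u x * ‖x‖⁻¹) • x) := by
      ext v
      simp [hgL]
    rw [heq, LinearIsometryEquiv.norm_map, norm_add_sq_real, inner_smul_right, hLx, norm_smul,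
      hgv, LinearIsometryEquiv.norm_map]
    simp only [norm_mul, norm_inv, Real.norm_eq_abs, abs_norm]
    rw [mul_assoc |u x|, inv_mul_cancel₀ hx0]
    simp
  have hM0 : 0 ≤ M := by
    obtain ⟨x, hx⟩ := exists_norm_eq (EuclideanSpace ℝ (Fin (n + 1))) zero_le_one
    exact (norm_nonneg _).trans (hM x (by simpa using hx))
  have hgb : ∀ x, |g x| ≤ M * ‖x‖ := by
    intro x
    rcases eq_or_ne x 0 with rfl | hx
    · simp [hg]
    · rw [hg, abs_mul, abs_norm, mul_comm]
      gcongr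
      exact hub x hx
  have hgc : Continuous g := by
    rw [continuous_iff_continuousAt]
    intro x
    rcases eq_or_ne x 0 with rfl | hx
    · have h0 : Tendsto (fun x : EuclideanSpace ℝ (Fin (n + 1)) => M * ‖x‖) (𝓝 0) (𝓝 0) := by
        have : Continuous fun x : EuclideanSpace ℝ (Fin (n + 1)) => M * ‖x‖ := by fun_prop
        simpa using this.tendsto 0
      have : Tendsto g (𝓝 0) (𝓝 0) := squeeze_zero_norm hgb h0
      have hg0 : g 0 = 0 := by simp [hg]
      rw [ContinuousAt, hg0]
      exact this
    · exact (hdg x hx).continuousAt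
  have hdb : ∀ x, ‖d x‖ ≤ √(M' ^ 2 + M ^ 2) := by
    intro x
    rcases eq_or_ne x 0 with rfl | hx
    · simp [hd]
    · apply Real.le_sqrt_of_sq_le
      rw [hdn x hx]
      have h1 := hM' _ (hunit x hx)
      have h2 := hM _ (hunit x hx)
      rw [← sq_abs (u _)]
      exact add_le_add (pow_le_pow_left₀ (norm_nonneg _) h1 2)
        (pow_le_pow_left₀ (abs_nonneg _) h2 2)
  have hpoin := variance_stdGaussian_le hgc hdg hdm hdb hgb
  have hne : ∀ᵐ x ∂γ, x ≠ 0 := by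
    rw [ae_iff]
    simp only [not_not]
    exact stdGaussian_singleton
  have hgL : MemLp g 2 γ := ((IsGaussian.memLp_id γ 2 (by simp)).norm.const_mul M).mono'
    hgc.aestronglyMeasurable (Eventually.of_forall hgb)
  have hmean0 : ∫ x, g x ∂γ = 0 := by
    have h := sphereMeasure_smul_integral_stdGaussian (m := n + 1) 1 hum
    rw [hmean, mul_zero] at h
    have hs : (sphereMeasure (EuclideanSpace ℝ (Fin (n + 1)))).real univ ≠ 0 :=
      measureReal_univ_pos.ne'
    have h' := (mul_eq_zero.1 h).resolve_left hs
    rw [← h']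
    refine integral_congr_ae (hne.mono fun x hx => ?_)
    simp only [hg, pow_one, hu_unit x hx]
  rw [variance_eq_sub hgL, hmean0] at hpoin
  set s := σ.real univ with hs
  have hs0 : 0 < s := measureReal_univ_pos
  have e1 : s * ∫ x, g x ^ 2 ∂γ = (n + 1) * ∫ θ, u θ ^ 2 ∂σ := by
    have h := sphereMeasure_smul_integral_stdGaussian (m := n + 1) 2 (hum.pow_const 2)
    rw [integral_norm_sq_stdGaussian] at h
    push_cast at h
    rw [← h]
    congr 1
    refine integral_congr_ae (hne.mono fun x hx => ?_)
    simp only [hg, hu_unit x hx]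
    ring
  -- The exponent is zero here because the gradient of `g` is homogeneous of degree zero, in
  -- contrast to degree two for `g ^ 2`.
  have e2 : s * ∫ x, ‖d x‖ ^ 2 ∂γ = ∫ θ, (‖fderiv ℝ u θ‖ ^ 2 + u θ ^ 2) ∂σ := by
    have h := sphereMeasure_smul_integral_stdGaussian (m := n + 1) 0
      (((measurable_fderiv ℝ u).norm.pow_const 2).add (hum.pow_const 2))
    simp only [pow_zero, integral_const, probReal_univ, smul_eq_mul, mul_one, one_mul] at h
    refine Eq.trans ?_ h
    congr 1
    refine integral_congr_ae (hne.mono fun x hx => ?_)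
    simp only [hdn x hx]
    rfl
  have hi1 : Integrable (fun θ => ‖fderiv ℝ u θ‖ ^ 2) σ := by
    refine (integrable_const (M' ^ 2)).mono'
      ((measurable_fderiv ℝ u).norm.pow_const 2).aestronglyMeasurable ?_
    filter_upwards [ae_sphereMeasure_norm_eq_one] with θ hθ
    rw [Real.norm_eq_abs, abs_of_nonneg (sq_nonneg _)]
    exact pow_le_pow_left₀ (norm_nonneg _) (hM' θ (by simpa using hθ)) 2
  have hi2 : Integrable (fun θ => u θ ^ 2) σ := by
    refine (integrable_const (M ^ 2)).mono' (hum.pow_const 2).aestronglyMeasurable ?_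
    filter_upwards [ae_sphereMeasure_norm_eq_one] with θ hθ
    rw [Real.norm_eq_abs, abs_pow]
    exact pow_le_pow_left₀ (abs_nonneg _) (hM θ (by simpa using hθ)) 2
  rw [integral_add hi1 hi2] at e2
  have hmul := mul_le_mul_of_nonneg_left hpoin hs0.le
  have e3 : ∫ x, (g ^ 2) x ∂γ = ∫ x, g x ^ 2 ∂γ := rfl
  rw [e3, e2, zero_pow two_ne_zero, sub_zero, e1] at hmul
  linarith

end SpherePoincare

/-! ### Star-shapedness and the radial function of a perturbed ball. -/

section RadialRepresentation

variable {E : Type} [NormedAddCommGroup E] [InnerProductSpace ℝ E] [FiniteDimensional ℝ E]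

/-- The inverses of a smooth family of diffeomorphisms form a smooth family. -/
theorem contDiffOn_family_inverse {ε : ℝ} {φ χ : ℝ → E → E}
    (hφ : ContDiffOn ℝ ∞ (fun p : ℝ × E => φ p.1 p.2) (Ioo (-ε) ε ×ˢ univ))
    (hχ : ∀ t ∈ Ioo (-ε) ε, ContDiff ℝ ∞ (χ t))
    (hl : ∀ t ∈ Ioo (-ε) ε, Function.LeftInverse (χ t) (φ t))
    (hr : ∀ t ∈ Ioo (-ε) ε, Function.RightInverse (χ t) (φ t)) :
    ContDiffOn ℝ ∞ (fun p : ℝ × E => χ p.1 p.2) (Ioo (-ε) ε ×ˢ univ) := by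
  have hU : IsOpen (Ioo (-ε) ε ×ˢ (univ : Set E)) := isOpen_Ioo.prod isOpen_univ
  -- Keeping `t` as a coordinate makes the derivative block triangular; it is injective because each
  -- `φ t` has a differentiable left inverse.
  have key : ContDiffOn ℝ ∞ (fun p : ℝ × E => (p.1, χ p.1 p.2))
      ((fun p : ℝ × E => (p.1, φ p.1 p.2)) '' (Ioo (-ε) ε ×ˢ univ)) := by
    refine contDiffOn_leftInverse hU (contDiff_fst.contDiffOn.prodMk hφ) ?_ ?_
    · rintro ⟨t, x⟩ hp
      have hA := ((hφ.contDiffAt (hU.mem_nhds hp)).differentiableAt (by simp)).hasFDerivAt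
      have hF : HasFDerivAt (fun p : ℝ × E => (p.1, φ p.1 p.2)) _ (t, x) :=
        (hasFDerivAt_fst (𝕜 := ℝ)).prodMk hA
      rw [hF.fderiv]
      have hx : HasFDerivAt (φ t) ((fderiv ℝ (fun p : ℝ × E => φ p.1 p.2) (t, x)).comp
          (ContinuousLinearMap.inr ℝ ℝ E)) x :=
        HasFDerivAt.comp x hA (hasFDerivAt_prodMk_right t x)
      have hid := (((hχ t hp.1).differentiable (by simp)) (φ t x)).hasFDerivAt.comp x hx
      have hid' : χ t ∘ φ t = id := funext (hl t hp.1)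
      rw [hid'] at hid
      have h1 := hid.unique (hasFDerivAt_id x)
      rw [injective_iff_map_eq_zero]
      rintro ⟨a, v⟩ h
      have ha : a = 0 := congrArg Prod.fst h
      subst ha
      have hv : fderiv ℝ (fun p : ℝ × E => φ p.1 p.2) (t, x) (0, v) = 0 := congrArg Prod.snd h
      have h2 := congrArg (fun A : E →L[ℝ] E => A v) h1
      simp [hv] at h2
      simp [← h2]
    · rintro ⟨t, x⟩ hp
      simp [hl t hp.1 x]
  refine (contDiff_snd.comp_contDiffOn key).mono ?_
  rintro ⟨t, y⟩ hp
  exact ⟨(t, χ t y), ⟨hp.1, mem_univ _⟩, by simp [hr t hp.1 y]⟩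

/-- The sublevel sets of small perturbations of `‖y‖ ^ 2` are star-shaped with smooth radial
function. -/
theorem exists_radial_function {ε r : ℝ} (hε : 0 < ε) (hr : 0 < r) {N : ℝ × E → ℝ}
    (hN : ContDiffOn ℝ ∞ N (Ioo (-ε) ε ×ˢ univ)) (hN0 : ∀ y, N (0, y) = ‖y‖ ^ 2) :
    ∃ τ > 0, ∃ R : ℝ × E → ℝ, ContDiffOn ℝ ∞ R (Ioo (-τ) τ ×ˢ {0}ᶜ) ∧
      (∀ t ∈ Ioo (-τ) τ, ∀ x, 0 < R (t, x)) ∧ (∀ x, R (0, x) = r) ∧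
      (∀ t, ∀ c : ℝ, 0 < c → ∀ x, R (t, c • x) = R (t, x)) ∧
      ∀ t ∈ Ioo (-τ) τ, N (t, 0) < r ^ 2 ∧ ∀ x ≠ 0, ‖x‖ < 2 * r →
        (N (t, x) < r ^ 2 ↔ ‖x‖ < R (t, x)) ∧ (N (t, x) = r ^ 2 ↔ ‖x‖ = R (t, x)) ∧
        R (t, x) < 2 * r := by
  have hU : IsOpen (Ioo (-ε) ε ×ˢ (univ : Set E)) := isOpen_Ioo.prod isOpen_univ
  have h0mem : ∀ y : E, ((0 : ℝ), y) ∈ Ioo (-ε) ε ×ˢ (univ : Set E) := fun y =>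
    ⟨⟨neg_lt_zero.2 hε, hε⟩, mem_univ _⟩
  have hNc : ∀ y, ContinuousAt N (0, y) := fun y =>
    hN.continuousOn.continuousAt (hU.mem_nhds (h0mem y))
  have hNd : ∀ p ∈ Ioo (-ε) ε ×ˢ (univ : Set E), HasFDerivAt N (fderiv ℝ N p) p := fun p hp =>
    ((hN.contDiffAt (hU.mem_nhds hp)).differentiableAt (by simp)).hasFDerivAt
  have hNfc : ContinuousOn (fderiv ℝ N) (Ioo (-ε) ε ×ˢ univ) :=
    hN.continuousOn_fderiv_of_isOpen hU (by simp)
  -- Three properties of `‖y‖ ^ 2` survive small perturbations by compactness: values below `r ^ 2`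
  -- on the ball of radius `r / 2`, radial growth on the shell up to `2 * r`, and values above `r ^
  -- 2` on the outer sphere. Each ray then meets the level `r ^ 2` exactly once within radius `2 *
  -- r`.
  have e1 : ∀ᶠ t in 𝓝 (0 : ℝ), ∀ y ∈ Metric.closedBall (0 : E) (r / 2), N (t, y) < r ^ 2 := by
    refine (isCompact_closedBall _ _).eventually_forall_of_forall_eventually fun y hy => ?_
    refine (hNc y).eventually_lt_const ?_
    rw [hN0]
    have : ‖y‖ ≤ r / 2 := by simpa using hy
    nlinarith [norm_nonneg y]
  have e2 : ∀ᶠ t in 𝓝 (0 : ℝ), ∀ y ∈ Metric.closedBall (0 : E) (2 * r) \ Metric.ball 0 (r / 2),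
      0 < fderiv ℝ N (t, y) (0, y) := by
    refine ((isCompact_closedBall _ _).diff
      Metric.isOpen_ball).eventually_forall_of_forall_eventually fun y hy => ?_
    have hc : ContinuousAt (fun p : ℝ × E => fderiv ℝ N p (0, p.2)) (0, y) :=
      (hNfc.continuousAt (hU.mem_nhds (h0mem y))).clm_apply (by fun_prop)
    refine hc.eventually_const_lt ?_
    have h1 : HasFDerivAt (fun z : E => N (0, z)) ((fderiv ℝ N (0, y)).comp
        (ContinuousLinearMap.inr ℝ ℝ E)) y :=
      HasFDerivAt.comp y (hNd _ (h0mem y)) (hasFDerivAt_prodMk_right 0 y)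
    simp only [hN0] at h1
    have h2 := h1.unique (hasStrictFDerivAt_norm_sq y).hasFDerivAt
    have h3 := congrArg (fun A : E →L[ℝ] ℝ => A y) h2
    simp only [ContinuousLinearMap.comp_apply, ContinuousLinearMap.inr_apply] at h3
    simp only [h3]
    have hy' : r / 2 ≤ ‖y‖ := by simpa using hy.2
    have hy0 : 0 < ‖y‖ := by linarith
    have : 0 < 2 * ‖y‖ ^ 2 := by positivity
    simpa using this
  have e3 : ∀ᶠ t in 𝓝 (0 : ℝ), ∀ y ∈ Metric.sphere (0 : E) (2 * r), r ^ 2 < N (t, y) := by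
    refine (isCompact_sphere _ _).eventually_forall_of_forall_eventually fun y hy => ?_
    refine (hNc y).eventually_const_lt ?_
    rw [hN0, mem_sphere_zero_iff_norm.1 hy]
    nlinarith
  obtain ⟨τ', hτ', hτ⟩ := Metric.eventually_nhds_iff.1 (e1.and (e2.and e3))
  set τ := min τ' ε with hτdef
  have hτ0 : 0 < τ := lt_min hτ' hε
  have hmem : ∀ t ∈ Ioo (-τ) τ, t ∈ Ioo (-ε) ε ∧ dist t 0 < τ' := by
    intro t ht
    have h1 := min_le_left τ' ε
    have h2 := min_le_right τ' ε
    refine ⟨⟨by linarith [ht.1], by linarith [ht.2]⟩, ?_⟩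
    rw [Real.dist_eq, sub_zero, abs_lt]
    exact ⟨by linarith [ht.1], by linarith [ht.2]⟩
  have hline : ∀ t ∈ Ioo (-τ) τ, ∀ θ : E, ∀ s : ℝ,
      HasDerivAt (fun s : ℝ => N (t, s • θ)) (fderiv ℝ N (t, s • θ) (0, θ)) s := by
    intro t ht θ s
    have h1 : HasDerivAt (fun s : ℝ => (t, s • θ)) ((0 : ℝ), θ) s := by
      have := (hasDerivAt_const s t).prodMk ((hasDerivAt_id s).smul_const θ)
      simpa using this
    exact (hNd (t, s • θ) ⟨(hmem t ht).1, mem_univ _⟩).comp_hasDerivAt s h1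
  have hpos : ∀ t ∈ Ioo (-τ) τ, ∀ θ : E, ‖θ‖ = 1 → ∀ s ∈ Icc (r / 2) (2 * r),
      0 < fderiv ℝ N (t, s • θ) (0, θ) := by
    intro t ht θ hθ s hs
    have hs0 : 0 < s := by linarith [hs.1]
    have hn : ‖s • θ‖ = s := by rw [norm_smul, hθ, mul_one, Real.norm_eq_abs, abs_of_pos hs0]
    have h := (hτ (hmem t ht).2).2.1 (s • θ) ⟨by simpa [hn] using hs.2, by simpa [hn] using hs.1⟩
    have : ((0 : ℝ), s • θ) = s • ((0 : ℝ), θ) := by simp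
    rw [this, map_smul, smul_eq_mul] at h
    exact pos_of_mul_pos_right h hs0.le
  have hmono : ∀ t ∈ Ioo (-τ) τ, ∀ θ : E, ‖θ‖ = 1 →
      StrictMonoOn (fun s : ℝ => N (t, s • θ)) (Icc (r / 2) (2 * r)) := by
    intro t ht θ hθ
    refine strictMonoOn_of_deriv_pos (convex_Icc _ _)
      (fun s _ => (hline t ht θ s).continuousAt.continuousWithinAt) fun s hs => ?_
    rw [(hline t ht θ s).deriv]
    exact hpos t ht θ hθ s (interior_subset hs)
  have hlow : ∀ t ∈ Ioo (-τ) τ, ∀ y : E, ‖y‖ ≤ r / 2 → N (t, y) < r ^ 2 := fun t ht y hy =>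
    (hτ (hmem t ht).2).1 y (by simpa using hy)
  have hex : ∀ (t : ℝ) (θ : E), ∃ s, t ∈ Ioo (-τ) τ → ‖θ‖ = 1 →
      s ∈ Ioo (r / 2) (2 * r) ∧ N (t, s • θ) = r ^ 2 := by
    intro t θ
    by_cases h : t ∈ Ioo (-τ) τ ∧ ‖θ‖ = 1
    swap
    · exact ⟨0, fun h1 h2 => (h ⟨h1, h2⟩).elim⟩
    obtain ⟨ht, hθ⟩ := h
    have hle : r / 2 ≤ 2 * r := by linarith
    have hI := intermediate_value_Ioo hle
      (fun s (_ : s ∈ Icc (r / 2) (2 * r)) => (hline t ht θ s).continuousAt.continuousWithinAt)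
    obtain ⟨s, hs, hs'⟩ := hI ⟨hlow t ht _ (by rw [norm_smul, hθ, Real.norm_eq_abs,
      abs_of_pos (by linarith), mul_one]), (hτ (hmem t ht).2).2.2 _ (by
        rw [mem_sphere_zero_iff_norm, norm_smul, hθ, Real.norm_eq_abs,
      abs_of_pos (by linarith), mul_one])⟩
    exact ⟨s, fun _ _ => ⟨hs, hs'⟩⟩
  choose S hS using hex
  classical
  -- The value `r` at the origin is a convention that keeps positivity, the initial condition and
  -- homogeneity valid for every `x`.
  set R : ℝ × E → ℝ := fun p => if p.2 = 0 then r else S p.1 (‖p.2‖⁻¹ • p.2) with hR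
  have hunit : ∀ x : E, x ≠ 0 → ‖‖x‖⁻¹ • x‖ = 1 := fun x hx => by
    rw [norm_smul, norm_inv, norm_norm, inv_mul_cancel₀ (norm_ne_zero_iff.2 hx)]
  have hRx : ∀ t, ∀ x ≠ 0, R (t, x) = S t (‖x‖⁻¹ • x) := fun t x hx => by simp [hR, hx]
  have hRS : ∀ t ∈ Ioo (-τ) τ, ∀ x ≠ 0, R (t, x) ∈ Ioo (r / 2) (2 * r) ∧
      N (t, R (t, x) • ‖x‖⁻¹ • x) = r ^ 2 := fun t ht x hx => by
    rw [hRx t x hx]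
    exact hS t _ ht (hunit x hx)
  have ht0 : (0 : ℝ) ∈ Ioo (-τ) τ := ⟨neg_lt_zero.2 hτ0, hτ0⟩
  refine ⟨τ, hτ0, R, ?_, ?_, ?_, ?_, ?_⟩
  · set U : Set (ℝ × E × ℝ) := Ioo (-τ) τ ×ˢ ({0}ᶜ ×ˢ Ioo (r / 2) (2 * r)) with hUdef
    have hUo : IsOpen U := isOpen_Ioo.prod (isOpen_compl_singleton.prod isOpen_Ioo)
    set q : ℝ × E × ℝ → ℝ × E := fun p => (p.1, p.2.2 • ‖p.2.1‖⁻¹ • p.2.1) with hq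
    -- Solving `N = r ^ 2` along rays amounts to inverting `M`; the last component of the inverse at
    -- level `r ^ 2` is `R`, which is therefore smooth.
    set M : ℝ × E × ℝ → ℝ × E × ℝ := fun p => (p.1, p.2.1, N (q p)) with hM
    have hqs : ContDiffOn ℝ ∞ q U := by
      have h1 : ContDiffOn ℝ ∞ (fun p : ℝ × E × ℝ => ‖p.2.1‖⁻¹) U := by
        have hx : ContDiffOn ℝ ∞ (fun p : ℝ × E × ℝ => p.2.1) U := by fun_prop
        exact (hx.norm ℝ fun p hp => hp.2.1).inv fun p hp => norm_ne_zero_iff.2 hp.2.1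
      exact contDiff_fst.contDiffOn.prodMk ((contDiff_snd.comp contDiff_snd).contDiffOn.smul
        (h1.smul (contDiff_fst.comp contDiff_snd).contDiffOn))
    have hqm : MapsTo q U (Ioo (-ε) ε ×ˢ univ) := fun p hp => ⟨(hmem _ hp.1).1, mem_univ _⟩
    have hNq : ContDiffOn ℝ ∞ (N ∘ q) U := hN.comp hqs hqm
    have hMs : ContDiffOn ℝ ∞ M U :=
      contDiff_fst.contDiffOn.prodMk ((contDiff_fst.comp contDiff_snd).contDiffOn.prodMk hNq)
    have hinj : InjOn M U := by
      rintro ⟨t, x, s⟩ hp ⟨t', x', s'⟩ hp' h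
      simp only [hM, hq, Prod.mk.injEq] at h
      obtain ⟨rfl, rfl, h⟩ := h
      have := (hmono t hp.1 _ (hunit x hp.2.1)).injOn (Ioo_subset_Icc_self hp.2.2)
        (Ioo_subset_Icc_self hp'.2.2) h
      exact congrArg (fun z => (t, x, z)) this
    have hleft : ∀ p ∈ U, Function.invFunOn M U (M p) = p := fun p hp =>
      hinj.leftInvOn_invFunOn hp
    have hd : ∀ p ∈ U, Function.Injective (fderiv ℝ M p) := by
      rintro ⟨t, x, s⟩ hp
      have hA := ((hNq.contDiffAt (hUo.mem_nhds hp)).differentiableAt (by simp)).hasFDerivAt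
      have hF : HasFDerivAt M ((ContinuousLinearMap.fst ℝ ℝ (E × ℝ)).prod
          (((ContinuousLinearMap.fst ℝ E ℝ).comp (ContinuousLinearMap.snd ℝ ℝ (E × ℝ))).prod
            (fderiv ℝ (N ∘ q) (t, x, s)))) (t, x, s) :=
        hasFDerivAt_fst.prodMk ((hasFDerivAt_fst.comp _ hasFDerivAt_snd).prodMk hA)
      rw [hF.fderiv, injective_iff_map_eq_zero]
      rintro ⟨a, v, b⟩ h
      have ha : a = 0 := congrArg Prod.fst h
      have hv : v = 0 := congrArg (fun z => z.2.1) h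
      subst ha hv
      have hb : fderiv ℝ (N ∘ q) (t, x, s) (0, 0, b) = 0 := congrArg (fun z => z.2.2) h
      have h1 : HasDerivAt (fun s : ℝ => (t, x, s)) ((0 : ℝ), (0 : E), (1 : ℝ)) s :=
        (hasDerivAt_const s t).prodMk ((hasDerivAt_const s x).prodMk (hasDerivAt_id s))
      have h2 := hA.comp_hasDerivAt s h1
      have h3 := HasDerivAt.unique h2 (hline t hp.1 (‖x‖⁻¹ • x) s)
      have h4 := hpos t hp.1 _ (hunit x hp.2.1) s (Ioo_subset_Icc_self hp.2.2)
      have h5 : ((0 : ℝ), (0 : E), b) = b • ((0 : ℝ), (0 : E), (1 : ℝ)) := by simp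
      rw [h5, map_smul, h3, smul_eq_mul] at hb
      have : b = 0 := (mul_eq_zero.1 hb).resolve_right h4.ne'
      simp [this]
    have hg := contDiffOn_leftInverse hUo hMs hd hleft
    have hmaps : MapsTo (fun p : ℝ × E => (p.1, p.2, r ^ 2)) (Ioo (-τ) τ ×ˢ {0}ᶜ) (M '' U) := by
      rintro ⟨t, x⟩ hp
      obtain ⟨h1, h2⟩ := hRS t hp.1 x hp.2
      exact ⟨(t, x, R (t, x)), ⟨hp.1, hp.2, h1⟩, by simp [hM, hq, h2]⟩
    have hcomp : ContDiffOn ℝ ∞ (fun p : ℝ × E =>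
        (Function.invFunOn M U (p.1, p.2, r ^ 2)).2.2) (Ioo (-τ) τ ×ˢ {0}ᶜ) :=
      (contDiff_snd.comp contDiff_snd).comp_contDiffOn
        (hg.comp (by fun_prop) hmaps)
    refine hcomp.congr ?_
    rintro ⟨t, x⟩ hp
    obtain ⟨h1, h2⟩ := hRS t hp.1 x hp.2
    have h3 : M (t, x, R (t, x)) = (t, x, r ^ 2) := by simp [hM, hq, h2]
    simp only
    rw [← h3, hleft (t, x, R (t, x)) ⟨hp.1, hp.2, h1⟩]
  · intro t ht x
    by_cases hx : x = 0
    · simpa [hR, hx] using hr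
    · linarith [(hRS t ht x hx).1.1]
  · intro x
    by_cases hx : x = 0
    · simp [hR, hx]
    · obtain ⟨h1, h2⟩ := hRS 0 ht0 x hx
      have h3 : 0 < R (0, x) := by linarith [h1.1]
      rw [hN0, norm_smul, hunit x hx, mul_one, Real.norm_eq_abs, sq_abs] at h2
      exact (pow_left_inj₀ h3.le hr.le two_ne_zero).1 h2
  · intro t c hc x
    by_cases hx : x = 0
    · simp [hx]
    · rw [hRx _ _ (smul_ne_zero hc.ne' hx), hRx _ _ hx, norm_smul, Real.norm_eq_abs,
        abs_of_pos hc, mul_inv, smul_smul, mul_right_comm, inv_mul_cancel₀ hc.ne', one_mul]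
  · intro t ht
    refine ⟨hlow t ht 0 (by simp; linarith), fun x hx hx2 => ?_⟩
    obtain ⟨h1, h2⟩ := hRS t ht x hx
    set θ := ‖x‖⁻¹ • x with hθ
    have hxθ : ‖x‖ • θ = x := smul_inv_smul₀ (norm_ne_zero_iff.2 hx) x
    have hm := hmono t ht θ (hunit x hx)
    by_cases hsmall : ‖x‖ ≤ r / 2
    · have h3 := hlow t ht x hsmall
      have h4 : ‖x‖ < R (t, x) := by linarith [h1.1]
      exact ⟨by simp [h3, h4], by simp [h3.ne, h4.ne], h1.2⟩
    · have hxI : ‖x‖ ∈ Icc (r / 2) (2 * r) := ⟨by linarith, hx2.le⟩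
      have hRI := Ioo_subset_Icc_self h1
      have h3 := hm.lt_iff_lt hxI hRI
      have h4 := hm.injOn.eq_iff hxI hRI
      simp only [hxθ, h2] at h3 h4
      exact ⟨h3, h4, h1.2⟩

end RadialRepresentation

/-- Along a variation, a ball centred at the origin stays star-shaped for a short time, with a
smooth radial function `R`. -/
theorem IsVariation.exists_radial {n : ℕ} {ε r : ℝ}
    {φ : ℝ → EuclideanSpace ℝ (Fin (n + 1)) → EuclideanSpace ℝ (Fin (n + 1))}
    (hφ : IsVariation ε φ) (hr : 0 < r) :
    ∃ τ > 0, ∃ R : ℝ × EuclideanSpace ℝ (Fin (n + 1)) → ℝ,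
      ContDiffOn ℝ ∞ R (Ioo (-τ) τ ×ˢ {0}ᶜ) ∧
      (∀ t ∈ Ioo (-τ) τ, ∀ x, 0 < R (t, x)) ∧ (∀ x, R (0, x) = r) ∧
      (∀ t, ∀ c : ℝ, 0 < c → ∀ x, R (t, c • x) = R (t, x)) ∧
      ∀ t ∈ Ioo (-τ) τ, φ t '' Metric.ball 0 r = {x | x = 0 ∨ ‖x‖ < R (t, x)} ∧
        frontier (φ t '' Metric.ball 0 r) = (fun x => R (t, x) • x) '' Metric.sphere 0 1 := by
  obtain ⟨hε, hs, h0, hdiff⟩ := hφ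
  have hdiff' : ∀ t, ∃ χ : EuclideanSpace ℝ (Fin (n + 1)) → EuclideanSpace ℝ (Fin (n + 1)),
      t ∈ Ioo (-ε) ε → ContDiff ℝ ∞ χ ∧ Function.LeftInverse χ (φ t) ∧
        Function.RightInverse χ (φ t) := by
    intro t
    by_cases ht : t ∈ Ioo (-ε) ε
    · obtain ⟨χ, hχ⟩ := hdiff t ht
      exact ⟨χ, fun _ => hχ⟩
    · exact ⟨id, fun h => (ht h).elim⟩
  choose χ hχ using hdiff'
  have hχs := contDiffOn_family_inverse hs (fun t ht => (hχ t ht).1) (fun t ht => (hχ t ht).2.1)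
    (fun t ht => (hχ t ht).2.2)
  have ht0 : (0 : ℝ) ∈ Ioo (-ε) ε := ⟨neg_lt_zero.2 hε, hε⟩
  have hχ0 : ∀ y, χ 0 y = y := fun y => by
    have := (hχ 0 ht0).2.1 y
    rwa [h0] at this
  -- The image of the ball is the sublevel set `{‖χ t y‖ < r}`; squaring makes the defining function
  -- smooth.
  obtain ⟨τ₁, hτ₁, R, hRs, hRpos, hR0, hRhom, hR⟩ := exists_radial_function hε hr
    (N := fun p => ‖χ p.1 p.2‖ ^ 2) (hχs.norm_sq ℝ) (fun y => by simp only [hχ0])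
  have hU : IsOpen (Ioo (-ε) ε ×ˢ (univ : Set (EuclideanSpace ℝ (Fin (n + 1))))) :=
    isOpen_Ioo.prod isOpen_univ
  have hev : ∀ᶠ t in 𝓝 (0 : ℝ), ∀ x ∈ Metric.closedBall (0 : EuclideanSpace ℝ (Fin (n + 1))) r,
      ‖φ t x‖ < 2 * r := by
    refine (isCompact_closedBall _ _).eventually_forall_of_forall_eventually fun x hx => ?_
    have hc := (hs.continuousOn.continuousAt (hU.mem_nhds (x := (0, x)) ⟨ht0, mem_univ _⟩)).norm
    refine hc.eventually_lt_const ?_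
    simp only [h0]
    have : ‖x‖ ≤ r := by simpa using hx
    linarith
  obtain ⟨τ₂, hτ₂, hev'⟩ := Metric.eventually_nhds_iff.1 hev
  set τ := min (min τ₁ τ₂) ε
  have hτ1 : τ ≤ τ₁ := (min_le_left _ _).trans (min_le_left _ _)
  have hτ2 : τ ≤ τ₂ := (min_le_left _ _).trans (min_le_right _ _)
  have hτ3 : τ ≤ ε := min_le_right _ _
  have hm1 : ∀ t ∈ Ioo (-τ) τ, t ∈ Ioo (-τ₁) τ₁ := fun t ht =>
    ⟨by linarith [ht.1], by linarith [ht.2]⟩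
  have hm3 : ∀ t ∈ Ioo (-τ) τ, t ∈ Ioo (-ε) ε := fun t ht =>
    ⟨by linarith [ht.1], by linarith [ht.2]⟩
  refine ⟨τ, lt_min (lt_min hτ₁ hτ₂) hε, R, hRs.mono (prod_mono hm1 subset_rfl),
    fun t ht => hRpos t (hm1 t ht), hR0, hRhom, fun t ht => ?_⟩
  obtain ⟨hcχ, hl, hr'⟩ := hχ t (hm3 t ht)
  have hfar : ∀ y, ‖χ t y‖ ≤ r → ‖y‖ < 2 * r := by
    intro y hy
    have h := @hev' t (by
      rw [Real.dist_eq, sub_zero, abs_lt]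
      exact ⟨by linarith [ht.1], by linarith [ht.2]⟩) (χ t y) (by simpa using hy)
    rwa [hr' y] at h
  obtain ⟨hc0, hcx⟩ := hR t (hm1 t ht)
  have hsq : ∀ y, ‖χ t y‖ ^ 2 < r ^ 2 ↔ ‖χ t y‖ < r := fun y =>
    pow_lt_pow_iff_left₀ (norm_nonneg _) hr.le two_ne_zero
  have hsq' : ∀ y, ‖χ t y‖ ^ 2 = r ^ 2 ↔ ‖χ t y‖ = r := fun y =>
    pow_left_inj₀ (norm_nonneg _) hr.le two_ne_zero
  have himg : ∀ A : Set (EuclideanSpace ℝ (Fin (n + 1))), φ t '' A = χ t ⁻¹' A := fun A =>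
    congrFun (image_eq_preimage_of_inverse hl hr') A
  -- `R` depends only on the direction, so `x` may be rescaled to norm `r`, where the bound is
  -- available.
  have hRlt : ∀ x ≠ 0, R (t, x) < 2 * r := by
    intro x hx
    have hc : 0 < r / ‖x‖ := div_pos hr (norm_pos_iff.2 hx)
    rw [← hRhom t _ hc x]
    refine (hcx _ (smul_ne_zero hc.ne' hx) ?_).2.2
    rw [norm_smul, Real.norm_eq_abs, abs_of_pos hc, div_mul_cancel₀ _ (norm_ne_zero_iff.2 hx)]
    linarith
  refine ⟨?_, ?_⟩
  · rw [himg]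
    ext y
    simp only [mem_preimage, mem_ball_zero_iff, Set.mem_ofPred_eq]
    rcases eq_or_ne y 0 with rfl | hy
    · simpa [hsq] using (hsq 0).1 hc0
    · constructor
      · intro h
        exact Or.inr ((hcx y hy (hfar y h.le)).1.1 ((hsq y).2 h))
      · intro h
        have h' := h.resolve_left hy
        exact (hsq y).1 ((hcx y hy (h'.trans (hRlt y hy))).1.2 h')
  · have hφc : Continuous (φ t) := by
      rw [← continuousOn_univ]
      exact hs.continuousOn.comp (f := fun x => (t, x)) (by fun_prop)
        (fun x _ => ⟨hm3 t ht, mem_univ _⟩)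
    let H : EuclideanSpace ℝ (Fin (n + 1)) ≃ₜ EuclideanSpace ℝ (Fin (n + 1)) :=
      { toFun := φ t, invFun := χ t, left_inv := hl, right_inv := hr',
        continuous_toFun := hφc, continuous_invFun := hcχ.continuous }
    have hfr : frontier (φ t '' Metric.ball 0 r) = φ t '' Metric.sphere 0 r := by
      rw [← frontier_ball 0 hr.ne']
      exact (H.image_frontier _).symm
    rw [hfr, himg]
    ext y
    simp only [mem_preimage, mem_sphere_zero_iff_norm, mem_image]
    constructor
    · intro h
      have hy : y ≠ 0 := by
        rintro rfl
        exact absurd h ((hsq 0).1 hc0).ne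
      have h1 := (hcx y hy (hfar y h.le)).2.1.1 ((hsq' y).2 h)
      have hy0 := norm_ne_zero_iff.2 hy
      refine ⟨‖y‖⁻¹ • y, by rw [norm_smul, norm_inv, norm_norm, inv_mul_cancel₀ hy0], ?_⟩
      rw [hRhom t _ (inv_pos.2 (norm_pos_iff.2 hy)), ← h1, smul_inv_smul₀ hy0]
    · rintro ⟨θ, hθ, rfl⟩
      have hθ0 : θ ≠ 0 := by
        rintro rfl
        simp at hθ
      have hp := hRpos t (hm1 t ht) θ
      have hnorm : ‖R (t, θ) • θ‖ = R (t, θ) := by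
        rw [norm_smul, hθ, mul_one, Real.norm_eq_abs, abs_of_pos hp]
      refine (hsq' _).1 ((hcx _ (smul_ne_zero hp.ne' hθ0) ?_).2.1.2 ?_)
      · rw [hnorm]
        exact hRlt θ hθ0
      · rw [hnorm, hRhom t _ hp]

/-! ### Calculus of second-order jets in one real variable. -/

section Jets

/-- `f` has value `a`, derivative `b` and second derivative `c` at `t`. -/
def HasJetAt (f : ℝ → ℝ) (a b c t : ℝ) : Prop :=
  f t = a ∧ ∃ f' : ℝ → ℝ, (∀ᶠ s in 𝓝 t, HasDerivAt f (f' s) s) ∧ f' t = b ∧ HasDerivAt f' c t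

namespace HasJetAt

variable {f g : ℝ → ℝ} {a b c a' b' c' t : ℝ}

theorem hasDerivAt (h : HasJetAt f a b c t) : HasDerivAt f b t := by
  obtain ⟨-, f', h1, rfl, -⟩ := h
  exact h1.self_of_nhds

theorem congr (h : HasJetAt f a b c t) (hg : g =ᶠ[𝓝 t] f) : HasJetAt g a b c t := by
  obtain ⟨rfl, f', h1, rfl, h3⟩ := h
  refine ⟨hg.eq_of_nhds, f', ?_, rfl, h3⟩
  filter_upwards [h1, hg.eventuallyEq_nhds] with s hs hgs
  exact hs.congr_of_eventuallyEq hgs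

theorem unique (h : HasJetAt f a b c t) (h' : HasJetAt f a' b' c' t) :
    a = a' ∧ b = b' ∧ c = c' := by
  refine ⟨h.1.symm.trans h'.1, h.hasDerivAt.unique h'.hasDerivAt, ?_⟩
  obtain ⟨-, f', h1, -, h3⟩ := h
  obtain ⟨-, f'', h1', -, h3'⟩ := h'
  refine h3.unique (h3'.congr_of_eventuallyEq ?_)
  filter_upwards [h1, h1'] with s hs hs' using hs.unique hs'

theorem iteratedDeriv_eq (h : HasJetAt f a b c t) : iteratedDeriv 2 f t = c := by
  obtain ⟨-, f', h1, -, h3⟩ := h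
  rw [iteratedDeriv_succ, iteratedDeriv_one]
  refine (h3.congr_of_eventuallyEq ?_).deriv
  filter_upwards [h1] with s hs using hs.deriv

theorem of_contDiffAt (hf : ContDiffAt ℝ 2 f t) :
    HasJetAt f (f t) (deriv f t) (iteratedDeriv 2 f t) t := by
  refine ⟨rfl, deriv f, ?_, rfl, ?_⟩
  · filter_upwards [hf.eventually (by simp)] with s hs
    exact (hs.differentiableAt (by simp)).hasDerivAt
  · have h1 : ContDiffAt ℝ 1 (deriv f) t := by
      have h2 : deriv f = fun x => fderiv ℝ f x 1 := funext fun x => fderiv_apply_one_eq_deriv.symm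
      rw [h2]
      exact (hf.fderiv_right (m := 1) (by norm_num)).clm_apply contDiffAt_const
    rw [iteratedDeriv_succ, iteratedDeriv_one]
    exact (h1.differentiableAt (by simp)).hasDerivAt

theorem const (a t : ℝ) : HasJetAt (fun _ => a) a 0 0 t :=
  ⟨rfl, fun _ => 0, Eventually.of_forall fun s => hasDerivAt_const s a, rfl, hasDerivAt_const t 0⟩

theorem add (hf : HasJetAt f a b c t) (hg : HasJetAt g a' b' c' t) :
    HasJetAt (fun s => f s + g s) (a + a') (b + b') (c + c') t := by
  obtain ⟨rfl, f', h1, rfl, h3⟩ := hf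
  obtain ⟨rfl, g', k1, rfl, k3⟩ := hg
  refine ⟨rfl, fun s => f' s + g' s, ?_, rfl, h3.add k3⟩
  filter_upwards [h1, k1] with s hs ks using hs.add ks

theorem mul (hf : HasJetAt f a b c t) (hg : HasJetAt g a' b' c' t) :
    HasJetAt (fun s => f s * g s) (a * a') (b * a' + a * b')
      (c * a' + 2 * (b * b') + a * c') t := by
  obtain ⟨rfl, f', h1, rfl, h3⟩ := hf
  obtain ⟨rfl, g', k1, rfl, k3⟩ := hg
  refine ⟨rfl, fun s => f' s * g s + f s * g' s, ?_, rfl, ?_⟩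
  · filter_upwards [h1, k1] with s hs ks using hs.mul ks
  · refine ((h3.mul k1.self_of_nhds).add (h1.self_of_nhds.mul k3)).congr_deriv ?_
    ring

theorem comp (hg : HasJetAt g a' b' c' a) (hf : HasJetAt f a b c t) :
    HasJetAt (fun s => g (f s)) a' (b' * b) (c' * b ^ 2 + b' * c) t := by
  have hc := hf.hasDerivAt.continuousAt
  obtain ⟨rfl, f', h1, rfl, h3⟩ := hf
  obtain ⟨rfl, g', k1, rfl, k3⟩ := hg
  refine ⟨rfl, fun s => g' (f s) * f' s, ?_, rfl, ?_⟩
  · filter_upwards [h1, hc.eventually k1] with s hs ks using ks.comp s hs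
  · refine ((k3.comp t h1.self_of_nhds).mul h3).congr_deriv ?_
    simp only [Function.comp_apply]
    ring

theorem sum {ι : Type} (s : Finset ι) {f : ι → ℝ → ℝ} {a b c : ι → ℝ}
    (h : ∀ i ∈ s, HasJetAt (f i) (a i) (b i) (c i) t) :
    HasJetAt (fun x => ∑ i ∈ s, f i x) (∑ i ∈ s, a i) (∑ i ∈ s, b i) (∑ i ∈ s, c i) t := by
  classical
  induction s using Finset.induction_on with
  | empty => simpa using const 0 t
  | insert i s hi ih =>
    simp only [Finset.sum_insert hi]
    exact (h i (Finset.mem_insert_self i s)).add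
      (ih fun j hj => h j (Finset.mem_insert_of_mem hj))

/-- The second-order jet of the area element of a graph over a critical point. -/
theorem sqrt_one_add_sum_div {ι : Type} [Fintype ι] {ρ : ℝ → ℝ} {v : ι → ℝ → ℝ} {r b c : ℝ}
    {v' v'' : ι → ℝ} (hr : r ≠ 0) (hρ : HasJetAt ρ r b c t)
    (hv : ∀ i, HasJetAt (v i) 0 (v' i) (v'' i) t) :
    HasJetAt (fun s => √(1 + (∑ i, v i s ^ 2) / ρ s ^ 2)) 1 0 ((∑ i, v' i ^ 2) / r ^ 2) t := by
  -- Each `v i` vanishes at `t`, so the sum of squares vanishes to first order. Hence the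
  -- derivatives of `1 / ρ ^ 2` and the second derivative of the square root do not contribute.
  have h1 : HasJetAt (fun s => ∑ i, v i s ^ 2) 0 0 (2 * ∑ i, v' i ^ 2) t := by
    have := sum Finset.univ fun i (_ : i ∈ Finset.univ) => (hv i).mul (hv i)
    simp only [mul_zero, zero_mul, add_zero, Finset.sum_const_zero, zero_add] at this
    rw [Finset.mul_sum]
    simpa only [sq] using this
  have h2 : HasJetAt (fun x : ℝ => (x ^ 2)⁻¹) (r ^ 2)⁻¹ _ _ r :=
    of_contDiffAt ((contDiffAt_id.pow 2).inv (pow_ne_zero 2 hr))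
  have h3 := h1.mul (h2.comp hρ)
  simp only [zero_mul, mul_zero, add_zero] at h3
  have h4 : HasJetAt (fun x : ℝ => √(1 + x)) 1 (1 / 2) (iteratedDeriv 2 (fun x : ℝ => √(1 + x)) 0)
      0 := by
    have h := of_contDiffAt (f := fun x : ℝ => √(1 + x)) (t := 0)
      ((contDiffAt_const.add contDiffAt_id).sqrt (by simp))
    have hd : HasDerivAt (fun x : ℝ => √(1 + x)) (1 / 2) 0 := by
      have := ((hasDerivAt_id (0 : ℝ)).const_add 1).sqrt (by simp)
      simpa using this
    rw [hd.deriv] at h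
    simpa using h
  have h5 := h4.comp h3
  simp only [mul_zero, ← div_eq_mul_inv] at h5
  convert h5 using 1
  ring

end HasJetAt

/-- The second-order jet of a slice of a function of two variables. -/
theorem hasJetAt_slice {X : Type} [NormedAddCommGroup X] [NormedSpace ℝ X]
    {U : Set ℝ} {W : Set X} (hU : IsOpen U) (hW : IsOpen W) {H : ℝ × X → ℝ}
    (hH : ContDiffOn ℝ ∞ H (U ×ˢ W)) {t : ℝ} (ht : t ∈ U) {x : X} (hx : x ∈ W) :
    HasJetAt (fun s => H (s, x)) (H (t, x)) (fderiv ℝ H (t, x) (1, 0))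
      (fderiv ℝ (fun p => fderiv ℝ H p (1, 0)) (t, x) (1, 0)) t := by
  have hUW := hU.prod hW
  have hH' : ContDiffOn ℝ ∞ (fun p => fderiv ℝ H p (1, 0)) (U ×ˢ W) :=
    (hH.fderiv_of_isOpen hUW (by simp)).clm_apply contDiffOn_const
  refine ⟨rfl, fun s => fderiv ℝ H (s, x) (1, 0), ?_, rfl, ?_⟩
  · filter_upwards [hU.mem_nhds ht] with s hs
    exact HasFDerivAt.comp_hasDerivAt s ((hH.contDiffAt
      (hUW.mem_nhds ⟨hs, hx⟩)).differentiableAt (by simp)).hasFDerivAt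
      ((hasDerivAt_id s).prodMk (hasDerivAt_const s x))
  · exact HasFDerivAt.comp_hasDerivAt t ((hH'.contDiffAt
      (hUW.mem_nhds ⟨ht, hx⟩)).differentiableAt (by simp)).hasFDerivAt
      ((hasDerivAt_id t).prodMk (hasDerivAt_const t x))

/-- Differentiation under the integral sign for second-order jets. -/
theorem hasJetAt_setIntegral {X : Type} [NormedAddCommGroup X] [NormedSpace ℝ X]
    [SecondCountableTopology X] [MeasurableSpace X] [BorelSpace X]
    {μ : Measure X} [IsFiniteMeasureOnCompacts μ] {U : Set ℝ} {W K : Set X} (hU : IsOpen U)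
    (hW : IsOpen W) (hK : IsCompact K) (hKW : K ⊆ W) {H : ℝ × X → ℝ}
    (hH : ContDiffOn ℝ ∞ H (U ×ˢ W)) {t : ℝ} (ht : t ∈ U) {a b c : X → ℝ}
    (h : ∀ x ∈ K, HasJetAt (fun s => H (s, x)) (a x) (b x) (c x) t) :
    HasJetAt (fun s => ∫ x in K, H (s, x) ∂μ) (∫ x in K, a x ∂μ) (∫ x in K, b x ∂μ)
      (∫ x in K, c x ∂μ) t := by
  have hUW := hU.prod hW
  set H' : ℝ × X → ℝ := fun p => fderiv ℝ H p (1, 0) with hH'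
  have hH's : ContDiffOn ℝ ∞ H' (U ×ˢ W) :=
    (hH.fderiv_of_isOpen hUW (by simp)).clm_apply contDiffOn_const
  have hjet : ∀ x ∈ K, H (t, x) = a x ∧ H' (t, x) = b x ∧ fderiv ℝ H' (t, x) (1, 0) = c x := by
    intro x hx
    exact (hasJetAt_slice hU hW hH ht (hKW hx)).unique (h x hx)
  refine ⟨setIntegral_congr_fun hK.measurableSet fun x hx => (hjet x hx).1,
    fun s => ∫ x in K, H' (s, x) ∂μ, ?_,
    setIntegral_congr_fun hK.measurableSet fun x hx => (hjet x hx).2.1, ?_⟩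
  · filter_upwards [hU.mem_nhds ht] with s hs
    exact hasDerivAt_setIntegral_of_contDiffOn hU hW hK hKW (hH.of_le (by simp)) hs
  · rw [← setIntegral_congr_fun hK.measurableSet fun x hx => (hjet x hx).2.2]
    exact hasDerivAt_setIntegral_of_contDiffOn hU hW hK hKW (hH's.of_le (by simp)) ht

end Jets

/-! ### Weighted volume and perimeter in polar form. -/

section RadialDensity

variable {n : ℕ} {ψ : EuclideanSpace ℝ (Fin (n + 1)) → ℝ}

/-- The values of `ψ` along a fixed line through the origin. -/
noncomputable def radialProfile (ψ : EuclideanSpace ℝ (Fin (n + 1)) → ℝ) (s : ℝ) : ℝ :=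
  ψ (s • EuclideanSpace.single 0 1)

/-- The weighted area element of the sphere of radius `s`. -/
noncomputable def areaDensity (ψ : EuclideanSpace ℝ (Fin (n + 1)) → ℝ) (s : ℝ) : ℝ :=
  Real.exp (radialProfile ψ s) * s ^ n

/-- The weighted volume, per unit solid angle, of the ball of radius `s`. -/
noncomputable def volumeDensity (ψ : EuclideanSpace ℝ (Fin (n + 1)) → ℝ) (s : ℝ) : ℝ :=
  ∫ x in (0 : ℝ)..s, areaDensity ψ x

theorem contDiff_radialProfile (hψ : ContDiff ℝ ∞ ψ) : ContDiff ℝ ∞ (radialProfile ψ) :=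
  hψ.comp (contDiff_id.smul contDiff_const)

theorem contDiff_areaDensity (hψ : ContDiff ℝ ∞ ψ) : ContDiff ℝ ∞ (areaDensity ψ) :=
  (contDiff_radialProfile hψ).exp.mul (contDiff_id.pow n)

theorem areaDensity_pos {s : ℝ} (hs : 0 < s) : 0 < areaDensity ψ s := by
  unfold areaDensity
  positivity

theorem hasDerivAt_volumeDensity (hψ : ContDiff ℝ ∞ ψ) (s : ℝ) :
    HasDerivAt (volumeDensity ψ) (areaDensity ψ s) s :=
  have hc := (contDiff_areaDensity hψ).continuous
  intervalIntegral.integral_hasDerivAt_right (hc.intervalIntegrable _ _)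
    (hc.stronglyMeasurableAtFilter _ _) hc.continuousAt

theorem contDiff_volumeDensity (hψ : ContDiff ℝ ∞ ψ) : ContDiff ℝ ∞ (volumeDensity ψ) := by
  rw [contDiff_infty_iff_deriv]
  refine ⟨fun s => (hasDerivAt_volumeDensity hψ s).differentiableAt, ?_⟩
  have : deriv (volumeDensity ψ) = areaDensity ψ :=
    funext fun s => (hasDerivAt_volumeDensity hψ s).deriv
  rw [this]
  exact contDiff_areaDensity hψ

theorem volumeDensity_nonneg {s : ℝ} (hs : 0 ≤ s) : 0 ≤ volumeDensity ψ s :=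
  intervalIntegral.integral_nonneg hs fun x hx => by
    have := hx.1
    unfold areaDensity
    positivity

/-- The logarithmic derivative of `e^δ s^n` is `δ' + n / s`, the weighted mean curvature of the
sphere; keeping `areaDensity` as a factor makes the later cancellation visible. -/
theorem hasJetAt_areaDensity (hψ : ContDiff ℝ ∞ ψ) {r : ℝ} (hr : 0 < r) :
    HasJetAt (areaDensity ψ) (areaDensity ψ r)
      (areaDensity ψ r * (deriv (radialProfile ψ) r + n / r))
      (areaDensity ψ r * ((deriv (radialProfile ψ) r + n / r) ^ 2 +
        iteratedDeriv 2 (radialProfile ψ) r - n / r ^ 2)) r := by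
  have hp := HasJetAt.of_contDiffAt (t := r)
    (contDiff_infty.1 (contDiff_radialProfile hψ) 2).contDiffAt
  obtain ⟨-, p', h1, h2, h3⟩ := hp
  have hA : ∀ᶠ s in 𝓝 r, HasDerivAt (areaDensity ψ) (areaDensity ψ s * (p' s + n / s)) s := by
    filter_upwards [h1, lt_mem_nhds hr] with s hs hs0
    refine (hs.exp.mul (hasDerivAt_pow n s)).congr_deriv ?_
    unfold areaDensity
    -- The power rule involves the truncated exponent `n - 1`, so `n = 0` is separate.
    rcases n with _ | k
    · simp
    · have : s ≠ 0 := hs0.ne'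
      simp only [Nat.add_sub_cancel]
      field_simp
      ring
  refine ⟨rfl, _, hA, by rw [h2], ?_⟩
  refine (hA.self_of_nhds.mul (h3.add ((hasDerivAt_const r (n : ℝ)).div (hasDerivAt_id r)
    hr.ne'))).congr_deriv ?_
  simp only [h2, id, Pi.add_apply, Pi.div_apply]
  field_simp
  ring

theorem hasJetAt_volumeDensity (hψ : ContDiff ℝ ∞ ψ) {r : ℝ} (hr : 0 < r) :
    HasJetAt (volumeDensity ψ) (volumeDensity ψ r) (areaDensity ψ r)
      (areaDensity ψ r * (deriv (radialProfile ψ) r + n / r)) r :=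
  ⟨rfl, areaDensity ψ, Eventually.of_forall (hasDerivAt_volumeDensity hψ), rfl,
    (hasJetAt_areaDensity hψ hr).hasDerivAt⟩

theorem eq_radialProfile {δ : ℝ → ℝ} (hδ : ∀ x, ψ x = δ ‖x‖)
    {θ : EuclideanSpace ℝ (Fin (n + 1))} (hθ : ‖θ‖ = 1) (s : ℝ) :
    ψ (s • θ) = radialProfile ψ s := by
  simp [radialProfile, hδ, norm_smul, hθ]

theorem continuousOn_sphere_integrable {X : Type} [NormedAddCommGroup X] [InnerProductSpace ℝ X]
    [FiniteDimensional ℝ X] [MeasurableSpace X] [BorelSpace X] {f : X → ℝ}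
    (hf : ContinuousOn f {0}ᶜ) : IntegrableOn f (Metric.sphere 0 1) (sphereMeasure X) :=
  (hf.mono fun x hx h0 => by simp [mem_singleton_iff.1 h0] at hx).integrableOn_compact
    (isCompact_sphere 0 1)

/-- The weighted volume of a star-shaped set, in polar coordinates. -/
theorem weightedVolume_starShaped (hψ : ContDiff ℝ ∞ ψ) {δ : ℝ → ℝ} (hδ : ∀ x, ψ x = δ ‖x‖)
    {ρ : EuclideanSpace ℝ (Fin (n + 1)) → ℝ} (hρc : ContinuousOn ρ {0}ᶜ) (hρ : ∀ x, 0 < ρ x)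
    (hhom : ∀ c : ℝ, 0 < c → ∀ x, ρ (c • x) = ρ x) :
    weightedVolume ψ {x | x = 0 ∨ ‖x‖ < ρ x} =
      ENNReal.ofReal (∫ θ in Metric.sphere 0 1, volumeDensity ψ (ρ θ)
        ∂(sphereMeasure (EuclideanSpace ℝ (Fin (n + 1))))) := by
  have hρm : Measurable ρ := measurable_of_continuousOn_compl_singleton 0 hρc
  have hset : {x | x = 0 ∨ ‖x‖ < ρ x} = {x | ‖x‖ < ρ x} := by
    ext x
    simp only [Set.mem_ofPred_eq]
    refine ⟨fun h => h.elim (fun h0 => ?_) id, Or.inr⟩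
    rw [h0, norm_zero]
    exact hρ 0
  have hA : MeasurableSet {x | ‖x‖ < ρ x} := measurableSet_lt measurable_norm hρm
  have hGc := (contDiff_areaDensity hψ).continuous
  have hgm : Measurable fun x => ENNReal.ofReal (Real.exp (ψ x)) := by
    have := hψ.continuous
    fun_prop
  rw [weightedVolume, hset, ← lintegral_indicator hA,
    lintegral_eq_lintegral_sphereMeasure (hgm.indicator hA), sphereMeasure_restrict,
    ofReal_integral_eq_lintegral_ofReal]
  · refine lintegral_congr_ae ?_
    filter_upwards [ae_sphereMeasure_norm_eq_one] with θ hθ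
    have h1 : ∀ s ∈ Ioi (0 : ℝ),
        ENNReal.ofReal (s ^ (Module.finrank ℝ (EuclideanSpace ℝ (Fin (n + 1))) - 1)) *
          {x | ‖x‖ < ρ x}.indicator (fun x => ENNReal.ofReal (Real.exp (ψ x))) (s • θ) =
        (Iio (ρ θ)).indicator (fun s => ENNReal.ofReal (areaDensity ψ s)) s := by
      intro s hs
      have hs0 : 0 < s := hs
      have hmem : s • θ ∈ {x | ‖x‖ < ρ x} ↔ s ∈ Iio (ρ θ) := by
        simp only [Set.mem_ofPred_eq, mem_Iio, hhom s hs0, norm_smul, hθ, mul_one, Real.norm_eq_abs,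
          abs_of_pos hs0]
      by_cases h : s ∈ Iio (ρ θ)
      · rw [indicator_of_mem h, indicator_of_mem (hmem.2 h), eq_radialProfile hδ hθ,
          ← ENNReal.ofReal_mul (by positivity), areaDensity, mul_comm]
        simp
      · rw [indicator_of_notMem h, indicator_of_notMem (mt hmem.1 h), mul_zero]
    rw [setLIntegral_congr_fun measurableSet_Ioi h1, lintegral_indicator measurableSet_Iio,
      Measure.restrict_restrict measurableSet_Iio, volumeDensity,
      intervalIntegral.integral_of_le (hρ θ).le, integral_Ioc_eq_integral_Ioo, inter_comm,
      Ioi_inter_Iio, ofReal_integral_eq_lintegral_ofReal]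
    · exact (hGc.integrableOn_Icc (a := 0) (b := ρ θ)).mono_set Ioo_subset_Icc_self
    · refine (ae_restrict_iff' measurableSet_Ioo).2 (Eventually.of_forall fun s hs => ?_)
      exact (areaDensity_pos hs.1).le
  · have h := continuousOn_sphere_integrable
      ((contDiff_volumeDensity hψ).continuous.comp_continuousOn hρc)
    rwa [IntegrableOn, sphereMeasure_restrict] at h
  · exact Eventually.of_forall fun θ => volumeDensity_nonneg (hρ θ).le

/-- The weighted perimeter of a radial graph. -/
theorem weightedPerimeter_radialGraph (hψ : ContDiff ℝ ∞ ψ) {δ : ℝ → ℝ} (hδ : ∀ x, ψ x = δ ‖x‖)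
    {ρ : EuclideanSpace ℝ (Fin (n + 1)) → ℝ} (hρc : ContDiffOn ℝ 1 ρ {0}ᶜ) (hρ : ∀ x, 0 < ρ x)
    (hhom : ∀ c : ℝ, 0 < c → ∀ x, ρ (c • x) = ρ x)
    {Ω : Set (EuclideanSpace ℝ (Fin (n + 1)))}
    (hΩ : frontier Ω = (fun x => ρ x • x) '' Metric.sphere 0 1) {c : ℝ≥0∞}
    (hc : (μHE[n] : Measure (EuclideanSpace ℝ (Fin (n + 1)))).restrict (Metric.sphere 0 1) =
      c • sphereMeasure (EuclideanSpace ℝ (Fin (n + 1)))) :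
    weightedPerimeter ψ Ω = c * ENNReal.ofReal (∫ θ in Metric.sphere 0 1,
      areaDensity ψ (ρ θ) * √(1 + ‖fderiv ℝ ρ θ‖ ^ 2 / ρ θ ^ 2)
        ∂(sphereMeasure (EuclideanSpace ℝ (Fin (n + 1))))) := by
  have : Fact (Module.finrank ℝ (EuclideanSpace ℝ (Fin (n + 1))) = n + 1) := ⟨by simp⟩
  have hopen : IsOpen ({0}ᶜ : Set (EuclideanSpace ℝ (Fin (n + 1)))) := isOpen_compl_singleton
  have hne : ∀ θ : EuclideanSpace ℝ (Fin (n + 1)), ‖θ‖ = 1 → θ ∈ ({0}ᶜ : Set _) := by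
    rintro θ hθ rfl
    simp at hθ
  have hgm : Measurable fun x => ENNReal.ofReal (Real.exp (ψ x)) := by
    have := hψ.continuous
    fun_prop
  have hat : ∀ θ, ‖θ‖ = 1 → ContDiffAt ℝ 1 ρ θ := fun θ hθ =>
    hρc.contDiffAt (hopen.mem_nhds (hne θ hθ))
  rw [weightedPerimeter, hΩ, setLIntegral_radialGraph (n := n)
    (measurable_of_continuousOn_compl_singleton 0 hρc.continuousOn) (fun θ _ => hρ θ) hat
    (fun θ hθ => fderiv_apply_self_eq_zero hhom ((hat θ hθ).differentiableAt one_ne_zero)) hgm, hc,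
    lintegral_smul_measure, smul_eq_mul, sphereMeasure_restrict,
    ofReal_integral_eq_lintegral_ofReal]
  · congr 1
    refine lintegral_congr_ae ?_
    filter_upwards [ae_sphereMeasure_norm_eq_one] with θ hθ
    have := hρ θ
    rw [eq_radialProfile hδ hθ, ← ENNReal.ofReal_mul (by positivity), areaDensity]
    ring_nf
  · have hcont : ContinuousOn (fun θ => areaDensity ψ (ρ θ) *
        √(1 + ‖fderiv ℝ ρ θ‖ ^ 2 / ρ θ ^ 2)) {0}ᶜ := by
      refine ((contDiff_areaDensity hψ).continuous.comp_continuousOn hρc.continuousOn).mul ?_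
      refine Real.continuous_sqrt.comp_continuousOn (continuousOn_const.add ?_)
      exact ((hρc.continuousOn_fderiv_of_isOpen hopen le_rfl).norm.pow 2).div
        (hρc.continuousOn.pow 2) fun x _ => (pow_pos (hρ x) 2).ne'
    have h := continuousOn_sphere_integrable hcont
    rwa [IntegrableOn, sphereMeasure_restrict] at h
  · exact Eventually.of_forall fun θ => mul_nonneg (areaDensity_pos (hρ θ)).le (Real.sqrt_nonneg _)

end RadialDensity

/-! ### First and second variation of volume and perimeter. -/

section SecondVariation

variable {n : ℕ} {ψ : EuclideanSpace ℝ (Fin (n + 1)) → ℝ} {δ : ℝ → ℝ} {r τ : ℝ}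
  {φ : ℝ → EuclideanSpace ℝ (Fin (n + 1)) → EuclideanSpace ℝ (Fin (n + 1))}
  {R : ℝ × EuclideanSpace ℝ (Fin (n + 1)) → ℝ}

/-- `R` is the radial function of the images of the ball of radius `r` under the variation `φ`. -/
structure IsRadialFunction (r τ : ℝ)
    (φ : ℝ → EuclideanSpace ℝ (Fin (n + 1)) → EuclideanSpace ℝ (Fin (n + 1)))
    (R : ℝ × EuclideanSpace ℝ (Fin (n + 1)) → ℝ) : Prop where
  radius_pos : 0 < r
  time_pos : 0 < τ
  smooth : ContDiffOn ℝ ∞ R (Ioo (-τ) τ ×ˢ {0}ᶜ)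
  pos : ∀ t ∈ Ioo (-τ) τ, ∀ x, 0 < R (t, x)
  zero : ∀ x, R (0, x) = r
  smul : ∀ t, ∀ c : ℝ, 0 < c → ∀ x, R (t, c • x) = R (t, x)
  image_ball : ∀ t ∈ Ioo (-τ) τ, φ t '' Metric.ball 0 r = {x | x = 0 ∨ ‖x‖ < R (t, x)}
  frontier_image : ∀ t ∈ Ioo (-τ) τ,
    frontier (φ t '' Metric.ball 0 r) = (fun x => R (t, x) • x) '' Metric.sphere 0 1

theorem IsVariation.exists_isRadialFunction {ε : ℝ} (hφ : IsVariation ε φ) (hr : 0 < r) :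
    ∃ τ R, IsRadialFunction r τ φ R := by
  obtain ⟨τ, hτ, R, h1, h2, h3, h4, h5⟩ := hφ.exists_radial hr
  exact ⟨τ, R, hr, hτ, h1, h2, h3, h4, fun t ht => (h5 t ht).1, fun t ht => (h5 t ht).2⟩

namespace IsRadialFunction

/-- The initial radial velocity. -/
noncomputable def velocity (R : ℝ × EuclideanSpace ℝ (Fin (n + 1)) → ℝ)
    (x : EuclideanSpace ℝ (Fin (n + 1))) : ℝ :=
  fderiv ℝ R (0, x) (1, 0)

/-- The initial radial acceleration. -/
noncomputable def acceleration (R : ℝ × EuclideanSpace ℝ (Fin (n + 1)) → ℝ)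
    (x : EuclideanSpace ℝ (Fin (n + 1))) : ℝ :=
  fderiv ℝ (fun p => fderiv ℝ R p (1, 0)) (0, x) (1, 0)

theorem zero_mem (h : IsRadialFunction r τ φ R) : (0 : ℝ) ∈ Ioo (-τ) τ :=
  ⟨neg_lt_zero.2 h.time_pos, h.time_pos⟩

theorem isOpen_domain : IsOpen (Ioo (-τ) τ ×ˢ ({0}ᶜ : Set (EuclideanSpace ℝ (Fin (n + 1))))) :=
  isOpen_Ioo.prod isOpen_compl_singleton

theorem sphere_subset : Metric.sphere (0 : EuclideanSpace ℝ (Fin (n + 1))) 1 ⊆ {0}ᶜ :=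
  fun x hx h0 => by simp [mem_singleton_iff.1 h0] at hx

theorem contDiffOn_fderiv (h : IsRadialFunction r τ φ R) :
    ContDiffOn ℝ ∞ (fderiv ℝ R) (Ioo (-τ) τ ×ˢ {0}ᶜ) :=
  h.smooth.fderiv_of_isOpen isOpen_domain (by simp)

theorem contDiffOn_slice {F : Type} [NormedAddCommGroup F]
    [NormedSpace ℝ F] {Q : ℝ × EuclideanSpace ℝ (Fin (n + 1)) → F}
    (hQ : ContDiffOn ℝ ∞ Q (Ioo (-τ) τ ×ˢ {0}ᶜ)) {t : ℝ} (ht : t ∈ Ioo (-τ) τ) :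
    ContDiffOn ℝ ∞ (fun x => Q (t, x)) {0}ᶜ :=
  hQ.comp (f := fun x => (t, x)) (by fun_prop) fun x hx => ⟨ht, hx⟩

theorem contDiffOn_velocity (h : IsRadialFunction r τ φ R) :
    ContDiffOn ℝ ∞ (velocity R) {0}ᶜ :=
  contDiffOn_slice (h.contDiffOn_fderiv.clm_apply contDiffOn_const) h.zero_mem

theorem contDiffOn_acceleration (h : IsRadialFunction r τ φ R) :
    ContDiffOn ℝ ∞ (acceleration R) {0}ᶜ :=
  contDiffOn_slice (((h.contDiffOn_fderiv.clm_apply contDiffOn_const).fderiv_of_isOpen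
    isOpen_domain (by simp)).clm_apply contDiffOn_const) h.zero_mem

theorem hasJetAt (h : IsRadialFunction r τ φ R) {x : EuclideanSpace ℝ (Fin (n + 1))} (hx : x ≠ 0) :
    HasJetAt (fun t => R (t, x)) r (velocity R x) (acceleration R x) 0 := by
  rw [← h.zero x]
  exact hasJetAt_slice isOpen_Ioo isOpen_compl_singleton h.smooth h.zero_mem hx

theorem velocity_smul (h : IsRadialFunction r τ φ R) {c : ℝ} (hc : 0 < c)
    (x : EuclideanSpace ℝ (Fin (n + 1))) : velocity R (c • x) = velocity R x := by
  rcases eq_or_ne x 0 with rfl | hx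
  · simp
  · have h1 := (h.hasJetAt (smul_ne_zero hc.ne' hx)).hasDerivAt
    simp only [h.smul _ c hc] at h1
    exact h1.unique (h.hasJetAt hx).hasDerivAt

theorem fderiv_slice (h : IsRadialFunction r τ φ R) {t : ℝ} (ht : t ∈ Ioo (-τ) τ)
    {x : EuclideanSpace ℝ (Fin (n + 1))} (hx : x ≠ 0) :
    fderiv ℝ (fun x => R (t, x)) x =
      (fderiv ℝ R (t, x)).comp (ContinuousLinearMap.inr ℝ ℝ (EuclideanSpace ℝ (Fin (n + 1)))) :=
  (HasFDerivAt.comp x ((h.smooth.contDiffAt (isOpen_domain.mem_nhds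
    (show (t, x) ∈ Ioo (-τ) τ ×ˢ ({0}ᶜ : Set _) from ⟨ht, hx⟩))).differentiableAt
    (by simp)).hasFDerivAt (hasFDerivAt_prodMk_right t x)).fderiv

/-- The time derivative of a spatial derivative of `R` is the derivative of the velocity. -/
theorem hasJetAt_fderiv (h : IsRadialFunction r τ φ R) {x : EuclideanSpace ℝ (Fin (n + 1))}
    (hx : x ≠ 0) (v : EuclideanSpace ℝ (Fin (n + 1))) :
    ∃ a, HasJetAt (fun t => fderiv ℝ R (t, x) (0, v)) 0 (fderiv ℝ (velocity R) x v) a 0 := by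
  have hQ : ContDiffOn ℝ ∞ (fun p => fderiv ℝ R p (0, v)) (Ioo (-τ) τ ×ˢ {0}ᶜ) :=
    h.contDiffOn_fderiv.clm_apply contDiffOn_const
  have hj := hasJetAt_slice isOpen_Ioo isOpen_compl_singleton hQ h.zero_mem hx
  have hmem := isOpen_domain.mem_nhds
    (show ((0 : ℝ), x) ∈ Ioo (-τ) τ ×ˢ ({0}ᶜ : Set (EuclideanSpace ℝ (Fin (n + 1)))) from
      ⟨h.zero_mem, hx⟩)
  -- At time zero `R` is constant in space. The first time derivative is then identified by
  -- exchanging the two mixed derivatives.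
  have h0 : fderiv ℝ R (0, x) (0, v) = 0 := by
    have h1 := congrArg (fun A : EuclideanSpace ℝ (Fin (n + 1)) →L[ℝ] ℝ => A v)
      (h.fderiv_slice h.zero_mem hx)
    simp only [h.zero] at h1
    simpa using h1.symm
  have hd := ((h.contDiffOn_fderiv.contDiffAt hmem).differentiableAt (by simp)).hasFDerivAt
  have hsymm : IsSymmSndFDerivAt ℝ R (0, x) :=
    ((contDiffOn_infty.1 h.smooth 2).contDiffAt hmem).isSymmSndFDerivAt (by simp)
  have e1 : fderiv ℝ (fun p => fderiv ℝ R p (0, v)) (0, x) (1, 0) =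
      fderiv ℝ (fderiv ℝ R) (0, x) (1, 0) (0, v) := by
    have := (hd.clm_apply (hasFDerivAt_const ((0 : ℝ), v) ((0 : ℝ), x))).fderiv
    rw [this]
    simp
  have e2 : fderiv ℝ (velocity R) x v = fderiv ℝ (fderiv ℝ R) (0, x) (0, v) (1, 0) := by
    have hc : HasFDerivAt (fun x => fderiv ℝ R (0, x)) _ x :=
      HasFDerivAt.comp x hd (hasFDerivAt_prodMk_right (0 : ℝ) x)
    have := (hc.clm_apply (hasFDerivAt_const
      ((1 : ℝ), (0 : EuclideanSpace ℝ (Fin (n + 1)))) x)).fderiv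
    unfold velocity
    rw [this]
    simp
  rw [h0, e1, hsymm.eq, ← e2] at hj
  exact ⟨_, hj⟩

/-- The weighted area element of the evolving sphere, as a function on the unit sphere. -/
noncomputable def areaElement (ψ : EuclideanSpace ℝ (Fin (n + 1)) → ℝ)
    (R : ℝ × EuclideanSpace ℝ (Fin (n + 1)) → ℝ) (p : ℝ × EuclideanSpace ℝ (Fin (n + 1))) : ℝ :=
  areaDensity ψ (R p) * √(1 + (∑ i, fderiv ℝ R p (0, EuclideanSpace.basisFun (Fin (n + 1)) ℝ i) ^ 2)
    / R p ^ 2)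

theorem contDiffOn_areaElement (h : IsRadialFunction r τ φ R) (hψ : ContDiff ℝ ∞ ψ) :
    ContDiffOn ℝ ∞ (areaElement ψ R) (Ioo (-τ) τ ×ˢ {0}ᶜ) := by
  refine ((contDiff_areaDensity hψ).comp_contDiffOn h.smooth).mul (ContDiffOn.sqrt ?_ ?_)
  · refine contDiffOn_const.add (ContDiffOn.div ?_ (h.smooth.pow 2) ?_)
    · exact ContDiffOn.sum fun i _ => (h.contDiffOn_fderiv.clm_apply contDiffOn_const).pow 2
    · exact fun p hp => (pow_pos (h.pos p.1 hp.1 p.2) 2).ne'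
  · intro p hp
    have := Finset.sum_nonneg fun i (_ : i ∈ Finset.univ) =>
      sq_nonneg (fderiv ℝ R p (0, EuclideanSpace.basisFun (Fin (n + 1)) ℝ i))
    positivity

theorem weightedVolume_eq (h : IsRadialFunction r τ φ R) (hψ : ContDiff ℝ ∞ ψ)
    (hδ : ∀ x, ψ x = δ ‖x‖) {t : ℝ} (ht : t ∈ Ioo (-τ) τ) :
    weightedVolume ψ (φ t '' Metric.ball 0 r) =
      ENNReal.ofReal (∫ θ in Metric.sphere 0 1, volumeDensity ψ (R (t, θ))
        ∂(sphereMeasure (EuclideanSpace ℝ (Fin (n + 1))))) := by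
  rw [h.image_ball t ht]
  exact weightedVolume_starShaped hψ hδ (contDiffOn_slice h.smooth ht).continuousOn
    (h.pos t ht) (h.smul t)

theorem weightedPerimeter_eq (h : IsRadialFunction r τ φ R) (hψ : ContDiff ℝ ∞ ψ)
    (hδ : ∀ x, ψ x = δ ‖x‖) {c : ℝ≥0∞}
    (hc : (μHE[n] : Measure (EuclideanSpace ℝ (Fin (n + 1)))).restrict (Metric.sphere 0 1) =
      c • sphereMeasure (EuclideanSpace ℝ (Fin (n + 1)))) {t : ℝ} (ht : t ∈ Ioo (-τ) τ) :
    weightedPerimeter ψ (φ t '' Metric.ball 0 r) =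
      c * ENNReal.ofReal (∫ θ in Metric.sphere 0 1, areaElement ψ R (t, θ)
        ∂(sphereMeasure (EuclideanSpace ℝ (Fin (n + 1))))) := by
  rw [weightedPerimeter_radialGraph hψ hδ ((contDiffOn_slice h.smooth ht).of_le (by simp))
    (h.pos t ht) (h.smul t) (h.frontier_image t ht) hc]
  congr 2
  refine setIntegral_congr_fun Metric.isClosed_sphere.measurableSet fun θ hθ => ?_
  simp only [areaElement]
  rw [norm_sq_eq_sum_sq_basisFun, h.fderiv_slice ht (sphere_subset hθ)]
  simp only [ContinuousLinearMap.comp_apply, ContinuousLinearMap.inr_apply]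

theorem perimeterFunction_eq (h : IsRadialFunction r τ φ R) (hψ : ContDiff ℝ ∞ ψ)
    (hδ : ∀ x, ψ x = δ ‖x‖) {c : ℝ≥0∞}
    (hc : (μHE[n] : Measure (EuclideanSpace ℝ (Fin (n + 1)))).restrict (Metric.sphere 0 1) =
      c • sphereMeasure (EuclideanSpace ℝ (Fin (n + 1)))) {t : ℝ} (ht : t ∈ Ioo (-τ) τ) :
    perimeterFunction ψ (Metric.ball 0 r) φ t =
      c.toReal * ∫ θ in Metric.sphere 0 1, areaElement ψ R (t, θ)
        ∂(sphereMeasure (EuclideanSpace ℝ (Fin (n + 1)))) := by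
  rw [perimeterFunction, h.weightedPerimeter_eq hψ hδ hc ht, ENNReal.toReal_mul,
    ENNReal.toReal_ofReal]
  exact setIntegral_nonneg Metric.isClosed_sphere.measurableSet fun θ _ =>
    mul_nonneg (areaDensity_pos (h.pos t ht θ)).le (Real.sqrt_nonneg _)

/-- The slope factor has jet `(1, 0, |∇u|² / r²)` at the round sphere, so the product has no cross
terms and `|∇u|²` enters only at second order. -/
theorem hasJetAt_areaElement (h : IsRadialFunction r τ φ R) (hψ : ContDiff ℝ ∞ ψ)
    {x : EuclideanSpace ℝ (Fin (n + 1))} (hx : x ≠ 0) :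
    HasJetAt (fun t => areaElement ψ R (t, x)) (areaDensity ψ r)
      (areaDensity ψ r * (deriv (radialProfile ψ) r + n / r) * velocity R x)
      (areaDensity ψ r * ((deriv (radialProfile ψ) r + n / r) ^ 2 +
          iteratedDeriv 2 (radialProfile ψ) r - n / r ^ 2) * velocity R x ^ 2 +
        areaDensity ψ r * (deriv (radialProfile ψ) r + n / r) * acceleration R x +
        areaDensity ψ r * (‖fderiv ℝ (velocity R) x‖ ^ 2 / r ^ 2)) 0 := by
  choose a ha using fun i => h.hasJetAt_fderiv hx (EuclideanSpace.basisFun (Fin (n + 1)) ℝ i)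
  have h1 := ((hasJetAt_areaDensity hψ h.radius_pos).comp (h.hasJetAt hx)).mul
    (HasJetAt.sqrt_one_add_sum_div h.radius_pos.ne' (h.hasJetAt hx) ha)
  simp only [mul_one, mul_zero, add_zero, ← norm_sq_eq_sum_sq_basisFun] at h1
  exact h1

/-- The first and second variation of the volume. -/
theorem integral_velocity_acceleration (h : IsRadialFunction r τ φ R) (hψ : ContDiff ℝ ∞ ψ)
    (hδ : ∀ x, ψ x = δ ‖x‖) (hvol : PreservesVolume ψ (Metric.ball 0 r) φ) :
    (∫ θ in Metric.sphere 0 1, velocity R θ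
      ∂(sphereMeasure (EuclideanSpace ℝ (Fin (n + 1))))) = 0 ∧
    (∫ θ in Metric.sphere 0 1, acceleration R θ
      ∂(sphereMeasure (EuclideanSpace ℝ (Fin (n + 1))))) =
      - (deriv (radialProfile ψ) r + n / r) * ∫ θ in Metric.sphere 0 1, velocity R θ ^ 2
      ∂(sphereMeasure (EuclideanSpace ℝ (Fin (n + 1)))) := by
  set σ := sphereMeasure (EuclideanSpace ℝ (Fin (n + 1)))
  have hA := areaDensity_pos (ψ := ψ) h.radius_pos
  have hj := hasJetAt_setIntegral (μ := σ) isOpen_Ioo isOpen_compl_singleton (isCompact_sphere 0 1)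
    sphere_subset ((contDiff_volumeDensity hψ).comp_contDiffOn h.smooth) h.zero_mem
    fun x hx => (hasJetAt_volumeDensity hψ h.radius_pos).comp (h.hasJetAt (sphere_subset hx))
  -- Volume preservation makes the polar integral locally constant; uniqueness of jets turns this
  -- into equations for the velocity and the acceleration.
  have hconst : (fun t => ∫ x in Metric.sphere 0 1, (volumeDensity ψ ∘ R) (t, x) ∂σ) =ᶠ[𝓝 0]
      fun _ => (weightedVolume ψ (Metric.ball 0 r)).toReal := by
    filter_upwards [hvol, isOpen_Ioo.mem_nhds h.zero_mem] with t ht htm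
    rw [← ht, h.weightedVolume_eq hψ hδ htm, ENNReal.toReal_ofReal]
    · rfl
    · exact setIntegral_nonneg Metric.isClosed_sphere.measurableSet fun θ _ =>
        volumeDensity_nonneg (h.pos t htm θ).le
  obtain ⟨-, h1, h2⟩ := hj.unique ((HasJetAt.const _ 0).congr hconst)
  rw [integral_const_mul] at h1
  have i1 : IntegrableOn (fun x => velocity R x ^ 2) (Metric.sphere 0 1) σ :=
    continuousOn_sphere_integrable (h.contDiffOn_velocity.continuousOn.pow 2)
  have i2 : IntegrableOn (acceleration R) (Metric.sphere 0 1) σ :=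
    continuousOn_sphere_integrable h.contDiffOn_acceleration.continuousOn
  rw [integral_add (i1.const_mul _) (i2.const_mul _), integral_const_mul, integral_const_mul,
    mul_assoc, ← mul_add] at h2
  refine ⟨(mul_eq_zero.1 h1).resolve_left hA.ne', ?_⟩
  have := (mul_eq_zero.1 h2).resolve_left hA.ne'
  linarith

/-- **Second variation formula** for balls centred at the origin. -/
theorem second_variation (h : IsRadialFunction r τ φ R) (hψ : ContDiff ℝ ∞ ψ)
    (hδ : ∀ x, ψ x = δ ‖x‖) (hvol : PreservesVolume ψ (Metric.ball 0 r) φ) {c : ℝ≥0∞}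
    (hc : (μHE[n] : Measure (EuclideanSpace ℝ (Fin (n + 1)))).restrict (Metric.sphere 0 1) =
      c • sphereMeasure (EuclideanSpace ℝ (Fin (n + 1)))) :
    ∃ a, HasJetAt (perimeterFunction ψ (Metric.ball 0 r) φ) a 0
      (c.toReal * areaDensity ψ r * ((iteratedDeriv 2 (radialProfile ψ) r - n / r ^ 2) *
        (∫ θ, velocity R θ ^ 2 ∂(sphereMeasure (EuclideanSpace ℝ (Fin (n + 1))))) +
        (∫ θ, ‖fderiv ℝ (velocity R) θ‖ ^ 2
          ∂(sphereMeasure (EuclideanSpace ℝ (Fin (n + 1))))) / r ^ 2)) 0 := by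
  obtain ⟨hu, hw⟩ := h.integral_velocity_acceleration hψ hδ hvol
  set σ := sphereMeasure (EuclideanSpace ℝ (Fin (n + 1)))
  have hj := (HasJetAt.const c.toReal 0).mul
    (hasJetAt_setIntegral (μ := σ) isOpen_Ioo isOpen_compl_singleton (isCompact_sphere 0 1)
      sphere_subset (h.contDiffOn_areaElement hψ) h.zero_mem
      fun x hx => h.hasJetAt_areaElement hψ (sphere_subset hx))
  have hP := hj.congr (g := perimeterFunction ψ (Metric.ball 0 r) φ) (by
    filter_upwards [isOpen_Ioo.mem_nhds h.zero_mem] with t ht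
    exact h.perimeterFunction_eq hψ hδ hc ht)
  have i1 : IntegrableOn (fun x => velocity R x ^ 2) (Metric.sphere 0 1) σ :=
    continuousOn_sphere_integrable (h.contDiffOn_velocity.continuousOn.pow 2)
  have i2 : IntegrableOn (acceleration R) (Metric.sphere 0 1) σ :=
    continuousOn_sphere_integrable h.contDiffOn_acceleration.continuousOn
  have i3 : IntegrableOn (fun x => ‖fderiv ℝ (velocity R) x‖ ^ 2 / r ^ 2) (Metric.sphere 0 1) σ :=
    continuousOn_sphere_integrable
    (((h.contDiffOn_velocity.continuousOn_fderiv_of_isOpen isOpen_compl_singleton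
      (by simp)).norm.pow 2).div_const (r ^ 2))
  -- Substituting the two volume identities kills the first derivative. The acceleration term
  -- becomes minus the square of the mean curvature times the integral of the squared velocity,
  -- cancelling the same term of `areaDensity''`.
  rw [integral_add ((i1.const_mul _).fun_add (i2.const_mul _)) (i3.const_mul _),
    integral_add (i1.const_mul _) (i2.const_mul _), integral_const_mul, integral_const_mul,
    integral_const_mul, integral_const_mul, integral_div, hu, hw] at hP
  simp only [σ, sphereMeasure_restrict] at hP
  refine ⟨perimeterFunction ψ (Metric.ball 0 r) φ 0, ?_⟩
  rw [hP.1]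
  convert hP using 1
  · ring
  · ring

theorem contDiffAt_perimeterFunction (h : IsRadialFunction r τ φ R) (hψ : ContDiff ℝ ∞ ψ)
    (hδ : ∀ x, ψ x = δ ‖x‖) {c : ℝ≥0∞}
    (hc : (μHE[n] : Measure (EuclideanSpace ℝ (Fin (n + 1)))).restrict (Metric.sphere 0 1) =
      c • sphereMeasure (EuclideanSpace ℝ (Fin (n + 1)))) :
    ContDiffAt ℝ ∞ (perimeterFunction ψ (Metric.ball 0 r) φ) 0 := by
  have hmem := isOpen_Ioo.mem_nhds h.zero_mem
  have h1 := ((contDiffOn_setIntegral (μ := sphereMeasure (EuclideanSpace ℝ (Fin (n + 1))))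
    isOpen_Ioo isOpen_compl_singleton (isCompact_sphere 0 1)
    sphere_subset (h.contDiffOn_areaElement hψ)).contDiffAt hmem)
  refine (contDiffAt_const (c := c.toReal)).mul h1 |>.congr_of_eventuallyEq ?_
  filter_upwards [hmem] with t ht
  exact h.perimeterFunction_eq hψ hδ hc ht

end IsRadialFunction

end SecondVariation

/-! ### Stability from the Poincaré inequality, and an implicit function theorem. -/

section Stability

variable {n : ℕ} {ψ : EuclideanSpace ℝ (Fin (n + 1)) → ℝ} {δ : ℝ → ℝ} {r : ℝ}

theorem exists_restrict_euclideanHausdorffMeasure_sphere (n : ℕ) : ∃ c : ℝ≥0∞, c ≠ 0 ∧ c ≠ ⊤ ∧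
    (μHE[n] : Measure (EuclideanSpace ℝ (Fin (n + 1)))).restrict (Metric.sphere 0 1) =
      c • sphereMeasure (EuclideanSpace ℝ (Fin (n + 1))) := by
  have : Fact (Module.finrank ℝ (EuclideanSpace ℝ (Fin (n + 1))) = n + 1) := ⟨by simp⟩
  exact exists_restrict_sphere_eq_smul

/-- Balls centred at the origin are stationary for radial densities. -/
theorem isStationaryRegion_ball (hψ : ContDiff ℝ ∞ ψ) (hδ : ∀ x, ψ x = δ ‖x‖) (hr : 0 < r) :
    IsStationaryRegion ψ (Metric.ball 0 r) := by
  intro ε φ hφ hvol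
  obtain ⟨c, -, hct, hc⟩ := exists_restrict_euclideanHausdorffMeasure_sphere n
  obtain ⟨τ, R, h⟩ := hφ.exists_isRadialFunction hr
  refine ⟨?_, ?_⟩
  · filter_upwards [isOpen_Ioo.mem_nhds h.zero_mem] with t ht
    rw [h.weightedPerimeter_eq hψ hδ hc ht]
    exact ENNReal.mul_ne_top hct ENNReal.ofReal_ne_top
  · obtain ⟨a, ha⟩ := h.second_variation hψ hδ hvol hc
    exact ha.hasDerivAt

/-- The velocity has mean zero and degree zero, so the spherical Poincaré inequality absorbs exactly
the term `-n / r ^ 2` of the second variation. -/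
theorem isStableRegion_ball (hψ : ContDiff ℝ ∞ ψ) (hδ : ∀ x, ψ x = δ ‖x‖) (hr : 0 < r)
    (h2 : 0 ≤ iteratedDeriv 2 (radialProfile ψ) r) : IsStableRegion ψ (Metric.ball 0 r) := by
  refine ⟨isStationaryRegion_ball hψ hδ hr, fun ε φ hφ hvol => ?_⟩
  obtain ⟨c, -, -, hc⟩ := exists_restrict_euclideanHausdorffMeasure_sphere n
  obtain ⟨τ, R, h⟩ := hφ.exists_isRadialFunction hr
  obtain ⟨a, ha⟩ := h.second_variation hψ hδ hvol hc
  refine ⟨contDiffAt_infty.1 (h.contDiffAt_perimeterFunction hψ hδ hc) 2, ?_⟩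
  rw [ha.iteratedDeriv_eq]
  have hmean := (h.integral_velocity_acceleration hψ hδ hvol).1
  rw [sphereMeasure_restrict] at hmean
  have hP := sphere_poincare (h.contDiffOn_velocity.of_le (by simp))
    (fun c hc x => h.velocity_smul hc x) hmean
  refine mul_nonneg (mul_nonneg ENNReal.toReal_nonneg (areaDensity_pos hr).le) ?_
  set I := ∫ θ, IsRadialFunction.velocity R θ ^ 2
    ∂(sphereMeasure (EuclideanSpace ℝ (Fin (n + 1))))
  have hI : 0 ≤ I := integral_nonneg fun θ => sq_nonneg _
  have hdiv := div_le_div_of_nonneg_right hP (sq_nonneg r)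
  have e : (iteratedDeriv 2 (radialProfile ψ) r - n / r ^ 2) * I =
      iteratedDeriv 2 (radialProfile ψ) r * I - n * I / r ^ 2 := by ring
  rw [e]
  have := mul_nonneg h2 hI
  linarith

/-- A scalar implicit function theorem with a uniformly smooth solution. -/
theorem exists_contDiffOn_implicit {W : ℝ × ℝ → ℝ} (hW : ContDiff ℝ ∞ W) {d : ℝ} (hd : 0 < d)
    (hder : HasDerivAt (fun l => W (0, l)) d 1) :
    ∃ ε > 0, ∃ l : ℝ → ℝ, ContDiffOn ℝ ∞ l (Ioo (-ε) ε) ∧ l 0 = 1 ∧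
      ∀ t ∈ Ioo (-ε) ε, W (t, l t) = W (0, 1) ∧ 0 < l t := by
  have hline : ∀ t l, HasDerivAt (fun l => W (t, l)) (fderiv ℝ W (t, l) (0, 1)) l := fun t l =>
    HasFDerivAt.comp_hasDerivAt l ((hW.differentiable (by simp)) (t, l)).hasFDerivAt
      ((hasDerivAt_const l t).prodMk (hasDerivAt_id l))
  have hc : Continuous fun p => fderiv ℝ W p (0, 1) :=
    (hW.continuous_fderiv (by simp)).clm_apply continuous_const
  have h0 : 0 < fderiv ℝ W (0, 1) (0, 1) := by
    rwa [(hline 0 1).unique hder]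
  obtain ⟨η', hη', hball⟩ := Metric.eventually_nhds_iff.1 (hc.continuousAt.eventually_const_lt h0)
  -- The cap at one keeps the second coordinate positive on `U`, which makes the dilation factor
  -- positive.
  set η := min η' 1
  have hη0 : 0 < η := lt_min hη' one_pos
  set U : Set (ℝ × ℝ) := Ioo (-η) η ×ˢ Ioo (1 - η) (1 + η) with hU
  have hUo : IsOpen U := isOpen_Ioo.prod isOpen_Ioo
  have hpos : ∀ p ∈ U, 0 < fderiv ℝ W p (0, 1) := by
    rintro ⟨t, l⟩ ⟨ht, hl⟩
    have := min_le_left η' 1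
    refine hball ?_
    rw [Prod.dist_eq, max_lt_iff, Real.dist_eq, Real.dist_eq, abs_lt, abs_lt]
    simp only [mem_Ioo] at ht hl
    exact ⟨⟨by linarith, by linarith⟩, by linarith, by linarith⟩
  set M : ℝ × ℝ → ℝ × ℝ := fun p => (p.1, W p) with hM
  have hMs : ContDiffOn ℝ ∞ M U := (contDiff_fst.prodMk hW).contDiffOn
  have hinj : InjOn M U := by
    rintro ⟨t, l⟩ hp ⟨t', l'⟩ hp' h
    simp only [hM, Prod.mk.injEq] at h
    obtain ⟨rfl, h⟩ := h
    have hmono : StrictMonoOn (fun l => W (t, l)) (Ioo (1 - η) (1 + η)) := by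
      refine strictMonoOn_of_deriv_pos (convex_Ioo _ _)
        (fun s _ => (hline t s).continuousAt.continuousWithinAt) fun s hs => ?_
      rw [(hline t s).deriv]
      exact hpos _ ⟨hp.1, interior_subset hs⟩
    exact congrArg (Prod.mk t) (hmono.injOn hp.2 hp'.2 h)
  have hinjd : ∀ p ∈ U, Function.Injective (fderiv ℝ M p) := by
    intro p hp
    have hF : HasFDerivAt M ((ContinuousLinearMap.fst ℝ ℝ ℝ).prod (fderiv ℝ W p)) p :=
      hasFDerivAt_fst.prodMk ((hW.differentiable (by simp)) p).hasFDerivAt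
    rw [hF.fderiv, injective_iff_map_eq_zero]
    rintro ⟨a, b⟩ h
    have ha : a = 0 := congrArg Prod.fst h
    subst ha
    have hb : fderiv ℝ W p (0, b) = 0 := congrArg Prod.snd h
    have e : ((0 : ℝ), b) = b • ((0 : ℝ), (1 : ℝ)) := by simp
    rw [e, map_smul, smul_eq_mul] at hb
    have : b = 0 := (mul_eq_zero.1 hb).resolve_right (hpos p hp).ne'
    simp [this]
  have hleft : ∀ p ∈ U, Function.invFunOn M U (M p) = p := fun p hp =>
    hinj.leftInvOn_invFunOn hp
  have hg := contDiffOn_leftInverse hUo hMs hinjd hleft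
  have hopen : IsOpen (M '' U) := isOpen_image_of_injective_fderiv hUo hMs hinjd
  have h1U : ((0 : ℝ), (1 : ℝ)) ∈ U := ⟨⟨by linarith, hη0⟩, by linarith, by linarith⟩
  have hev : ∀ᶠ t : ℝ in 𝓝 0, (t, W (0, 1)) ∈ M '' U := by
    have hcont : ContinuousAt (fun t : ℝ => (t, W (0, 1))) 0 := by fun_prop
    exact hcont.eventually_mem (hopen.mem_nhds ⟨_, h1U, rfl⟩)
  obtain ⟨ε, hε, hmem⟩ := Metric.eventually_nhds_iff.1 hev
  have hmem' : ∀ t ∈ Ioo (-ε) ε, (t, W (0, 1)) ∈ M '' U := fun t ht => hmem (by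
    rw [Real.dist_eq, sub_zero, abs_lt]
    exact ht)
  refine ⟨ε, hε, fun t => (Function.invFunOn M U (t, W (0, 1))).2, ?_, ?_, ?_⟩
  · exact contDiff_snd.comp_contDiffOn (hg.comp (by fun_prop) hmem')
  · have : ((0 : ℝ), W (0, 1)) = M (0, 1) := rfl
    simp only [this, hleft _ h1U]
  · intro t ht
    obtain ⟨⟨t', l⟩, hp, hpe⟩ := hmem' t ht
    simp only [hM, Prod.mk.injEq] at hpe
    obtain ⟨rfl, hpe⟩ := hpe
    have : (t', W (0, 1)) = M (t', l) := by simp [hM, hpe]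
    simp only [this, hleft _ hp]
    refine ⟨hpe, ?_⟩
    have := min_le_right η' 1
    linarith [hp.2.1]

end Stability

/-! ### Volume-corrected translations and the necessary condition. -/

section Translations

variable {n : ℕ} {ψ : EuclideanSpace ℝ (Fin (n + 1)) → ℝ} {δ : ℝ → ℝ} {r : ℝ}

theorem image_ball_affine {e : EuclideanSpace ℝ (Fin (n + 1))} {l t : ℝ} (hl : 0 < l) :
    (fun x => l • x + t • e) '' Metric.ball 0 r = Metric.ball (t • e) (l * r) := by
  ext y
  simp only [mem_image, mem_ball_iff_norm, sub_zero]
  constructor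
  · rintro ⟨x, hx, rfl⟩
    rw [add_sub_cancel_right, norm_smul, Real.norm_eq_abs, abs_of_pos hl]
    gcongr
  · intro hy
    refine ⟨l⁻¹ • (y - t • e), ?_, by simp [smul_inv_smul₀ hl.ne']⟩
    rw [norm_smul, norm_inv, Real.norm_eq_abs, abs_of_pos hl, inv_mul_lt_iff₀ hl]
    exact hy

/-- The weighted volume of the ball of centre `t • e` and radius `l * r`. -/
noncomputable def ballVolume (ψ : EuclideanSpace ℝ (Fin (n + 1)) → ℝ)
    (e : EuclideanSpace ℝ (Fin (n + 1))) (r : ℝ) (p : ℝ × ℝ) : ℝ :=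
  ∫ x in Metric.closedBall 0 r, p.2 ^ (n + 1) * Real.exp (ψ (p.2 • x + p.1 • e))

theorem contDiff_ballVolume (hψ : ContDiff ℝ ∞ ψ) (e : EuclideanSpace ℝ (Fin (n + 1))) (r : ℝ) :
    ContDiff ℝ ∞ (ballVolume ψ e r) := by
  rw [← contDiffOn_univ]
  refine contDiffOn_setIntegral (μ := volume) (W := univ)
    (G := fun q : (ℝ × ℝ) × EuclideanSpace ℝ (Fin (n + 1)) =>
      q.1.2 ^ (n + 1) * Real.exp (ψ (q.1.2 • q.2 + q.1.1 • e))) isOpen_univ isOpen_univ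
    (isCompact_closedBall 0 r) (subset_univ _) ?_
  refine ContDiff.contDiffOn ?_
  have h1 : ContDiff ℝ ∞ fun q : (ℝ × ℝ) × EuclideanSpace ℝ (Fin (n + 1)) =>
      q.1.2 • q.2 + q.1.1 • e := by fun_prop
  have h2 : ContDiff ℝ ∞ fun q : (ℝ × ℝ) × EuclideanSpace ℝ (Fin (n + 1)) => q.1.2 ^ (n + 1) := by
    fun_prop
  exact h2.mul (hψ.comp h1).exp

/-- Changing variables to a fixed ball exposes the smooth dependence on centre and radius. The
boundary sphere is null, so the closed ball may be used, giving a compact domain of integration. -/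
theorem weightedVolume_image_affine (hψ : ContDiff ℝ ∞ ψ) (e : EuclideanSpace ℝ (Fin (n + 1)))
    {l t : ℝ} (hl : 0 < l) :
    weightedVolume ψ ((fun x => l • x + t • e) '' Metric.ball 0 r) =
      ENNReal.ofReal (ballVolume ψ e r (t, l)) := by
  have hc := hψ.continuous
  have hd : ∀ x ∈ Metric.ball (0 : EuclideanSpace ℝ (Fin (n + 1))) r,
      HasFDerivWithinAt (fun x => l • x + t • e)
        (l • ContinuousLinearMap.id ℝ (EuclideanSpace ℝ (Fin (n + 1)))) (Metric.ball 0 r) x :=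
    fun x _ => (((hasFDerivAt_id x).const_smul l).add_const _).hasFDerivWithinAt
  have hinj : InjOn (fun x : EuclideanSpace ℝ (Fin (n + 1)) => l • x + t • e)
      (Metric.ball 0 r) := fun x _ y _ h => smul_right_injective _ hl.ne' (add_right_cancel h)
  have hdet : (l • ContinuousLinearMap.id ℝ (EuclideanSpace ℝ (Fin (n + 1)))).det =
      l ^ (n + 1) := by
    rw [ContinuousLinearMap.det]
    simp
  rw [weightedVolume, lintegral_image_eq_lintegral_abs_det_fderiv_mul volume
    measurableSet_ball hd hinj, hdet, ballVolume, abs_of_pos (pow_pos hl _),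
    ofReal_integral_eq_lintegral_ofReal]
  · have hae : Metric.ball (0 : EuclideanSpace ℝ (Fin (n + 1))) r =ᵐ[volume]
        Metric.closedBall 0 r := by
      rw [← Metric.ball_union_sphere]
      exact (union_ae_eq_left_of_ae_eq_empty
        (ae_eq_empty.2 (Measure.addHaar_sphere volume 0 r))).symm
    rw [← setLIntegral_congr hae]
    simp_rw [ENNReal.ofReal_mul (pow_pos hl (n + 1)).le]
  · have : Continuous fun x => l ^ (n + 1) * Real.exp (ψ (l • x + t • e)) := by fun_prop
    exact this.continuousOn.integrableOn_compact (isCompact_closedBall _ _)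
  · exact Eventually.of_forall fun x => by positivity

/-- For a centred ball, polar coordinates give the volume as `volumeDensity ψ (l * r)` times the
mass of the sphere. The derivative is positive, so the dilation factor can be solved for. -/
theorem hasDerivAt_ballVolume (hψ : ContDiff ℝ ∞ ψ) (hδ : ∀ x, ψ x = δ ‖x‖)
    (e : EuclideanSpace ℝ (Fin (n + 1))) (hr : 0 < r) :
    HasDerivAt (fun l => ballVolume ψ e r (0, l))
      (areaDensity ψ r * r * (sphereMeasure (EuclideanSpace ℝ (Fin (n + 1)))).real univ) 1 := by
  have h1 : HasDerivAt (fun l : ℝ => volumeDensity ψ (l * r) *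
      (sphereMeasure (EuclideanSpace ℝ (Fin (n + 1)))).real univ) (areaDensity ψ r * r *
        (sphereMeasure (EuclideanSpace ℝ (Fin (n + 1)))).real univ) 1 := by
    have h2 : HasDerivAt (fun l : ℝ => l * r) r 1 := by
      simpa using (hasDerivAt_id (1 : ℝ)).mul_const r
    have h3 := (hasDerivAt_volumeDensity hψ (1 * r)).comp (1 : ℝ) h2
    rw [one_mul] at h3
    exact h3.mul_const _
  refine h1.congr_of_eventuallyEq ?_
  filter_upwards [lt_mem_nhds (zero_lt_one' ℝ)] with l hl
  have hlr : 0 < l * r := mul_pos hl hr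
  have hv := weightedVolume_image_affine (r := r) (t := 0) hψ e hl
  have hset : Metric.ball (0 : EuclideanSpace ℝ (Fin (n + 1))) (l * r) =
      {x | x = 0 ∨ ‖x‖ < l * r} := by
    ext x
    simp only [mem_ball_zero_iff, Set.mem_ofPred_eq]
    refine ⟨Or.inr, fun h => h.elim (fun h0 => ?_) id⟩
    rwa [h0, norm_zero]
  rw [image_ball_affine hl, zero_smul, hset, weightedVolume_starShaped hψ hδ
    (ρ := fun _ => l * r) continuousOn_const (fun _ => hlr) (fun _ _ _ => rfl),
    sphereMeasure_restrict, integral_const, ENNReal.ofReal_eq_ofReal_iff] at hv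
  · rw [← hv, smul_eq_mul, mul_comm]
  · exact smul_nonneg measureReal_nonneg (volumeDensity_nonneg hlr.le)
  · exact integral_nonneg fun x => by positivity

/-- A volume-preserving variation moving the ball of radius `r` in the direction `e`. -/
theorem exists_translation_variation (hψ : ContDiff ℝ ∞ ψ) (hδ : ∀ x, ψ x = δ ‖x‖)
    (e : EuclideanSpace ℝ (Fin (n + 1))) (hr : 0 < r) :
    ∃ ε > 0, ∃ l : ℝ → ℝ, ContDiffOn ℝ ∞ l (Ioo (-ε) ε) ∧ l 0 = 1 ∧
      (∀ t ∈ Ioo (-ε) ε, 0 < l t) ∧ IsVariation ε (fun t x => l t • x + t • e) ∧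
      PreservesVolume ψ (Metric.ball 0 r) (fun t x => l t • x + t • e) := by
  have : NeZero (sphereMeasure (EuclideanSpace ℝ (Fin (n + 1)))) := ⟨sphereMeasure_ne_zero⟩
  obtain ⟨ε, hε, l, hl, hl0, hlt⟩ := exists_contDiffOn_implicit (contDiff_ballVolume hψ e r)
    (mul_pos (mul_pos (areaDensity_pos hr) hr) measureReal_univ_pos)
    (hasDerivAt_ballVolume hψ hδ e hr)
  refine ⟨ε, hε, l, hl, hl0, fun t ht => (hlt t ht).2, ⟨hε, ?_, fun x => by simp [hl0], ?_⟩, ?_⟩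
  · have h1 : ContDiffOn ℝ ∞ (fun p : ℝ × EuclideanSpace ℝ (Fin (n + 1)) => l p.1)
        (Ioo (-ε) ε ×ˢ univ) := hl.comp contDiff_fst.contDiffOn fun p hp => hp.1
    exact (h1.smul contDiff_snd.contDiffOn).add (by fun_prop)
  · intro t ht
    have hne := (hlt t ht).2.ne'
    refine ⟨fun y => (l t)⁻¹ • (y - t • e), by fun_prop, fun x => ?_, fun y => ?_⟩
    · simp [inv_smul_smul₀ hne]
    · simp [smul_inv_smul₀ hne]
  · have h0 : weightedVolume ψ (Metric.ball 0 r) = ENNReal.ofReal (ballVolume ψ e r (0, 1)) := by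
      rw [← weightedVolume_image_affine hψ e one_pos]
      simp
    filter_upwards [Ioo_mem_nhds (neg_lt_zero.2 hε) hε] with t ht
    rw [weightedVolume_image_affine hψ e (hlt t ht).2, (hlt t ht).1, h0]

theorem integral_inner_sphereMeasure (e : EuclideanSpace ℝ (Fin (n + 1))) :
    ∫ θ, inner ℝ θ e ∂(sphereMeasure (EuclideanSpace ℝ (Fin (n + 1)))) = 0 := by
  have h := isRotationInvariant_sphereMeasure (E := EuclideanSpace ℝ (Fin (n + 1)))
    (LinearIsometryEquiv.neg ℝ)
  have h1 : ∫ θ, inner ℝ θ e ∂(sphereMeasure (EuclideanSpace ℝ (Fin (n + 1)))) =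
      ∫ θ, inner ℝ (-θ) e ∂(sphereMeasure (EuclideanSpace ℝ (Fin (n + 1)))) := by
    conv_lhs => rw [← h]
    rw [integral_map (by fun_prop) (by fun_prop)]
    simp
  simp only [inner_neg_left, integral_neg] at h1
  linarith

/-- Differentiating `|R θ - t e| = l r` at time zero gives velocity `⟨θ, e⟩ + l'(0) r`. Volume
preservation makes its mean zero, and `⟨θ, e⟩` has mean zero by antipodal symmetry, so `l'(0) = 0`.
-/
theorem velocity_translation (hψ : ContDiff ℝ ∞ ψ) (hδ : ∀ x, ψ x = δ ‖x‖)
    {e : EuclideanSpace ℝ (Fin (n + 1))} {ε τ : ℝ} {l : ℝ → ℝ} {R} (hε : 0 < ε)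
    (hl : ContDiffOn ℝ ∞ l (Ioo (-ε) ε)) (hl0 : l 0 = 1) (hlpos : ∀ t ∈ Ioo (-ε) ε, 0 < l t)
    (hvol : PreservesVolume ψ (Metric.ball 0 r) (fun t x => l t • x + t • e))
    (h : IsRadialFunction r τ (fun t x => l t • x + t • e) R)
    {x : EuclideanSpace ℝ (Fin (n + 1))} (hx : x ≠ 0) :
    IsRadialFunction.velocity R x = ‖x‖⁻¹ * inner ℝ x e := by
  have : NeZero (sphereMeasure (EuclideanSpace ℝ (Fin (n + 1)))) := ⟨sphereMeasure_ne_zero⟩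
  have hr := h.radius_pos
  have hnhds : Ioo (-ε) ε ∈ 𝓝 (0 : ℝ) := Ioo_mem_nhds (neg_lt_zero.2 hε) hε
  obtain ⟨l', hl'⟩ : ∃ l', HasDerivAt l l' 0 :=
    ⟨_, ((hl.contDiffAt hnhds).differentiableAt (by simp)).hasDerivAt⟩
  have hunit : ∀ θ : EuclideanSpace ℝ (Fin (n + 1)), ‖θ‖ = 1 →
      IsRadialFunction.velocity R θ = inner ℝ θ e + l' * r := by
    intro θ hθ
    have hθ0 : θ ≠ 0 := by
      rintro rfl
      simp at hθ
    have hR := (h.hasJetAt hθ0).hasDerivAt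
    have heq : (fun t => R (t, θ) ^ 2 - 2 * t * R (t, θ) * inner ℝ θ e + t ^ 2 * ‖e‖ ^ 2) =ᶠ[𝓝 0]
        fun t => (l t * r) ^ 2 := by
      filter_upwards [hnhds, isOpen_Ioo.mem_nhds h.zero_mem] with t ht1 ht2
      have hf := h.frontier_image t ht2
      rw [image_ball_affine (hlpos t ht1), frontier_ball _ (mul_pos (hlpos t ht1) hr).ne'] at hf
      have hm : R (t, θ) • θ ∈ Metric.sphere (t • e) (l t * r) := by
        rw [hf]
        exact ⟨θ, by simpa using hθ, rfl⟩
      rw [mem_sphere_iff_norm] at hm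
      rw [← hm, norm_sub_sq_real, norm_smul, norm_smul, hθ, inner_smul_left, inner_smul_right]
      simp only [mul_pow, Real.norm_eq_abs, sq_abs, conj_trivial]
      ring
    have hz := h.zero θ
    have d1 : HasDerivAt (fun t => R (t, θ) ^ 2 - 2 * t * R (t, θ) * inner ℝ θ e + t ^ 2 * ‖e‖ ^ 2)
        (2 * r * IsRadialFunction.velocity R θ - 2 * r * inner ℝ θ e) 0 := by
      refine (((hR.pow 2).sub ((((hasDerivAt_id (0 : ℝ)).const_mul 2).mul hR).mul_const
        (inner ℝ θ e))).add ((hasDerivAt_pow 2 (0 : ℝ)).mul_const (‖e‖ ^ 2))).congr_deriv ?_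
      simp [hz]
    have d2 : HasDerivAt (fun t => (l t * r) ^ 2) (2 * r * (l' * r)) 0 := by
      refine ((hl'.mul_const r).pow 2).congr_deriv ?_
      simp [hl0]
    have h3 := d1.unique (d2.congr_of_eventuallyEq heq)
    have h4 : 2 * r * (IsRadialFunction.velocity R θ - (inner ℝ θ e + l' * r)) = 0 := by linarith
    have := (mul_eq_zero.1 h4).resolve_left (by positivity)
    linarith
  have hmean := (h.integral_velocity_acceleration hψ hδ hvol).1
  have hli : l' = 0 := by
    rw [setIntegral_congr_fun Metric.isClosed_sphere.measurableSet
      (g := fun θ => inner ℝ θ e + l' * r) (fun θ hθ => hunit θ (by simpa using hθ))] at hmean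
    have hi := continuousOn_sphere_integrable (X := EuclideanSpace ℝ (Fin (n + 1)))
      (f := fun θ => inner ℝ θ e) (by fun_prop)
    rw [integral_add hi (integrable_const _), sphereMeasure_restrict,
      integral_inner_sphereMeasure, zero_add, integral_const, smul_eq_mul] at hmean
    have h5 := (mul_eq_zero.1 hmean).resolve_left measureReal_univ_pos.ne'
    exact (mul_eq_zero.1 h5).resolve_right hr.ne'
  have hxn := norm_ne_zero_iff.2 hx
  rw [← h.velocity_smul (inv_pos.2 (norm_pos_iff.2 hx)) x, hunit _ (by
    rw [norm_smul, norm_inv, norm_norm, inv_mul_cancel₀ hxn]), hli, inner_smul_left]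
  simp

/-- At a unit vector the gradient of `⟨x, e⟩ / |x|` is the tangential part `e - ⟨θ, e⟩ θ` of `e`. -/
theorem norm_sq_fderiv_inner_div_norm {e θ : EuclideanSpace ℝ (Fin (n + 1))} (he : ‖e‖ = 1)
    (hθ : ‖θ‖ = 1) {u : EuclideanSpace ℝ (Fin (n + 1)) → ℝ}
    (hu : ∀ x ≠ 0, u x = ‖x‖⁻¹ * inner ℝ x e) :
    ‖fderiv ℝ u θ‖ ^ 2 = 1 - inner ℝ θ e ^ 2 := by
  have hθ0 : θ ≠ 0 := by
    rintro rfl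
    simp at hθ
  have hnorm : HasFDerivAt (fun x : EuclideanSpace ℝ (Fin (n + 1)) => ‖x‖) (innerSL ℝ θ) θ := by
    have := (hasStrictFDerivAt_norm_sq θ).hasFDerivAt.sqrt (by simpa using hθ0)
    simp only [Real.sqrt_sq (norm_nonneg _)] at this
    refine this.congr_fderiv ?_
    ext v
    simp [hθ]
  have hinn : HasFDerivAt (fun x : EuclideanSpace ℝ (Fin (n + 1)) => inner ℝ x e)
      (innerSL ℝ e) θ := by
    exact (innerSL ℝ e).hasFDerivAt.congr_of_eventuallyEq
      (Eventually.of_forall fun x => real_inner_comm _ _)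
  have hinv : HasFDerivAt (fun x : EuclideanSpace ℝ (Fin (n + 1)) => ‖x‖⁻¹) (-innerSL ℝ θ) θ := by
    have := (hasDerivAt_inv (by simp [hθ] : ‖θ‖ ≠ 0)).comp_hasFDerivAt θ hnorm
    refine this.congr_fderiv ?_
    simp [hθ]
  have hD : HasFDerivAt u (innerSL ℝ (e - (inner ℝ θ e : ℝ) • θ)) θ := by
    have h1 : HasFDerivAt u _ θ := (hinv.mul hinn).congr_of_eventuallyEq (by
      filter_upwards [isOpen_compl_singleton.mem_nhds hθ0] with x hx using hu x hx)
    refine h1.congr_fderiv ?_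
    ext v
    simp [hθ]
    ring
  rw [hD.fderiv, innerSL_apply_norm, norm_sub_sq_real, he, inner_smul_right, norm_smul, hθ,
    real_inner_comm]
  simp only [Real.norm_eq_abs, mul_one, sq_abs]
  ring

/-- Translations detect the sign of the second derivative of the log-density. -/
theorem iteratedDeriv_radialProfile_nonneg (hψ : ContDiff ℝ ∞ ψ) (hδ : ∀ x, ψ x = δ ‖x‖)
    (hr : 0 < r) (hs : IsStableRegion ψ (Metric.ball 0 r)) :
    0 ≤ iteratedDeriv 2 (radialProfile ψ) r := by
  have : NeZero (sphereMeasure (EuclideanSpace ℝ (Fin (n + 1)))) := ⟨sphereMeasure_ne_zero⟩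
  obtain ⟨c, hc0, hct, hc⟩ := exists_restrict_euclideanHausdorffMeasure_sphere n
  set σ := sphereMeasure (EuclideanSpace ℝ (Fin (n + 1))) with hσ
  set b := EuclideanSpace.basisFun (Fin (n + 1)) ℝ
  set d := iteratedDeriv 2 (radialProfile ψ) r
  have hint : ∀ e, Integrable (fun θ => (inner ℝ θ e : ℝ) ^ 2) σ := fun e => by
    have h := continuousOn_sphere_integrable (X := EuclideanSpace ℝ (Fin (n + 1)))
      (f := fun θ => (inner ℝ θ e : ℝ) ^ 2) (by fun_prop)
    rwa [IntegrableOn, sphereMeasure_restrict] at h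
  have key : ∀ i, 0 ≤ (d - n / r ^ 2) * (∫ θ, (inner ℝ θ (b i) : ℝ) ^ 2 ∂σ) +
      (∫ θ, (1 - (inner ℝ θ (b i) : ℝ) ^ 2) ∂σ) / r ^ 2 := by
    intro i
    obtain ⟨ε, hε, l, hl, hl0, hlpos, hvar, hvol⟩ := exists_translation_variation hψ hδ (b i) hr
    obtain ⟨τ, R, h⟩ := hvar.exists_isRadialFunction hr
    obtain ⟨a, ha⟩ := h.second_variation hψ hδ hvol hc
    have hpos := (hs.2 ε _ hvar hvol).2
    rw [ha.iteratedDeriv_eq] at hpos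
    have hcA : 0 < c.toReal * areaDensity ψ r :=
      mul_pos (ENNReal.toReal_pos hc0 hct) (areaDensity_pos hr)
    have hv : ∀ x ≠ 0, IsRadialFunction.velocity R x = ‖x‖⁻¹ * inner ℝ x (b i) := fun x hx =>
      velocity_translation hψ hδ hε hl hl0 hlpos hvol h hx
    have e1 : ∫ θ, IsRadialFunction.velocity R θ ^ 2 ∂σ = ∫ θ, (inner ℝ θ (b i) : ℝ) ^ 2 ∂σ := by
      refine integral_congr_ae ?_
      filter_upwards [ae_sphereMeasure_norm_eq_one] with θ hθ
      rw [hv θ (by rintro rfl; simp at hθ), hθ, inv_one, one_mul]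
    have e2 : ∫ θ, ‖fderiv ℝ (IsRadialFunction.velocity R) θ‖ ^ 2 ∂σ =
        ∫ θ, (1 - (inner ℝ θ (b i) : ℝ) ^ 2) ∂σ := by
      refine integral_congr_ae ?_
      filter_upwards [ae_sphereMeasure_norm_eq_one] with θ hθ
      exact norm_sq_fderiv_inner_div_norm (b.orthonormal.1 i) hθ hv
    rw [e1, e2] at hpos
    exact nonneg_of_mul_nonneg_right hpos hcA
  -- Summing over the basis avoids computing the second moments individually: pointwise, the squares
  -- add up to `1` and the squared gradients to `n`, so the terms in `n / r ^ 2` cancel.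
  have hsum : ∑ i, ∫ θ, (inner ℝ θ (b i) : ℝ) ^ 2 ∂σ = σ.real univ := by
    rw [← integral_finsetSum _ fun i _ => hint (b i)]
    have : ∀ᵐ θ ∂σ, ∑ i, (inner ℝ θ (b i) : ℝ) ^ 2 = 1 := by
      filter_upwards [ae_sphereMeasure_norm_eq_one] with θ hθ
      have := b.sum_sq_norm_inner_left θ
      simpa [hθ] using this
    rw [integral_congr_ae this]
    simp
  have htot := Finset.sum_nonneg fun i (_ : i ∈ Finset.univ) => key i
  simp_rw [integral_sub (integrable_const (1 : ℝ)) (hint _)] at htot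
  rw [Finset.sum_add_distrib, ← Finset.mul_sum, ← Finset.sum_div, Finset.sum_sub_distrib, hsum]
    at htot
  have hS : 0 < σ.real univ := measureReal_univ_pos
  have e : (d - n / r ^ 2) * σ.real univ +
      (∑ _i : Fin (n + 1), ∫ _θ, (1 : ℝ) ∂σ - σ.real univ) / r ^ 2 = d * σ.real univ := by
    simp only [integral_const, smul_eq_mul, mul_one, Finset.sum_const, Finset.card_univ,
      Fintype.card_fin, nsmul_eq_mul]
    push_cast
    ring
  rw [e] at htot
  exact nonneg_of_mul_nonneg_left htot hS

end Translations

theorem iteratedDeriv_two_nonneg_of_convexOn {f : ℝ → ℝ} (hf : ConvexOn ℝ univ f)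
    (hd : Differentiable ℝ f) (x : ℝ) : 0 ≤ iteratedDeriv 2 f x := by
  have hm : Monotone (deriv f) := by
    rw [← monotoneOn_univ]
    exact hf.monotoneOn_deriv fun x _ => hd x
  rw [iteratedDeriv_succ, iteratedDeriv_one]
  exact hm.deriv_nonneg

theorem theorem3p8 (n : ℕ) (ψ : EuclideanSpace ℝ (Fin (n + 1)) → ℝ) (δ : ℝ → ℝ)
    (hψ : ContDiff ℝ ∞ ψ) (hδ : ∀ x, ψ x = δ ‖x‖) :
    (∀ r : ℝ, 0 < r → (IsStableRegion ψ (Metric.ball 0 r) ↔ 0 ≤ iteratedDeriv 2 δ r)) ∧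
      (ConvexOn ℝ univ ψ → ∀ r : ℝ, 0 < r → IsStableRegion ψ (Metric.ball 0 r)) := by
  refine ⟨fun r hr => ?_, fun hconv r hr => ?_⟩
  -- Only the values of `δ` at nonnegative arguments are constrained. The profile along a line is
  -- smooth on all of `ℝ` and agrees with `δ` near every `r > 0`.
  · have heq : δ =ᶠ[𝓝 r] radialProfile ψ := by
      filter_upwards [lt_mem_nhds hr] with s hs
      simp [radialProfile, hδ, norm_smul, abs_of_pos hs]
    rw [heq.iteratedDeriv_eq]
    exact ⟨iteratedDeriv_radialProfile_nonneg hψ hδ hr, isStableRegion_ball hψ hδ hr⟩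
  · refine isStableRegion_ball hψ hδ hr (iteratedDeriv_two_nonneg_of_convexOn ?_
      ((contDiff_radialProfile hψ).differentiable (by simp)) r)
    exact hconv.comp_linearMap
      (LinearMap.toSpanSingleton ℝ (EuclideanSpace ℝ (Fin (n + 1))) (EuclideanSpace.single 0 1))
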